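/- **Setting.** Fix $d,m\in\mathbb N$ and $\frac13<\alpha<\nu\le\frac12$; put $p=1/\alpha$, $q=p/2$. Let $T^2_1(\mathbb R^m)=1\oplus\mathbb R^m\oplus(\mathbb R^m\otimes\mathbb R^m)$ with product $(1,g^1,g^2)\otimes(1,h^1,h^2)=(1,g^1+h^1,g^1\otimes h^1+g^2+h^2)$, and let $\Omega=\mathscr C^{0,\alpha}_0(\mathbb R,T^2_1(\mathbb R^m))$ be the space of paths $\omega$ with $\omega_0=\mathbf 1$ which on every compact interval are $\alpha$-Hölder rough paths and limits of smooth paths in the $\alpha$-Hölder rough path metric, with its Borel $\sigma$-algebra. Write $(1,x_{s,t},\mathbb X_{s,t})=\omega_s^{-1}\otimes\omega_t$, $\mathbf x=(x,\mathbb X)$, and $(\theta_t\omega)_\cdot=\omega_t^{-1}\otimes\omega_{t+\cdot}$. For $I\subset\mathbb R$ let $|||\mathbf x|||_{p\text{-var},I}=\big(|||x|||^p_{p\text{-var},I}+|||\mathbb X|||^q_{q\text{-var},I}\big)^{1/p}$, the suprema being over finite increasing sequences of points of $I$. Let $0<\Delta\le1$, $t_k=k\Delta$, $\Pi=\{t_k\}_{k\ge0}$,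 $\Pi[s,t]=\Pi\cap[s,t]$. Let $\mathbb P$ be a probability measure on $\Omega$ which is invariant under every $\theta_t$, for which $\theta_\Delta$ is ergodic, and such that for every $T>0$ there is $C_{T,\nu}$ with $\mathbb E(\|x_{s,t}\|^p+\|\mathbb X_{s,t}\|^q)\le C_{T,\nu}|t-s|^{p\nu}$ for $0\le s\le t\le T$. Let $f:\mathbb R^d\to\mathbb R^d$ be $C^1$ with $L_f:=\|Df\|_\infty<\infty$ and globally dissipative: $\langle y,f(y)\rangle\le D_1-D_2\|y\|^2$ for all $y$, where $D_1,D_2>0$. Let $g\in C^3_b(\mathbb R^d,L(\mathbb R^m,\mathbb R^d))$, with $$L_g=\max\Big\{\|Dg\|_\infty,\|D^2g\|_\infty,\big[\|g\|_\infty(\|Dg\|_\infty\vee\|D^2g\|_\infty\vee\|D^3g\|_\infty)\big]^{1/2},\big(\|g\|_\infty^2\|D^3g\|_\infty\big)^{1/3}\Big\},$$ and $\|g\|_{C^3_b}=\sum_{k=0}^3\|D^kg\|_\infty$. The scheme is $$y_{t_{k+1}}=y_{t_k}+f(y_{t_k})\Delta+g(y_{t_k})x_{t_k,t_{k+1}}+Dg(y_{t_k})g(y_{t_k})\mathbb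 X_{t_k,t_{k+1}}.\qquad(1)$$ A *stationary solution* of (1) is a random point $\mathfrak a:\Omega\to\mathbb R^d$ such that almost surely $t_k\mapsto\mathfrak a(\theta_{t_k}\omega)$ solves (1) with initial value $\mathfrak a(\omega)$. Put $\ell(f,\hat y)=\lim_{r\to0}\sup_{0<\|y-\hat y\|<r}\langle y-\hat y,f(y)-f(\hat y)\rangle/\|y-\hat y\|^2$ and $-\eta=\mathbb E\,\ell(f,\mathfrak a)+\frac12L_f^2\Delta$. Let $C_p>1$ (for instance the constant of the $p$-variation estimate for the rough integral), $\lambda\in(0,\frac12)$, $\gamma^*\in(0,1)$, and $$K=5(1+\lambda)(1+2C_p)^2e^{12\lambda+2\lambda^2}\vee\tfrac32e^{6L_f\Delta}.$$ For a two-parameter function $W$ and $\gamma>0$ let $\tau_0=0$, $\tau_{i+1}=\inf\{t>\tau_i:W_{\tau_i,t}\ge\gamma\}\wedge1$, and count $N^*=\sup\{i:\tau_i<1\}+1$. Let $N^*(\gamma^*,\mathbf x,[0,1])$ be this number for $W_{s,t}=|||\mathbf x|||_{p\text{-var},[s,t]}$, $\gamma=\gamma^*$, and $N^*(\lambda,\mathcal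 S,[0,1])$ the one for $\gamma=\lambda$ and $W=\sum_{\mathbf w\in\mathcal S}\mathbf w^{\beta_{\mathbf w}}$, where $\mathcal S$ consists of $\mathbf w^{(1)}_{s,t}=L_f(t-s)$ ($\beta=1$), $\mathbf w^{(2)}_{s,t}=(4C_p+1)^pL_g^p|||x|||^p_{p\text{-var},\Pi[s,t]}$ ($\beta=\frac1p$), $\mathbf w^{(3)}_{s,t}=(4C_p+1)^pL_g^p|||\mathbb X|||^q_{q\text{-var},\Pi[s,t]}$ ($\beta=\frac1q$), $\mathbf w^{(4)}_{s,t}=2\lambda\sup_{u\in\Pi[s,t]}\|f(\mathfrak a(\theta_u\omega))\|(t-s)$ ($\beta=1$). **Theorem.** For given $d,m,\alpha,C_p$ there are $\Delta^*=\Delta^*(L_f,D_2)>0$ and a constant $\bar\Gamma=\bar\Gamma(L_f,\|f(0)\|,D_1,D_2,\|g\|_{C^3_b},\lambda,\gamma^*)>0$, nondecreasing in $\|g\|_{C^3_b}$, such that for all data as above and every stationary solution $\mathfrak a$ of (1): 1. if $\Delta<\Delta^*$, then $\mathbb E N^*(\gamma^*,\mathbf x,[0,1])+2\,\mathbb E N^*(\lambda,\mathcal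 S,[0,1])\le\bar\Gamma\big[1+\mathbb E|||\mathbf x|||^{p(p+2)}_{p\text{-var},[0,1]}\big]$; 2. (for every $0<\Delta\le1$) if $\eta>0$ and $$\eta>K\,\bar\Gamma\,L_g\Big[1+\mathbb E|||\mathbf x|||^{p(p+2)}_{p\text{-var},[0,1]}\Big]$$ (in $[0,\infty]$, with $0\cdot\infty=0$), then $\mathfrak a$ is almost surely exponentially stable: for every $\varepsilon>0$ there is a positive random variable $r$ such that almost surely $\|y_0-\mathfrak a(\omega)\|<r(\omega)$ implies $\sup_k\|y_{t_k}-\mathfrak a(\theta_{t_k}\omega)\|<\varepsilon$; and there are positive random variables $r,A$ and a non-random $\mu>0$ such that almost surely $\|y_0-\mathfrak a(\omega)\|<r(\omega)$ implies $\|y_{t_k}-\mathfrak a(\theta_{t_k}\omega)\|\le A(\omega)e^{-\mu t_k}$ for all $k\ge0$, where $y$ is the solution of (1) started at $y_0$. -/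

import Mathlib

open Set Filter Topology MeasureTheory
open scoped ENNReal ContDiff

noncomputable section

namespace RoughEuler

/-- Euclidean space `ℝⁿ`. -/
abbrev E (n : ℕ) : Type := EuclideanSpace ℝ (Fin n)

/-- `ℝᵐ ⊗ ℝᵐ`, as arrays `(A i j)` with the Hilbert-Schmidt norm. -/
abbrev E2 (m : ℕ) : Type := EuclideanSpace ℝ (Fin m × Fin m)

/-- The tensor `x ⊗ y`. -/
def tens {m : ℕ} (x y : E m) : E2 m := WithLp.toLp 2 (fun ij => x ij.1 * y ij.2)

/-! ### The group `T²₁(ℝᵐ) = 1 ⊕ ℝᵐ ⊕ (ℝᵐ ⊗ ℝᵐ)` -/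

/-- Elements `(1, g¹, g²)` of `T²₁(ℝᵐ)`. -/
@[ext] structure T2 (m : ℕ) where
  lvl1 : E m
  lvl2 : E2 m

instance (m : ℕ) : Mul (T2 m) :=
  ⟨fun g h => ⟨g.lvl1 + h.lvl1, tens g.lvl1 h.lvl1 + g.lvl2 + h.lvl2⟩⟩

instance (m : ℕ) : One (T2 m) := ⟨⟨0, 0⟩⟩

instance (m : ℕ) : Inv (T2 m) :=
  ⟨fun g => ⟨-g.lvl1, tens g.lvl1 g.lvl1 - g.lvl2⟩⟩

theorem T2.mul_lvl1 {m : ℕ} (g h : T2 m) : (g * h).lvl1 = g.lvl1 + h.lvl1 := rfl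

theorem T2.mul_lvl2 {m : ℕ} (g h : T2 m) :
    (g * h).lvl2 = tens g.lvl1 h.lvl1 + g.lvl2 + h.lvl2 := rfl

theorem T2.one_lvl1 {m : ℕ} : (1 : T2 m).lvl1 = 0 := rfl

theorem T2.one_lvl2 {m : ℕ} : (1 : T2 m).lvl2 = 0 := rfl

theorem T2.inv_lvl1 {m : ℕ} (g : T2 m) : (g⁻¹).lvl1 = -g.lvl1 := rfl

theorem T2.inv_lvl2 {m : ℕ} (g : T2 m) : (g⁻¹).lvl2 = tens g.lvl1 g.lvl1 - g.lvl2 := rfl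

instance (m : ℕ) : Group (T2 m) :=
  Group.ofLeftAxioms
    (by
      intro a b c
      ext i
      · simp only [T2.mul_lvl1, PiLp.add_apply]; ring
      · simp only [T2.mul_lvl1, T2.mul_lvl2, PiLp.add_apply, tens]; ring)
    (by
      intro a
      ext i
      · simp [T2.mul_lvl1, T2.one_lvl1]
      · simp [T2.mul_lvl2, T2.one_lvl1, T2.one_lvl2, tens])
    (by
      intro a
      ext i
      · simp [T2.mul_lvl1, T2.inv_lvl1, T2.one_lvl1]
      · simp [T2.mul_lvl2, T2.inv_lvl1, T2.inv_lvl2, T2.one_lvl2, tens]; ring)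

/-- The increment `ω_s⁻¹ ⊗ ω_t = (1, x_{s,t}, 𝕏_{s,t})` of a path in `T²₁(ℝᵐ)`. -/
def inc {m : ℕ} (w : ℝ → T2 m) (s t : ℝ) : T2 m := (w s)⁻¹ * w t

/-- Chen's relation `𝕏_{s,t} - 𝕏_{s,u} - 𝕏_{u,t} = x_{s,u} ⊗ x_{u,t}` holds for the increments. -/
theorem inc_chen {m : ℕ} (w : ℝ → T2 m) (s u t : ℝ) :
    (inc w s t).lvl2 - (inc w s u).lvl2 - (inc w u t).lvl2
      = tens (inc w s u).lvl1 (inc w u t).lvl1 := by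
  have h : inc w s t = inc w s u * inc w u t := by simp [inc, mul_assoc]
  rw [h, T2.mul_lvl2]
  abel

/-! ### The canonical space of rough paths and the Wiener-type shift -/

/-- `w` is an `a`-Hölder rough path on every compact interval. -/
def LocallyHolder {m : ℕ} (a : ℝ) (w : ℝ → T2 m) : Prop :=
  ∀ R : ℝ, 0 < R → ∃ C : ℝ, ∀ s ∈ Icc (-R) R, ∀ t ∈ Icc (-R) R,
    ‖(inc w s t).lvl1‖ ≤ C * |t - s| ^ a ∧ ‖(inc w s t).lvl2‖ ≤ C * |t - s| ^ (2 * a)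

/-- On every compact interval `w` is a limit, in the `a`-Hölder rough path metric,
of smooth paths in `T²₁(ℝᵐ)`. -/
def InSmoothClosure {m : ℕ} (a : ℝ) (w : ℝ → T2 m) : Prop :=
  ∀ R : ℝ, 0 < R → ∀ ε : ℝ, 0 < ε → ∃ v : ℝ → T2 m,
    ContDiff ℝ ∞ (fun t => (v t).lvl1) ∧ ContDiff ℝ ∞ (fun t => (v t).lvl2) ∧
    ∀ s ∈ Icc (-R) R, ∀ t ∈ Icc (-R) R,
      ‖(inc w s t).lvl1 - (inc v s t).lvl1‖ ≤ ε * |t - s| ^ a ∧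
      ‖(inc w s t).lvl2 - (inc v s t).lvl2‖ ≤ ε * |t - s| ^ (2 * a)

/-- The space `𝒞₀^{0,a}(ℝ, T²₁(ℝᵐ))`. -/
def PathSpace (m : ℕ) (a : ℝ) : Type :=
  {w : ℝ → T2 m // w 0 = 1 ∧ LocallyHolder a w ∧ InSmoothClosure a w}

/-- The σ-algebra generated by the evaluations; as the path space is separable, this is the
Borel σ-algebra of the Hölder topology. -/
instance (m : ℕ) (a : ℝ) : MeasurableSpace (PathSpace m a) :=
  ⨆ t : ℝ, MeasurableSpace.comap (fun w : PathSpace m a => (w.1 t).lvl1) inferInstance ⊔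
    MeasurableSpace.comap (fun w : PathSpace m a => (w.1 t).lvl2) inferInstance

theorem inc_shift {m : ℕ} (w : ℝ → T2 m) (t r s : ℝ) :
    inc (fun u => (w t)⁻¹ * w (t + u)) r s = inc w (t + r) (t + s) := by
  simp [inc, mul_assoc]

/-- The Wiener-type shift `(θ_t ω)_s = ω_t⁻¹ ⊗ ω_{t+s}`. -/
def shift {m : ℕ} {a : ℝ} (t : ℝ) (w : PathSpace m a) : PathSpace m a :=
  ⟨fun s => (w.1 t)⁻¹ * w.1 (t + s), by
    have key : ∀ R : ℝ, ∀ s ∈ Icc (-R) R, t + s ∈ Icc (-(R + |t|)) (R + |t|) := by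
      intro R s hs
      have h1 := neg_abs_le t
      have h2 := le_abs_self t
      exact ⟨by linarith [hs.1], by linarith [hs.2]⟩
    refine ⟨by simp, ?_, ?_⟩
    · intro R hR
      obtain ⟨C, hC⟩ := w.2.2.1 (R + |t|) (by positivity)
      refine ⟨C, fun r hr s hs => ?_⟩
      have h := hC (t + r) (key R r hr) (t + s) (key R s hs)
      rw [inc_shift]
      simpa using h
    · intro R hR ε hε
      obtain ⟨v, h1, h2, hv⟩ := w.2.2.2 (R + |t|) (by positivity) ε hε
      refine ⟨fun s => v (t + s), h1.comp (contDiff_const.add contDiff_id),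
        h2.comp (contDiff_const.add contDiff_id), fun r hr s hs => ?_⟩
      have h := hv (t + r) (key R r hr) (t + s) (key R s hs)
      rw [inc_shift]
      simpa [inc] using h⟩

/-! ### Variation norms -/

/-- `sup ∑ᵢ ‖A_{tᵢ,tᵢ₊₁}‖^r` over finite nondecreasing sequences `(tᵢ)` of points of `s`, that is
the `r`-th power of the `r`-variation seminorm of `A` over `s`. -/
def varPow {F : Type*} [NormedAddCommGroup F] (r : ℝ) (A : ℝ → ℝ → F) (s : Set ℝ) : ℝ≥0∞ :=
  ⨆ u : ℕ × {u : ℕ → ℝ // Monotone u ∧ ∀ i, u i ∈ s},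
    ∑ i ∈ Finset.range u.1, ‖A (u.2.1 i) (u.2.1 (i + 1))‖ₑ ^ r

/-- The `p`-th power of the `p`-variation of `x` over `s`, `p = 1 / a`. -/
def xVarPow {m : ℕ} {a : ℝ} (w : PathSpace m a) (s : Set ℝ) : ℝ≥0∞ :=
  varPow (1 / a) (fun u v => (inc w.1 u v).lvl1) s

/-- The `q`-th power of the `q`-variation of `𝕏` over `s`, `q = p / 2`, `p = 1 / a`. -/
def xxVarPow {m : ℕ} {a : ℝ} (w : PathSpace m a) (s : Set ℝ) : ℝ≥0∞ :=
  varPow (1 / a / 2) (fun u v => (inc w.1 u v).lvl2) s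

/-- The rough path seminorm `(|||x|||_{p-var}^p + |||𝕏|||_{q-var}^q)^{1/p}` over `s`. -/
def roughVar {m : ℕ} {a : ℝ} (w : PathSpace m a) (s : Set ℝ) : ℝ≥0∞ :=
  (xVarPow w s + xxVarPow w s) ^ a

/-- `𝔼 |||𝐱|||^{p(p+2)}_{p-var,[0,1]}`, `p = 1 / a`. -/
def roughMoment {m : ℕ} {a : ℝ} (P : Measure (PathSpace m a)) : ℝ≥0∞ :=
  ∫⁻ w, roughVar w (Icc 0 1) ^ (1 / a * (1 / a + 2)) ∂P

/-! ### The driving noise -/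

/-- `𝔼(‖x_{s,t}‖^p + ‖𝕏_{s,t}‖^q) ≤ C_{T,ν} |t - s|^{pν}` on every `[0,T]`. -/
def MomentBound {m : ℕ} {a : ℝ} (P : Measure (PathSpace m a)) (nu : ℝ) : Prop :=
  ∀ T : ℝ, 0 < T → ∃ C : ℝ, ∀ s ∈ Icc 0 T, ∀ t ∈ Icc 0 T, s ≤ t →
    ∫⁻ w, (‖(inc w.1 s t).lvl1‖ₑ ^ (1 / a) + ‖(inc w.1 s t).lvl2‖ₑ ^ (1 / a / 2)) ∂P
      ≤ ENNReal.ofReal (C * |t - s| ^ (1 / a * nu))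

/-- The increments are stationary: the shift preserves the law. -/
def StationaryIncrements {m : ℕ} {a : ℝ} (P : Measure (PathSpace m a)) : Prop :=
  ∀ t : ℝ, MeasurePreserving (shift t) P P

/-! ### The coefficients -/

/-- `‖Df‖_∞`. -/
def Lf {d : ℕ} (f : E d → E d) : ℝ := ⨆ y, ‖fderiv ℝ f y‖

/-- `f` is `C¹` with `‖Df‖_∞ < ∞`. -/
def DriftRegular {d : ℕ} (f : E d → E d) : Prop :=
  ContDiff ℝ 1 f ∧ BddAbove (range fun y => ‖fderiv ℝ f y‖)

/-- Global dissipativity with constants `D₁, D₂`. -/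
def Dissipative {d : ℕ} (f : E d → E d) (D₁ D₂ : ℝ) : Prop :=
  ∀ y, inner ℝ y (f y) ≤ D₁ - D₂ * ‖y‖ ^ 2

/-- `g ∈ C³_b(ℝᵈ, L(ℝᵐ, ℝᵈ))`. -/
def C3b {d m : ℕ} (g : E d → (E m →L[ℝ] E d)) : Prop :=
  ContDiff ℝ 3 g ∧ ∀ k : ℕ, k ≤ 3 → BddAbove (range fun y => ‖iteratedFDeriv ℝ k g y‖)

/-- `‖Dᵏg‖_∞`. -/
def supD {d m : ℕ} (k : ℕ) (g : E d → (E m →L[ℝ] E d)) : ℝ := ⨆ y, ‖iteratedFDeriv ℝ k g y‖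

/-- `‖g‖_{C³_b}`. -/
def normC3b {d m : ℕ} (g : E d → (E m →L[ℝ] E d)) : ℝ := ∑ k ∈ Finset.range 4, supD k g

/-- `L_g = max {‖Dg‖, ‖D²g‖, [‖g‖ (‖Dg‖ ∨ ‖D²g‖ ∨ ‖D³g‖)]^{1/2}, (‖g‖² ‖D³g‖)^{1/3}}`. -/
def Lg {d m : ℕ} (g : E d → (E m →L[ℝ] E d)) : ℝ :=
  max (max (supD 1 g) (supD 2 g))
    (max (Real.sqrt (supD 0 g * max (max (supD 1 g) (supD 2 g)) (supD 3 g)))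
      ((supD 0 g ^ 2 * supD 3 g) ^ (1 / 3 : ℝ)))

/-- `ℓ(f, z, r) = sup_{0 < ‖y - z‖ < r} ⟨y - z, f(y) - f(z)⟩ / ‖y - z‖²`. -/
def ellr {d : ℕ} (f : E d → E d) (z : E d) (r : ℝ) : ℝ :=
  sSup {c | ∃ y, 0 < ‖y - z‖ ∧ ‖y - z‖ < r ∧ c = inner ℝ (y - z) (f y - f z) / ‖y - z‖ ^ 2}

/-- The local one-sided Lipschitz constant `ℓ(f, z) = lim_{r → 0} ℓ(f, z, r)`. -/
def ell {d : ℕ} (f : E d → E d) (z : E d) : ℝ := limUnder (𝓝[>] (0 : ℝ)) (ellr f z)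

/-! ### The discretization scheme, stationary solutions and stability -/

/-- One step `y ↦ y + f(y)Δ + g(y) x_{s,t} + Dg(y)g(y) 𝕏_{s,t}`, where `X = (1, x_{s,t}, 𝕏_{s,t})`
and `Dg(y)g(y)𝕏 = ∑_{i,j} 𝕏^{ij} (Dg(y)[g(y)eᵢ]) eⱼ`. -/
def eulerStep {d m : ℕ} (f : E d → E d) (g : E d → (E m →L[ℝ] E d)) (Δ : ℝ) (X : T2 m)
    (y : E d) : E d :=
  y + Δ • f y + g y X.lvl1 +
    ∑ i : Fin m, ∑ j : Fin m, X.lvl2 (i, j) •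
      (fderiv ℝ g y (g y (EuclideanSpace.single i 1))) (EuclideanSpace.single j 1)

/-- The solution `y_{t_k}`, `t_k = kΔ`, of the scheme driven by `w` and started at `y₀`. -/
def eulerSol {d m : ℕ} {a : ℝ} (f : E d → E d) (g : E d → (E m →L[ℝ] E d)) (Δ : ℝ)
    (w : PathSpace m a) (y₀ : E d) : ℕ → E d
  | 0 => y₀
  | k + 1 => eulerStep f g Δ (inc w.1 (k * Δ) ((k + 1) * Δ)) (eulerSol f g Δ w y₀ k)

/-- The random point `z` is a stationary solution: `t ↦ z(θ_t ω)`, `t ∈ Δℕ`, solves the scheme. -/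
def IsStationarySol {d m : ℕ} {a : ℝ} (P : Measure (PathSpace m a)) (f : E d → E d)
    (g : E d → (E m →L[ℝ] E d)) (Δ : ℝ) (z : PathSpace m a → E d) : Prop :=
  Measurable z ∧ ∀ᵐ w ∂P, ∀ k : ℕ, z (shift (k * Δ) w) = eulerSol f g Δ w (z w) k

/-- Lyapunov stability of the stationary solution `z` on the time set `Δℕ`, almost surely. -/
def IsStable {d m : ℕ} {a : ℝ} (P : Measure (PathSpace m a)) (f : E d → E d)
    (g : E d → (E m →L[ℝ] E d)) (Δ : ℝ) (z : PathSpace m a → E d) : Prop :=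
  ∀ ε : ℝ, 0 < ε → ∃ r : PathSpace m a → ℝ, Measurable r ∧ (∀ w, 0 < r w) ∧
    ∀ᵐ w ∂P, ∀ y₀ : E d, ‖y₀ - z w‖ < r w →
      ⨆ k : ℕ, ‖eulerSol f g Δ w y₀ k - z (shift (k * Δ) w)‖ₑ < ENNReal.ofReal ε

/-- Exponential stability of the stationary solution `z` on the time set `Δℕ`, almost surely;
the rate `μ` is not random. -/
def IsExpStable {d m : ℕ} {a : ℝ} (P : Measure (PathSpace m a)) (f : E d → E d)
    (g : E d → (E m →L[ℝ] E d)) (Δ : ℝ) (z : PathSpace m a → E d) : Prop :=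
  IsStable P f g Δ z ∧
  ∃ r A : PathSpace m a → ℝ, Measurable r ∧ Measurable A ∧ (∀ w, 0 < r w) ∧ (∀ w, 0 < A w) ∧
    ∃ μ : ℝ, 0 < μ ∧ ∀ᵐ w ∂P, ∀ y₀ : E d, ‖y₀ - z w‖ < r w →
      ∀ k : ℕ, ‖eulerSol f g Δ w y₀ k - z (shift (k * Δ) w)‖ ≤ A w * Real.exp (-μ * (k * Δ))

/-! ### Greedy stopping times -/

/-- Greedy times on `[b, c]`: `τ₀ = b`, `τᵢ₊₁ = inf {t > τᵢ : W(τᵢ, t) ≥ γ} ∧ c`. -/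
def greedy (W : ℝ → ℝ → ℝ≥0∞) (γ b c : ℝ) : ℕ → ℝ
  | 0 => b
  | i + 1 => sInf ({t | greedy W γ b c i < t ∧ ENNReal.ofReal γ ≤ W (greedy W γ b c i) t} ∪ {c})

/-- `N* = sup {i : τᵢ < c} + 1`. -/
def greedyCount (W : ℝ → ℝ → ℝ≥0∞) (γ b c : ℝ) : ℝ≥0∞ :=
  ⨆ (i : ℕ) (_ : greedy W γ b c i < c), ((i : ℝ≥0∞) + 1)

/-- `N*(γ, 𝐱, [0,1])`. -/
def Nstar {m : ℕ} {a : ℝ} (γ : ℝ) (w : PathSpace m a) : ℝ≥0∞ :=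
  greedyCount (fun s t => roughVar w (Icc s t)) γ 0 1

/-- `Π[s,t]`, the points of the grid `Δℕ` in `[s,t]`. -/
def grid (Δ s t : ℝ) : Set ℝ := {u | (∃ k : ℕ, u = k * Δ) ∧ s ≤ u ∧ u ≤ t}

/-- The sum `∑ 𝐰^{β_𝐰}` over the controls, with `p = 1 / a`, `q = p / 2`,
`w¹ = L_f (t - s)`, `β₁ = 1`;
`w² = (4C_p+1)^p L_g^p |||x|||^p_{p-var,Π[s,t]}`, `β₂ = 1/p`;
`w³ = (4C_p+1)^p L_g^p |||𝕏|||^q_{q-var,Π[s,t]}`, `β₃ = 1/q`;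
`w⁴ = 2 lam ‖f(z)‖_{∞,Π[s,t]} (t - s)`, `β₄ = 1`. -/
def controlSum {d m : ℕ} {a : ℝ} (Cp lam : ℝ) (f : E d → E d) (g : E d → (E m →L[ℝ] E d))
    (Δ : ℝ) (z : PathSpace m a → E d) (w : PathSpace m a) (s t : ℝ) : ℝ≥0∞ :=
  ENNReal.ofReal (Lf f * (t - s))
    + (ENNReal.ofReal ((4 * Cp + 1) * Lg g) ^ (1 / a) * xVarPow w (grid Δ s t)) ^ a
    + (ENNReal.ofReal ((4 * Cp + 1) * Lg g) ^ (1 / a) * xxVarPow w (grid Δ s t)) ^ (2 * a)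
    + ENNReal.ofReal (2 * lam * (t - s)) * ⨆ u ∈ grid Δ s t, ‖f (z (shift u w))‖ₑ

/-- `N*(lam, 𝒮, [0,1])` for the above family `𝒮` of controls. -/
def NstarS {d m : ℕ} {a : ℝ} (Cp lam : ℝ) (f : E d → E d) (g : E d → (E m →L[ℝ] E d))
    (Δ : ℝ) (z : PathSpace m a → E d) (w : PathSpace m a) : ℝ≥0∞ :=
  greedyCount (controlSum Cp lam f g Δ z w) lam 0 1

/-! ### The quantities of the criterion -/

/-- `η = -(𝔼 ℓ(f, z) + L_f² Δ / 2)`. -/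
def eta {d m : ℕ} {a : ℝ} (P : Measure (PathSpace m a)) (f : E d → E d) (Δ : ℝ)
    (z : PathSpace m a → E d) : ℝ :=
  -((∫ w, ell f (z w) ∂P) + 1 / 2 * Lf f ^ 2 * Δ)

/-- `K = 5(1+lam)(1+2C_p)² e^{12 lam + 2 lam²} ∨ (3/2) e^{6 L Δ}`. -/
def constK (Cp lam L Δ : ℝ) : ℝ :=
  max (5 * (1 + lam) * (1 + 2 * Cp) ^ 2 * Real.exp (12 * lam + 2 * lam ^ 2))
    (3 / 2 * Real.exp (6 * L * Δ))

end RoughEuler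

end

/-! Near the stationary solution the difference `v` of two solutions is driven by the drift
difference and by a noise term that is linear in `v` up to a quadratic error. Expanding `‖v + Δ
w‖²`, with `w` the drift difference, and using `1 + 2s ≤ exp (2s)` shows that one drift step adds at
most `Δ ℓ + L² Δ² / 2` to `log ‖v‖`, where `ℓ` is the one-sided Lipschitz constant and `L = L_f`; in
the mean this is `-Δ η`. The point is to show that over a time of at most one the noise adds no more
than a constant times `L_g (1 + ϖ + M)`, where the control `ϖ` is bounded by the variation of the
rough path and `M` bounds the drift along the stationary solution, and that the mean of this cost is
bounded by a constant times `L_g (1 + roughMoment)`.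

Noise cost. Over an interval on which the control is small, `discrete_sewing` gives second order
expansions of the scheme (`norm_expRem_le`) and of its linearization, and the linearized noise flow
differs from the identity by a relative amount `L_g / (2G)` (`norm_linFlow_sub_le`). Transporting
the difference by this flow to the end of the interval removes the noise from its increments; only
the drift, perturbed by a relative error of order `L_g`, is left (`short_step`). Single steps with
large noise are estimated crudely, at a cost linear in `ϖ` (`single_step`). A greedy partition needs
a number of intervals linear in `ϖ + M`, which yields `SchemePair.growth`.

Drift bound. For a small mesh the Euler step of a dissipative drift contracts up to an additive
error. Chaining this over a time between 1/2 and 1 gives `‖z_N‖ ≤ ρ ‖z_0‖ + C (1 + ϖ)` with `ρ < 1`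
(`dissipative_block`), and invariance of the law turns it into a bound for the mean of the
stationary solution, hence of `M` (`exists_drift_bound`). For a mesh above the threshold, blocks of
a single step are used: their cost does not involve `M`, and `Δ η` is at least the threshold times
`η`.

Stability. Only the shift by one mesh step is assumed ergodic, so block costs are averaged over all
residues of the starting index, which turns a cost `Ψ` per block of `N` steps into `Ψ / N` per step
(`block_chain`). If the mean of rate plus cost is negative, a maximal ergodic argument
(`exists_birkhoff_le`) bounds the partial sums by a random constant minus a linear term. A solution
that starts close enough then stays in the neighbourhood where the local estimates hold, and decays
exponentially (`block_chain_bootstrap`).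

Counts. Two successive greedy steps use up one unit of a superadditive functional
(`greedyCount_le`), so the counts are bounded linearly by variation and `M`. Stability is not
deduced from the counts: one constant is chosen large enough for both claims, and of `K` only `K ≥
5` is used. -/

noncomputable section

namespace RoughEuler

/-! ### Discrete controls, sewing and greedy partitions -/

/-- A discrete control: nonnegative and superadditive. -/
structure IsControl (ϖ : ℕ → ℕ → ℝ) : Prop where
  nonneg : ∀ i j, 0 ≤ ϖ i j
  superadd : ∀ i u j, i ≤ u → u ≤ j → ϖ i u + ϖ u j ≤ ϖ i j

namespace IsControl

variable {ϖ ϖ' : ℕ → ℕ → ℝ}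

theorem diag (h : IsControl ϖ) (i : ℕ) : ϖ i i = 0 := by
  have h1 := h.superadd i i i le_rfl le_rfl
  have h2 := h.nonneg i i
  linarith

theorem mono (h : IsControl ϖ) {i i' j' j : ℕ} (h1 : i ≤ i') (h2 : i' ≤ j') (h3 : j' ≤ j) :
    ϖ i' j' ≤ ϖ i j := by
  have e1 := h.superadd i i' j h1 (h2.trans h3)
  have e2 := h.superadd i' j' j h2 h3
  have e3 := h.nonneg i i'
  have e4 := h.nonneg j' j
  linarith

theorem add (h : IsControl ϖ) (h' : IsControl ϖ') : IsControl (fun i j => ϖ i j + ϖ' i j) where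
  nonneg i j := add_nonneg (h.nonneg i j) (h'.nonneg i j)
  superadd i u j h1 h2 := by
    have e1 := h.superadd i u j h1 h2
    have e2 := h'.superadd i u j h1 h2
    linarith

end IsControl

/-- The constant of the discrete sewing lemma. -/
def sewC (θ : ℝ) : ℝ := 2 / (1 - 2 ^ (1 - θ))

theorem two_rpow_one_sub_lt {θ : ℝ} (hθ : 1 < θ) : (2 : ℝ) ^ (1 - θ) < 1 :=
  Real.rpow_lt_one_of_one_lt_of_neg (by norm_num) (by linarith)

theorem sewC_pos {θ : ℝ} (hθ : 1 < θ) : 0 < sewC θ :=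
  div_pos two_pos (sub_pos.2 (two_rpow_one_sub_lt hθ))

theorem sewC_eq {θ : ℝ} (hθ : 1 < θ) : 2 + sewC θ * 2 ^ (1 - θ) = sewC θ := by
  have h : (1 - (2 : ℝ) ^ (1 - θ)) ≠ 0 := (sub_pos.2 (two_rpow_one_sub_lt hθ)).ne'
  unfold sewC
  field_simp
  ring

/-- Discrete sewing lemma: a two-parameter function that vanishes on single steps and whose
additivity defect is dominated by `B ϖ ^ θ`, `θ > 1`, is dominated by a multiple of `B ϖ ^ θ`. -/
theorem discrete_sewing {F : Type*} [NormedAddCommGroup F] (J : ℕ → ℕ → F) {ϖ : ℕ → ℕ → ℝ}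
    (hϖ : IsControl ϖ) {θ B : ℝ} (hθ : 1 < θ) (hB : 0 ≤ B) (S T : ℕ)
    (h0 : ∀ i, S ≤ i → i ≤ T → J i i = 0)
    (h1 : ∀ i, S ≤ i → i + 1 ≤ T → J i (i + 1) = 0)
    (hδ : ∀ i u j, S ≤ i → i ≤ u → u ≤ j → j ≤ T → ‖J i u‖ ≤ sewC θ * B * ϖ i u ^ θ →
      ‖J i j - J i u - J u j‖ ≤ B * ϖ i j ^ θ) :
    ∀ i j, S ≤ i → i ≤ j → j ≤ T → ‖J i j‖ ≤ sewC θ * B * ϖ i j ^ θ := by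
  have hK := sewC_pos hθ
  have main : ∀ n i j, j - i = n → S ≤ i → i ≤ j → j ≤ T →
      ‖J i j‖ ≤ sewC θ * B * ϖ i j ^ θ := by
    intro n
    induction n using Nat.strong_induction_on with
    | _ n ih =>
    intro i j hn hS hij hT
    have hpos : 0 ≤ sewC θ * B * ϖ i j ^ θ := by
      have := Real.rpow_nonneg (hϖ.nonneg i j) θ
      positivity
    rcases Nat.lt_or_ge (i + 1) j with hlt | hge
    swap
    · rcases Nat.eq_or_lt_of_le hij with e | e
      · subst e
        rw [h0 i hS hT, norm_zero]; exact hpos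
      · have : j = i + 1 := by omega
        subst this
        rw [h1 i hS hT, norm_zero]; exact hpos
    -- The split point is the last index before `j` up to which at most half of the control is used.
    -- By superadditivity at most half remains after the next index, and the single step between
    -- them contributes nothing.
    let Q : ℕ → Prop := fun u => i ≤ u ∧ ϖ i u ≤ ϖ i j / 2
    classical
    have hQi : Q i := ⟨le_rfl, by rw [hϖ.diag]; linarith [hϖ.nonneg i j]⟩
    obtain ⟨hiu, hu2⟩ : Q (Nat.findGreatest Q (j - 1)) :=
      Nat.findGreatest_spec (m := i) (by omega) hQi
    have huj : Nat.findGreatest Q (j - 1) ≤ j - 1 := Nat.findGreatest_le _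
    have hgt : ∀ k, Nat.findGreatest Q (j - 1) < k → k ≤ j - 1 → ¬ Q k :=
      fun k => Nat.findGreatest_is_greatest
    generalize Nat.findGreatest Q (j - 1) = u at *
    have hv : ϖ (u + 1) j ≤ ϖ i j / 2 := by
      rcases Nat.lt_or_ge u (j - 1) with e | e
      · have h2 : ¬ Q (u + 1) := hgt (u + 1) (by omega) (by omega)
        have h3 : ϖ i j / 2 < ϖ i (u + 1) := by
          by_contra h4
          exact h2 ⟨by omega, not_lt.1 h4⟩
        have h5 := hϖ.superadd i (u + 1) j (by omega) (by omega)
        linarith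
      · have : u + 1 = j := by omega
        rw [this, hϖ.diag]; linarith [hϖ.nonneg i j]
    have half : ∀ a b, ϖ a b ≤ ϖ i j / 2 → sewC θ * B * ϖ a b ^ θ
        ≤ sewC θ * B * (ϖ i j ^ θ * (2 ^ (1 - θ) / 2)) := by
      intro a b hab
      have h2 : ϖ a b ^ θ ≤ (ϖ i j / 2) ^ θ :=
        Real.rpow_le_rpow (hϖ.nonneg a b) hab (by linarith)
      rw [Real.div_rpow (hϖ.nonneg i j) two_pos.le] at h2
      have h3 : (2 : ℝ) ^ (1 - θ) / 2 = 1 / 2 ^ θ := by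
        rw [Real.rpow_sub two_pos, Real.rpow_one]
        field_simp
      rw [h3, mul_one_div]
      gcongr
    have a1 := (ih (u - i) (by omega) i u rfl hS hiu (by omega))
    have b1 := (ih (j - (u + 1)) (by omega) (u + 1) j rfl (by omega) (by omega) hT).trans
      (half _ _ hv)
    have c1 := hδ i u j hS hiu (by omega) hT a1
    have z := h1 u (by omega) (by omega)
    -- The left part of this second splitting is a single step, where `J` vanishes, so the a priori
    -- bound demanded by `hδ` is free.
    have c2 := hδ u (u + 1) j (by omega) (by omega) (by omega) hT (by
      rw [z, norm_zero]
      have := Real.rpow_nonneg (hϖ.nonneg u (u + 1)) θ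
      positivity)
    have a2 := a1.trans (half _ _ hu2)
    have c3 : B * ϖ u j ^ θ ≤ B * ϖ i j ^ θ := by
      gcongr
      · exact hϖ.nonneg u j
      · exact hϖ.mono hiu (by omega) le_rfl
    have e : J i j = (J i j - J i u - J u j) + J i u +
        ((J u j - J u (u + 1) - J (u + 1) j) + J (u + 1) j) := by
      rw [z]; abel
    have key : ‖J i j‖ ≤ ‖J i j - J i u - J u j‖ + ‖J i u‖ +
        (‖J u j - J u (u + 1) - J (u + 1) j‖ + ‖J (u + 1) j‖) := by
      conv_lhs => rw [e]
      exact (norm_add_le _ _).trans (add_le_add (norm_add_le _ _) (norm_add_le _ _))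
    calc ‖J i j‖ ≤ B * ϖ i j ^ θ + sewC θ * B * (ϖ i j ^ θ * (2 ^ (1 - θ) / 2))
          + (B * ϖ i j ^ θ + sewC θ * B * (ϖ i j ^ θ * (2 ^ (1 - θ) / 2))) := by linarith
      _ = (2 + sewC θ * 2 ^ (1 - θ)) * B * ϖ i j ^ θ := by ring
      _ = sewC θ * B * ϖ i j ^ θ := by rw [sewC_eq hθ]
  exact fun i j => main (j - i) i j rfl

/-- Estimates over short intervals chain along a greedy partition. -/
theorem greedy_chain {Φ : ℕ → ℝ} {W b : ℕ → ℕ → ℝ} {a c : ℝ} (hW : IsControl W) (hc : 0 < c)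
    (ha : 0 ≤ a) (S T : ℕ) (hΦ0 : ∀ i, 0 ≤ Φ i)
    (hb : ∀ i u j, S ≤ i → i < u → u < j → j ≤ T → b i u + b u j ≤ b i j)
    (hΦ : ∀ i j, S ≤ i → i < j → j ≤ T → (j = i + 1 ∨ W i j ≤ c) →
      Φ j ≤ Φ i * Real.exp (a + b i j)) :
    ∀ i j, S ≤ i → i < j → j ≤ T → Φ j ≤ Φ i * Real.exp (a * (1 + 2 * W i j / c) + b i j) := by
  have up : ∀ i j a₁ a₂, a₁ ≤ a₂ → Φ j ≤ Φ i * Real.exp (a₁ + b i j) →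
      Φ j ≤ Φ i * Real.exp (a₂ + b i j) := by
    intro i j a₁ a₂ h h'
    refine h'.trans ?_
    have := hΦ0 i
    gcongr
  have trans : ∀ i u j a₁ a₂, S ≤ i → i < u → u < j → j ≤ T →
      Φ u ≤ Φ i * Real.exp (a₁ + b i u) → Φ j ≤ Φ u * Real.exp (a₂ + b u j) →
      Φ j ≤ Φ i * Real.exp (a₁ + a₂ + b i j) := by
    intro i u j a₁ a₂ h1 h2 h3 h4 h5 h6
    calc Φ j ≤ Φ u * Real.exp (a₂ + b u j) := h6
      _ ≤ Φ i * Real.exp (a₁ + b i u) * Real.exp (a₂ + b u j) := by gcongr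
      _ = Φ i * Real.exp (a₁ + a₂ + (b i u + b u j)) := by
          rw [mul_assoc, ← Real.exp_add]; ring_nf
      _ ≤ _ := by
          have := hΦ0 i
          have := hb i u j h1 h2 h3 h4
          gcongr
  have main : ∀ n i j, j - i = n → S ≤ i → i < j → j ≤ T →
      Φ j ≤ Φ i * Real.exp (a * (1 + 2 * W i j / c) + b i j) := by
    intro n
    induction n using Nat.strong_induction_on with
    | _ n ih =>
    intro i j hn hS hij hT
    have hWn := hW.nonneg i j
    by_cases hshort : j = i + 1 ∨ W i j ≤ c
    · refine up i j a _ ?_ (hΦ i j hS hij hT hshort)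
      have : 0 ≤ 2 * W i j / c := by positivity
      nlinarith
    push Not at hshort
    obtain ⟨hne, hWc⟩ := hshort
    -- The longest short interval `[i, u]` together with the single step to `u + 1` costs `2 a` and
    -- uses more than `c` of the control; this is the source of `2 W / c`.
    let Q : ℕ → Prop := fun u => i ≤ u ∧ W i u ≤ c
    classical
    have hQi : Q i := ⟨le_rfl, by rw [hW.diag]; exact hc.le⟩
    obtain ⟨hiu, hu2⟩ : Q (Nat.findGreatest Q (j - 1)) :=
      Nat.findGreatest_spec (m := i) (by omega) hQi
    have huj : Nat.findGreatest Q (j - 1) ≤ j - 1 := Nat.findGreatest_le _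
    have hgt : ∀ k, Nat.findGreatest Q (j - 1) < k → k ≤ j - 1 → ¬ Q k :=
      fun k => Nat.findGreatest_is_greatest
    generalize Nat.findGreatest Q (j - 1) = u at *
    have hv : c < W i (u + 1) := by
      rcases Nat.lt_or_ge u (j - 1) with e | e
      · have h2 : ¬ Q (u + 1) := hgt (u + 1) (by omega) (by omega)
        by_contra h4
        exact h2 ⟨by omega, not_lt.1 h4⟩
      · have : u + 1 = j := by omega
        rwa [this]
    have first : Φ (u + 1) ≤ Φ i * Real.exp (2 * a + b i (u + 1)) := by
      rcases Nat.eq_or_lt_of_le hiu with e | e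
      · subst e
        exact up _ _ a _ (by linarith) (hΦ i (i + 1) hS (by omega) (by omega) (Or.inl rfl))
      · rw [two_mul]
        exact trans i u (u + 1) a a hS e (by omega) (by omega)
          (hΦ i u hS e (by omega) (Or.inr hu2))
          (hΦ u (u + 1) (by omega) (by omega) (by omega) (Or.inl rfl))
    rcases Nat.eq_or_lt_of_le (show u + 1 ≤ j by omega) with e | e
    · subst e
      refine up _ _ _ _ ?_ first
      have : 1 ≤ W i (u + 1) / c := (one_le_div hc).2 hWc.le
      rw [mul_div_assoc]
      nlinarith
    · have h3 := ih (j - (u + 1)) (by omega) (u + 1) j rfl (by omega) e hT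
      refine up _ _ _ _ ?_ (trans i (u + 1) j _ _ hS (by omega) e hT first h3)
      have h5 := hW.superadd i (u + 1) j (by omega) (by omega)
      have h6 : W (u + 1) j / c ≤ W i j / c - 1 := by
        rw [div_sub_one hc.ne']
        gcongr
        linarith
      rw [mul_div_assoc, mul_div_assoc]
      nlinarith
  exact fun i j => main (j - i) i j rfl

/-- The least control above a nonnegative two-parameter function:
the supremum of `∑ c` over chains from `i` to `j`. -/
def chainSup (c : ℕ → ℕ → ℝ) (i : ℕ) : ℕ → ℝ
  | j => ⨆ k : Fin j, if i ≤ (k : ℕ) then chainSup c i k + c k j else 0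
decreasing_by exact k.2

theorem chainSup_eq (c : ℕ → ℕ → ℝ) (i j : ℕ) :
    chainSup c i j = ⨆ k : Fin j, if i ≤ (k : ℕ) then chainSup c i k + c k j else 0 := by
  rw [chainSup]

theorem add_le_chainSup (c : ℕ → ℕ → ℝ) {i k j : ℕ} (h1 : i ≤ k) (h2 : k < j) :
    chainSup c i k + c k j ≤ chainSup c i j := by
  rw [chainSup_eq c i j]
  refine le_trans (le_of_eq ?_) (le_ciSup (Set.finite_range _).bddAbove (⟨k, h2⟩ : Fin j))
  simp [h1]

theorem chainSup_of_le (c : ℕ → ℕ → ℝ) {i j : ℕ} (h : j ≤ i) : chainSup c i j = 0 := by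
  rw [chainSup_eq]
  have : (fun k : Fin j => if i ≤ (k : ℕ) then chainSup c i k + c k j else 0) = fun _ => 0 := by
    funext k
    rw [if_neg]
    have := k.2
    omega
  rw [this]
  exact Real.iSup_const_zero

theorem exists_chainSup_eq (c : ℕ → ℕ → ℝ) (hc : ∀ i j, 0 ≤ c i j) {i j : ℕ} (h : i < j)
    (hn : ∀ k, k < j → 0 ≤ chainSup c i k) :
    ∃ k, i ≤ k ∧ k < j ∧ chainSup c i j = chainSup c i k + c k j := by
  have : Nonempty (Fin j) := ⟨⟨i, h⟩⟩
  obtain ⟨k, hk⟩ := exists_eq_ciSup_of_finite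
    (f := fun k : Fin j => if i ≤ (k : ℕ) then chainSup c i k + c k j else 0)
  rw [← chainSup_eq] at hk
  by_cases hik : i ≤ (k : ℕ)
  · exact ⟨k, hik, k.2, by rw [← hk, if_pos hik]⟩
  -- The maximum is the default value 0. By nonnegativity the one-link chain from `i` then attains
  -- it too.
  · rw [if_neg hik] at hk
    refine ⟨i, le_rfl, h, le_antisymm ?_ (add_le_chainSup c le_rfl h)⟩
    rw [← hk]
    exact add_nonneg (hn i h) (hc i j)

theorem chainSup_nonneg (c : ℕ → ℕ → ℝ) (hc : ∀ i j, 0 ≤ c i j) (i j : ℕ) :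
    0 ≤ chainSup c i j := by
  induction j using Nat.strong_induction_on with
  | _ j ih =>
  rcases Nat.lt_or_ge i j with h | h
  · exact (add_nonneg (ih i h) (hc i j)).trans (add_le_chainSup c le_rfl h)
  · rw [chainSup_of_le c h]

theorem le_chainSup (c : ℕ → ℕ → ℝ) {i j : ℕ} (h : i < j) : c i j ≤ chainSup c i j := by
  have := add_le_chainSup c le_rfl h
  rwa [chainSup_of_le c le_rfl, zero_add] at this

/-- Chains can be concatenated: an optimal chain from `u` to `j` has a last link from some `k`, and
induction handles the part up to `k`. -/
theorem isControl_chainSup (c : ℕ → ℕ → ℝ) (hc : ∀ i j, 0 ≤ c i j) : IsControl (chainSup c) where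
  nonneg := chainSup_nonneg c hc
  superadd i u j hiu huj := by
    induction j using Nat.strong_induction_on with
    | _ j ih =>
    rcases Nat.eq_or_lt_of_le huj with e | e
    · subst e
      rw [chainSup_of_le c (le_refl u), add_zero]
    · obtain ⟨k, h1, h2, h3⟩ := exists_chainSup_eq c hc e (fun k _ => chainSup_nonneg c hc u k)
      rw [h3]
      have := ih k h2 h1
      have := add_le_chainSup c (hiu.trans h1) h2
      linarith

theorem measurable_chainSup {Ω : Type*} [MeasurableSpace Ω] (c : Ω → ℕ → ℕ → ℝ)
    (hc : ∀ i j, Measurable fun w => c w i j) (i j : ℕ) :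
    Measurable fun w => chainSup (c w) i j := by
  induction j using Nat.strong_induction_on with
  | _ j ih =>
  simp only [chainSup_eq _ i j]
  refine Measurable.iSup fun k => ?_
  split_ifs
  · exact (ih k k.2).add (hc k j)
  · exact measurable_const

end RoughEuler

end

noncomputable section

namespace RoughEuler

set_option maxSynthPendingDepth 3

/-! ### Derivative bounds for the diffusion coefficient -/

/-- Mean value inequality on the ball of radius `‖v‖` around `y`, where the derivative deviates from
that at the centre by at most `K ‖v‖`. The factor 1/2 is not pursued. -/
theorem norm_taylor_one_le {V F : Type*} [NormedAddCommGroup V] [NormedSpace ℝ V]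
    [NormedAddCommGroup F] [NormedSpace ℝ F] {h : V → F} (hd : Differentiable ℝ h) {K : ℝ}
    (hK : ∀ a b, ‖fderiv ℝ h a - fderiv ℝ h b‖ ≤ K * ‖a - b‖) (hK0 : 0 ≤ K) (y v : V) :
    ‖h (y + v) - h y - fderiv ℝ h y v‖ ≤ K * ‖v‖ ^ 2 := by
  have key := (convex_closedBall y ‖v‖).norm_image_sub_le_of_norm_hasFDerivWithin_le'
    (f := h) (f' := fderiv ℝ h) (φ := fderiv ℝ h y) (C := K * ‖v‖)
    (fun x _ => (hd x).hasFDerivAt.hasFDerivWithinAt)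
    (fun x hx => (hK x y).trans (by
      gcongr
      rw [← dist_eq_norm]
      exact Metric.mem_closedBall.1 hx))
    (Metric.mem_closedBall_self (norm_nonneg v))
    (show y + v ∈ Metric.closedBall y ‖v‖ by simp)
  rw [add_sub_cancel_left] at key
  rw [pow_two, ← mul_assoc]
  exact key

theorem norm_sub_le_of_fderiv_le {V F : Type*} [NormedAddCommGroup V] [NormedSpace ℝ V]
    [NormedAddCommGroup F] [NormedSpace ℝ F] {h : V → F} (hd : Differentiable ℝ h) {K : ℝ}
    (hK : ∀ a, ‖fderiv ℝ h a‖ ≤ K) (y y' : V) : ‖h y' - h y‖ ≤ K * ‖y' - y‖ :=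
  convex_univ.norm_image_sub_le_of_norm_fderiv_le (fun x _ => hd x) (fun x _ => hK x)
    (mem_univ y) (mem_univ y')

/-- The bounds on a coefficient `g` and its derivatives that the estimates use. -/
structure CoefBound {V U : Type*} [NormedAddCommGroup V] [NormedSpace ℝ V]
    [NormedAddCommGroup U] [NormedSpace ℝ U] (g : V → (U →L[ℝ] V)) (G l : ℝ) : Prop where
  one_le : 1 ≤ G
  nonneg : 0 ≤ l
  le : l ≤ G
  diff1 : Differentiable ℝ g
  diff2 : Differentiable ℝ (fderiv ℝ g)
  symm : ∀ y u v, fderiv ℝ (fderiv ℝ g) y u v = fderiv ℝ (fderiv ℝ g) y v u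
  b0 : ∀ y, ‖g y‖ ≤ G
  b1 : ∀ y, ‖fderiv ℝ g y‖ ≤ l
  b2 : ∀ y, ‖fderiv ℝ (fderiv ℝ g) y‖ ≤ l
  b3 : ∀ y y', ‖fderiv ℝ (fderiv ℝ g) y - fderiv ℝ (fderiv ℝ g) y'‖ ≤ G * ‖y - y'‖
  b3g : ∀ y y' a, ‖fderiv ℝ (fderiv ℝ g) y - fderiv ℝ (fderiv ℝ g) y'‖ * ‖g a‖
    ≤ l * G * ‖y - y'‖
  b3gg : ∀ y x, ‖fderiv ℝ g (y + g y x) - fderiv ℝ g y - fderiv ℝ (fderiv ℝ g) y (g y x)‖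
    ≤ l * G ^ 2 * ‖x‖ ^ 2

theorem supD_nonneg {d m : ℕ} (k : ℕ) (g : E d → (E m →L[ℝ] E d)) : 0 ≤ supD k g :=
  Real.iSup_nonneg fun _ => norm_nonneg _

theorem supD_le_normC3b {d m : ℕ} {k : ℕ} (hk : k < 4) (g : E d → (E m →L[ℝ] E d)) :
    supD k g ≤ normC3b g :=
  Finset.single_le_sum (f := fun k => supD k g) (fun i _ => supD_nonneg i g)
    (Finset.mem_range.2 hk)

theorem Lg_nonneg {d m : ℕ} (g : E d → (E m →L[ℝ] E d)) : 0 ≤ Lg g :=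
  (supD_nonneg 1 g).trans ((le_max_left _ _).trans (le_max_left _ _))

theorem Lg_le_normC3b {d m : ℕ} (g : E d → (E m →L[ℝ] E d)) : Lg g ≤ normC3b g := by
  have h0 := supD_le_normC3b (k := 0) (by norm_num) g
  have h1 := supD_le_normC3b (k := 1) (by norm_num) g
  have h2 := supD_le_normC3b (k := 2) (by norm_num) g
  have h3 := supD_le_normC3b (k := 3) (by norm_num) g
  have p0 := supD_nonneg 0 g
  have p3 := supD_nonneg 3 g
  have hn : 0 ≤ normC3b g := p0.trans h0
  refine max_le (max_le h1 h2) (max_le ?_ ?_)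
  · rw [Real.sqrt_le_left hn, pow_two]
    exact mul_le_mul h0 (max_le (max_le h1 h2) h3) (p3.trans (le_max_right _ _)) hn
  · have : supD 0 g ^ 2 * supD 3 g ≤ normC3b g ^ (3 : ℝ) := by
      rw [show (3 : ℝ) = (3 : ℕ) by norm_num, Real.rpow_natCast, pow_succ (normC3b g)]
      exact mul_le_mul (pow_le_pow_left₀ p0 h0 2) h3 p3 (by positivity)
    calc (supD 0 g ^ 2 * supD 3 g) ^ (1 / 3 : ℝ) ≤ (normC3b g ^ (3 : ℝ)) ^ (1 / 3 : ℝ) := by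
          gcongr
      _ = normC3b g := by rw [← Real.rpow_mul hn]; norm_num

/-- The criterion is linear in `L_g`, so noise estimates must keep one factor `l`. The third
derivative alone is not bounded by `l`, but its products with one and two factors `‖g‖` are bounded
by `l ^ 2` and `l ^ 3`; one `l` is kept and the others are enlarged to `G`. -/
theorem coefBound_of_contDiff {V U : Type*} [NormedAddCommGroup V] [NormedSpace ℝ V]
    [NormedAddCommGroup U] [NormedSpace ℝ U] {g : V → (U →L[ℝ] V)} (hc : ContDiff ℝ 3 g)
    {s : ℕ → ℝ} (le_sup : ∀ k, k ≤ 3 → ∀ y, ‖iteratedFDeriv ℝ k g y‖ ≤ s k) {G l : ℝ}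
    (hs : ∀ k, 0 ≤ s k) (h1 : 1 ≤ G) (hG : ∀ k, k ≤ 3 → s k ≤ G) (l0 : 0 ≤ l) (lG : l ≤ G)
    (hs1 : s 1 ≤ l) (hs2 : s 2 ≤ l) (s1 : s 0 * s 3 ≤ l ^ 2) (s2 : s 0 ^ 2 * s 3 ≤ l ^ 3) :
    CoefBound g G l := by
  have hc1 : ContDiff ℝ 2 (fderiv ℝ g) := hc.fderiv_right (by norm_num)
  have hc2 : ContDiff ℝ 1 (fderiv ℝ (fderiv ℝ g)) := hc1.fderiv_right (by norm_num)
  have d1 : Differentiable ℝ g := hc.differentiable (by norm_num)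
  have d2 : Differentiable ℝ (fderiv ℝ g) := hc1.differentiable (by norm_num)
  have d3 : Differentiable ℝ (fderiv ℝ (fderiv ℝ g)) := hc2.differentiable (by norm_num)
  have n0 : ∀ y, ‖g y‖ ≤ s 0 := fun y => by
    have := le_sup 0 (by norm_num) y
    rwa [norm_iteratedFDeriv_zero] at this
  have n1 : ∀ y, ‖fderiv ℝ g y‖ ≤ s 1 := fun y => by
    have := le_sup 1 (by norm_num) y
    rwa [← norm_iteratedFDeriv_fderiv, norm_iteratedFDeriv_zero] at this
  have n2 : ∀ y, ‖fderiv ℝ (fderiv ℝ g) y‖ ≤ s 2 := fun y => by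
    have := le_sup 2 (by norm_num) y
    rwa [← norm_iteratedFDeriv_fderiv, ← norm_iteratedFDeriv_fderiv,
      norm_iteratedFDeriv_zero] at this
  have n3 : ∀ y, ‖fderiv ℝ (fderiv ℝ (fderiv ℝ g)) y‖ ≤ s 3 := fun y => by
    have := le_sup 3 (by norm_num) y
    rwa [← norm_iteratedFDeriv_fderiv, ← norm_iteratedFDeriv_fderiv,
      ← norm_iteratedFDeriv_fderiv, norm_iteratedFDeriv_zero] at this
  have lip3 := fun y y' => norm_sub_le_of_fderiv_le d3 n3 y' y
  have p0 := hs 0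
  have p3 := hs 3
  refine ⟨h1, l0, lG, d1, d2, ?_, ?_, ?_, ?_, ?_, ?_, ?_⟩
  · intro y u v
    exact (hc.contDiffAt.isSymmSndFDerivAt (by simp; norm_num)).eq u v
  · exact fun y => (n0 y).trans (hG 0 (by norm_num))
  · exact fun y => (n1 y).trans hs1
  · exact fun y => (n2 y).trans hs2
  · intro y y'
    refine (lip3 y y').trans ?_
    have := hG 3 le_rfl
    gcongr
  · intro y y' a
    calc _ ≤ s 3 * ‖y - y'‖ * s 0 := by
          gcongr
          · exact lip3 y y'
          · exact n0 a
      _ = s 0 * s 3 * ‖y - y'‖ := by ring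
      _ ≤ l * G * ‖y - y'‖ := by
          refine mul_le_mul_of_nonneg_right (s1.trans ?_) (norm_nonneg _)
          nlinarith
  · intro y x
    refine (norm_taylor_one_le d2 lip3 p3 y (g y x)).trans ?_
    calc s 3 * ‖g y x‖ ^ 2 ≤ s 3 * (s 0 * ‖x‖) ^ 2 := by
          gcongr
          exact (g y).le_of_opNorm_le (n0 y) x
      _ = s 0 ^ 2 * s 3 * ‖x‖ ^ 2 := by ring
      _ ≤ l ^ 3 * ‖x‖ ^ 2 := by gcongr
      _ ≤ l * G ^ 2 * ‖x‖ ^ 2 := by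
          rw [pow_succ' l]
          gcongr

theorem C3b.coefBound {d m : ℕ} {g : E d → (E m →L[ℝ] E d)} (hg : C3b g) {G : ℝ}
    (h1 : 1 ≤ G) (hG : normC3b g ≤ G) : CoefBound g G (Lg g) := by
  obtain ⟨hc, hb⟩ := hg
  have p0 := supD_nonneg 0 g
  have p3 := supD_nonneg 3 g
  have l0 := Lg_nonneg g
  refine coefBound_of_contDiff hc (s := fun k => supD k g) (fun k hk y => le_ciSup (hb k hk) y)
    (fun k => supD_nonneg k g) h1 (fun k hk => (supD_le_normC3b (by omega) g).trans hG) l0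
    ((Lg_le_normC3b g).trans hG) ((le_max_left _ _).trans (le_max_left _ _))
    ((le_max_right _ _).trans (le_max_left _ _)) ?_ ?_
  · have h : Real.sqrt (supD 0 g * max (max (supD 1 g) (supD 2 g)) (supD 3 g)) ≤ Lg g :=
      (le_max_left _ _).trans (le_max_right _ _)
    rw [Real.sqrt_le_left l0] at h
    refine le_trans ?_ h
    exact mul_le_mul_of_nonneg_left (le_max_right _ _) p0
  · have h : (supD 0 g ^ 2 * supD 3 g) ^ (1 / 3 : ℝ) ≤ Lg g :=
      (le_max_right _ _).trans (le_max_right _ _)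
    have hnn : 0 ≤ supD 0 g ^ 2 * supD 3 g := by positivity
    calc supD 0 g ^ 2 * supD 3 g = ((supD 0 g ^ 2 * supD 3 g) ^ (1 / 3 : ℝ)) ^ (3 : ℝ) := by
          rw [← Real.rpow_mul hnn]; norm_num
      _ ≤ Lg g ^ (3 : ℝ) := by gcongr
      _ = Lg g ^ 3 := by
          rw [show (3 : ℝ) = (3 : ℕ) by norm_num, Real.rpow_natCast]

/-! ### Contraction with second level increments -/

/-- `∑ X^{ij} B(eᵢ, eⱼ)`. -/
def contract {V : Type*} [NormedAddCommGroup V] [NormedSpace ℝ V] {m : ℕ}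
    (X : E2 m) (B : E m →L[ℝ] E m →L[ℝ] V) : V :=
  ∑ i : Fin m, ∑ j : Fin m, X (i, j) • B (EuclideanSpace.single i 1) (EuclideanSpace.single j 1)

theorem contract_add {V : Type*} [NormedAddCommGroup V] [NormedSpace ℝ V] {m : ℕ}
    (X : E2 m) (B B' : E m →L[ℝ] E m →L[ℝ] V) :
    contract X (B + B') = contract X B + contract X B' := by
  simp [contract, Finset.sum_add_distrib]

theorem contract_sub {V : Type*} [NormedAddCommGroup V] [NormedSpace ℝ V] {m : ℕ}
    (X : E2 m) (B B' : E m →L[ℝ] E m →L[ℝ] V) :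
    contract X (B - B') = contract X B - contract X B' := by
  simp [contract, Finset.sum_sub_distrib, smul_sub]

theorem contract_smul {V : Type*} [NormedAddCommGroup V] [NormedSpace ℝ V] {m : ℕ}
    (X : E2 m) (c : ℝ) (B : E m →L[ℝ] E m →L[ℝ] V) :
    contract X (c • B) = c • contract X B := by
  simp only [contract, Finset.smul_sum, smul_apply]
  simp_rw [smul_comm c]

theorem add_contract {V : Type*} [NormedAddCommGroup V] [NormedSpace ℝ V] {m : ℕ}
    (X Y : E2 m) (B : E m →L[ℝ] E m →L[ℝ] V) :
    contract (X + Y) B = contract X B + contract Y B := by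
  simp [contract, add_smul, Finset.sum_add_distrib]

/-- Turns the tensor in Chen's relation into an evaluation, so that it can cancel the first order
Taylor term. -/
theorem contract_tens {V : Type*} [NormedAddCommGroup V] [NormedSpace ℝ V] {m : ℕ}
    (a b : E m) (B : E m →L[ℝ] E m →L[ℝ] V) :
    contract (tens a b) B = B a b := by
  have ha : a = ∑ i, a i • EuclideanSpace.single i (1 : ℝ) := by
    ext k; simp [Finset.sum_apply, Pi.single_apply]
  have hb : b = ∑ i, b i • EuclideanSpace.single i (1 : ℝ) := by
    ext k; simp [Finset.sum_apply, Pi.single_apply]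
  conv_rhs => rw [ha, hb]
  simp only [contract, tens, map_sum, map_smul, sum_apply,
    smul_apply, Finset.smul_sum, smul_smul]
  rw [Finset.sum_comm]
  refine Finset.sum_congr rfl fun i _ => Finset.sum_congr rfl fun j _ => ?_
  rw [mul_comm]

theorem norm_contract_le {V : Type*} [NormedAddCommGroup V] [NormedSpace ℝ V] {m : ℕ}
    (X : E2 m) (B : E m →L[ℝ] E m →L[ℝ] V) :
    ‖contract X B‖ ≤ (m : ℝ) ^ 2 * ‖X‖ * ‖B‖ := by
  have h : ∀ i j : Fin m, ‖X (i, j) • B (EuclideanSpace.single i 1) (EuclideanSpace.single j 1)‖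
      ≤ ‖X‖ * ‖B‖ := by
    intro i j
    rw [norm_smul]
    gcongr
    · exact PiLp.norm_apply_le X (i, j)
    · refine (B.le_opNorm₂ _ _).trans ?_
      simp
  calc ‖contract X B‖ ≤ ∑ i : Fin m, ∑ j : Fin m, ‖X‖ * ‖B‖ :=
        (norm_sum_le _ _).trans (Finset.sum_le_sum fun i _ =>
          (norm_sum_le _ _).trans (Finset.sum_le_sum fun j _ => h i j))
    _ = (m : ℝ) ^ 2 * ‖X‖ * ‖B‖ := by simp; ring

theorem norm_contract_le_of_le {V : Type*} [NormedAddCommGroup V] [NormedSpace ℝ V] {m : ℕ}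
    {X : E2 m} {B : E m →L[ℝ] E m →L[ℝ] V} {a b : ℝ}
    (h1 : ‖X‖ ≤ a) (h2 : ‖B‖ ≤ b) : ‖contract X B‖ ≤ (m : ℝ) ^ 2 * a * b := by
  refine (norm_contract_le X B).trans ?_
  have := (norm_nonneg X).trans h1
  gcongr

/-- `Dg(y) g(y)` as a bilinear map `(a, b) ↦ (Dg(y)[g(y) a]) b`. -/
def secondCoef {V U : Type*} [NormedAddCommGroup V] [NormedSpace ℝ V]
    [NormedAddCommGroup U] [NormedSpace ℝ U]
    (g : V → (U →L[ℝ] V)) (y : V) : U →L[ℝ] U →L[ℝ] V :=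
  (fderiv ℝ g y).comp (g y)

/-- The derivative of `secondCoef g` at `y` in direction `v`. -/
def secondCoefDeriv {V U : Type*} [NormedAddCommGroup V] [NormedSpace ℝ V]
    [NormedAddCommGroup U] [NormedSpace ℝ U]
    (g : V → (U →L[ℝ] V)) (y v : V) :
    U →L[ℝ] U →L[ℝ] V :=
  (fderiv ℝ (fderiv ℝ g) y v).comp (g y) + (fderiv ℝ g y).comp (fderiv ℝ g y v)

theorem eulerStep_eq {d m : ℕ} (f : E d → E d) (g : E d → (E m →L[ℝ] E d)) (Δ : ℝ) (X : T2 m)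
    (y : E d) :
    eulerStep f g Δ X y = y + Δ • f y + g y X.lvl1 + contract X.lvl2 (secondCoef g y) := rfl

theorem secondCoefDeriv_add {V U : Type*} [NormedAddCommGroup V] [NormedSpace ℝ V]
    [NormedAddCommGroup U] [NormedSpace ℝ U]
    (g : V → (U →L[ℝ] V)) (y v w : V) :
    secondCoefDeriv g y (v + w) = secondCoefDeriv g y v + secondCoefDeriv g y w := by
  ext a b
  simp [secondCoefDeriv]
  abel

theorem secondCoefDeriv_smul {V U : Type*} [NormedAddCommGroup V] [NormedSpace ℝ V]
    [NormedAddCommGroup U] [NormedSpace ℝ U]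
    (g : V → (U →L[ℝ] V)) (y : V) (c : ℝ) (v : V) :
    secondCoefDeriv g y (c • v) = c • secondCoefDeriv g y v := by
  ext a b
  simp [secondCoefDeriv]

theorem secondCoefDeriv_sub {V U : Type*} [NormedAddCommGroup V] [NormedSpace ℝ V]
    [NormedAddCommGroup U] [NormedSpace ℝ U]
    (g : V → (U →L[ℝ] V)) (y v w : V) :
    secondCoefDeriv g y (v - w) = secondCoefDeriv g y v - secondCoefDeriv g y w := by
  ext a b
  simp [secondCoefDeriv]
  abel

namespace CoefBound

variable {V U : Type*} [NormedAddCommGroup V] [NormedSpace ℝ V] [NormedAddCommGroup U] [NormedSpace ℝ U]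
  {g : V → (U →L[ℝ] V)} {G l : ℝ}

theorem lip0 (h : CoefBound g G l) (y y' : V) : ‖g y' - g y‖ ≤ l * ‖y' - y‖ :=
  norm_sub_le_of_fderiv_le h.diff1 h.b1 y y'

theorem lip1 (h : CoefBound g G l) (y y' : V) :
    ‖fderiv ℝ g y' - fderiv ℝ g y‖ ≤ l * ‖y' - y‖ :=
  norm_sub_le_of_fderiv_le h.diff2 h.b2 y y'

theorem taylor0 (h : CoefBound g G l) (y v : V) :
    ‖g (y + v) - g y - fderiv ℝ g y v‖ ≤ l * ‖v‖ ^ 2 :=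
  norm_taylor_one_le h.diff1 (fun a b => h.lip1 b a) h.nonneg y v

theorem taylor1 (h : CoefBound g G l) (y v : V) :
    ‖fderiv ℝ g (y + v) - fderiv ℝ g y - fderiv ℝ (fderiv ℝ g) y v‖ ≤ G * ‖v‖ ^ 2 :=
  norm_taylor_one_le h.diff2 h.b3 (zero_le_one.trans h.one_le) y v

theorem norm_secondCoef_le (h : CoefBound g G l) (y : V) : ‖secondCoef g y‖ ≤ l * G :=
  (ContinuousLinearMap.opNorm_comp_le _ _).trans
    (mul_le_mul (h.b1 y) (h.b0 y) (norm_nonneg _) h.nonneg)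

theorem secondCoef_lip (h : CoefBound g G l) (y y' : V) :
    ‖secondCoef g y' - secondCoef g y‖ ≤ 2 * l * G * ‖y' - y‖ := by
  have e : secondCoef g y' - secondCoef g y
      = (fderiv ℝ g y' - fderiv ℝ g y).comp (g y') + (fderiv ℝ g y).comp (g y' - g y) := by
    ext a b; simp [secondCoef]
  have l0 := h.nonneg
  rw [e]
  calc _ ≤ ‖(fderiv ℝ g y' - fderiv ℝ g y).comp (g y')‖ + ‖(fderiv ℝ g y).comp (g y' - g y)‖ :=
        norm_add_le _ _
    _ ≤ l * ‖y' - y‖ * G + l * (l * ‖y' - y‖) := by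
        refine add_le_add ?_ ?_
        · refine (ContinuousLinearMap.opNorm_comp_le _ _).trans ?_
          exact mul_le_mul (h.lip1 y y') (h.b0 y') (norm_nonneg _) (by positivity)
        · refine (ContinuousLinearMap.opNorm_comp_le _ _).trans ?_
          exact mul_le_mul (h.b1 y) (h.lip0 y y') (norm_nonneg _) (by positivity)
    _ ≤ l * ‖y' - y‖ * G + l * (G * ‖y' - y‖) := by
        have := h.le
        gcongr
    _ = _ := by ring

theorem first_order (h : CoefBound g G l) {y y' R : V} {x : U} (hy : y' = y + g y x + R) :
    ‖g y' - g y - secondCoef g y x‖ ≤ l * ‖R‖ + l * G ^ 2 * ‖x‖ ^ 2 := by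
  have l0 := h.nonneg
  have e : g y' - g y - secondCoef g y x
      = (g y' - g (y + g y x)) + (g (y + g y x) - g y - fderiv ℝ g y (g y x)) := by
    simp [secondCoef]
    abel
  rw [e]
  refine (norm_add_le _ _).trans (add_le_add ?_ ?_)
  · have := h.lip0 (y + g y x) y'
    rwa [show y' - (y + g y x) = R by rw [hy]; abel] at this
  · refine (h.taylor0 y (g y x)).trans ?_
    rw [mul_assoc, ← mul_pow]
    gcongr
    exact (g y).le_of_opNorm_le (h.b0 y) x

/-- The displacement is split into its noise part `g y x` and `R`. Along the noise part the Taylor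
remainder of `Dg` costs `‖g‖² ‖D³g‖`, which is why this product enters `L_g`. -/
theorem first_order_deriv (h : CoefBound g G l) {y y' R : V} {x : U}
    (hy : y' = y + g y x + R) :
    ‖fderiv ℝ g y' - fderiv ℝ g y - fderiv ℝ (fderiv ℝ g) y (g y x)‖
      ≤ l * ‖R‖ + l * G ^ 2 * ‖x‖ ^ 2 := by
  have e : fderiv ℝ g y' - fderiv ℝ g y - fderiv ℝ (fderiv ℝ g) y (g y x)
      = (fderiv ℝ g y' - fderiv ℝ g (y + g y x)) +
        (fderiv ℝ g (y + g y x) - fderiv ℝ g y - fderiv ℝ (fderiv ℝ g) y (g y x)) := by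
    abel
  rw [e]
  refine (norm_add_le _ _).trans (add_le_add ?_ (h.b3gg y x))
  have := h.lip1 (y + g y x) y'
  rwa [show y' - (y + g y x) = R by rw [hy]; abel] at this

theorem norm_secondCoefDeriv_le (h : CoefBound g G l) (y v : V) :
    ‖secondCoefDeriv g y v‖ ≤ 2 * l * G * ‖v‖ := by
  have l0 := h.nonneg
  have lG := h.le
  calc _ ≤ ‖(fderiv ℝ (fderiv ℝ g) y v).comp (g y)‖ + ‖(fderiv ℝ g y).comp (fderiv ℝ g y v)‖ :=
        norm_add_le _ _
    _ ≤ l * ‖v‖ * G + l * (l * ‖v‖) := by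
        refine add_le_add ?_ ?_
        · refine (ContinuousLinearMap.opNorm_comp_le _ _).trans ?_
          exact mul_le_mul (ContinuousLinearMap.le_of_opNorm_le _ (h.b2 y) v) (h.b0 y)
            (norm_nonneg _) (by positivity)
        · refine (ContinuousLinearMap.opNorm_comp_le _ _).trans ?_
          exact mul_le_mul (h.b1 y) (ContinuousLinearMap.le_of_opNorm_le _ (h.b1 y) v)
            (norm_nonneg _) (by positivity)
    _ ≤ l * ‖v‖ * G + l * (G * ‖v‖) := by gcongr
    _ = _ := by ring

theorem secondCoefDeriv_lip (h : CoefBound g G l) (y y' v : V) :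
    ‖secondCoefDeriv g y' v - secondCoefDeriv g y v‖ ≤ 4 * l * G * ‖y' - y‖ * ‖v‖ := by
  have l0 := h.nonneg
  have lG := h.le
  have e : secondCoefDeriv g y' v - secondCoefDeriv g y v
      = (((fderiv ℝ (fderiv ℝ g) y' - fderiv ℝ (fderiv ℝ g) y) v).comp (g y')
        + (fderiv ℝ (fderiv ℝ g) y v).comp (g y' - g y))
        + ((fderiv ℝ g y' - fderiv ℝ g y).comp (fderiv ℝ g y' v)
        + (fderiv ℝ g y).comp ((fderiv ℝ g y' - fderiv ℝ g y) v)) := by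
    ext a b
    simp [secondCoefDeriv]
    abel
  have t1 : ‖((fderiv ℝ (fderiv ℝ g) y' - fderiv ℝ (fderiv ℝ g) y) v).comp (g y')‖
      ≤ l * G * ‖y' - y‖ * ‖v‖ := by
    refine (ContinuousLinearMap.opNorm_comp_le _ _).trans ?_
    calc _ ≤ ‖fderiv ℝ (fderiv ℝ g) y' - fderiv ℝ (fderiv ℝ g) y‖ * ‖v‖ * ‖g y'‖ := by
          gcongr
          exact ContinuousLinearMap.le_opNorm _ _
      _ = ‖fderiv ℝ (fderiv ℝ g) y' - fderiv ℝ (fderiv ℝ g) y‖ * ‖g y'‖ * ‖v‖ := by ring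
      _ ≤ _ := by
          exact mul_le_mul_of_nonneg_right (h.b3g y' y y') (norm_nonneg _)
  have t2 : ‖(fderiv ℝ (fderiv ℝ g) y v).comp (g y' - g y)‖ ≤ l * ‖v‖ * (l * ‖y' - y‖) := by
    refine (ContinuousLinearMap.opNorm_comp_le _ _).trans ?_
    exact mul_le_mul (ContinuousLinearMap.le_of_opNorm_le _ (h.b2 y) v) (h.lip0 y y')
      (norm_nonneg _) (by positivity)
  have t3 : ‖(fderiv ℝ g y' - fderiv ℝ g y).comp (fderiv ℝ g y' v)‖
      ≤ l * ‖y' - y‖ * (l * ‖v‖) := by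
    refine (ContinuousLinearMap.opNorm_comp_le _ _).trans ?_
    exact mul_le_mul (h.lip1 y y') (ContinuousLinearMap.le_of_opNorm_le _ (h.b1 y') v)
      (norm_nonneg _) (by positivity)
  have t4 : ‖(fderiv ℝ g y).comp ((fderiv ℝ g y' - fderiv ℝ g y) v)‖
      ≤ l * (l * ‖y' - y‖ * ‖v‖) := by
    refine (ContinuousLinearMap.opNorm_comp_le _ _).trans ?_
    exact mul_le_mul (h.b1 y) (ContinuousLinearMap.le_of_opNorm_le _ (h.lip1 y y') v)
      (norm_nonneg _) (by positivity)
  rw [e]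
  calc _ ≤ (l * G * ‖y' - y‖ * ‖v‖ + l * ‖v‖ * (l * ‖y' - y‖))
        + (l * ‖y' - y‖ * (l * ‖v‖) + l * (l * ‖y' - y‖ * ‖v‖)) :=
        (norm_add_le _ _).trans (add_le_add
          ((norm_add_le _ _).trans (add_le_add t1 t2)) ((norm_add_le _ _).trans (add_le_add t3 t4)))
    _ = (l * G + 3 * (l * l)) * ‖y' - y‖ * ‖v‖ := by ring
    _ ≤ (l * G + 3 * (l * G)) * ‖y' - y‖ * ‖v‖ := by gcongr
    _ = _ := by ring

/-- No factor `l` is kept here: the bound serves only the error quadratic in the difference of two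
solutions, which is made small by the radius of the neighbourhood. -/
theorem secondCoef_taylor (h : CoefBound g G l) (y v : V) :
    ‖secondCoef g (y + v) - secondCoef g y - secondCoefDeriv g y v‖ ≤ 3 * G ^ 2 * ‖v‖ ^ 2 := by
  have l0 := h.nonneg
  have lG := h.le
  have G0 : 0 ≤ G := l0.trans lG
  have e : secondCoef g (y + v) - secondCoef g y - secondCoefDeriv g y v
      = (fderiv ℝ g (y + v) - fderiv ℝ g y - fderiv ℝ (fderiv ℝ g) y v).comp (g y)
        + ((fderiv ℝ g (y + v)).comp (g (y + v) - g y - fderiv ℝ g y v)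
        + (fderiv ℝ g (y + v) - fderiv ℝ g y).comp (fderiv ℝ g y v)) := by
    ext a b
    simp [secondCoef, secondCoefDeriv]
    abel
  have t1 := (ContinuousLinearMap.opNorm_comp_le
    (fderiv ℝ g (y + v) - fderiv ℝ g y - fderiv ℝ (fderiv ℝ g) y v) (g y)).trans
    (mul_le_mul (h.taylor1 y v) (h.b0 y) (norm_nonneg _) (by positivity))
  have t2 := (ContinuousLinearMap.opNorm_comp_le (fderiv ℝ g (y + v))
    (g (y + v) - g y - fderiv ℝ g y v)).trans
    (mul_le_mul (h.b1 _) (h.taylor0 y v) (norm_nonneg _) l0)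
  have t3 := (ContinuousLinearMap.opNorm_comp_le (fderiv ℝ g (y + v) - fderiv ℝ g y)
    (fderiv ℝ g y v)).trans
    (mul_le_mul (h.lip1 y (y + v)) (ContinuousLinearMap.le_of_opNorm_le _ (h.b1 y) v)
      (norm_nonneg _) (by positivity))
  rw [add_sub_cancel_left] at t3
  rw [e]
  calc _ ≤ G * ‖v‖ ^ 2 * G + (l * (l * ‖v‖ ^ 2) + l * ‖v‖ * (l * ‖v‖)) :=
        (norm_add_le _ _).trans (add_le_add t1 ((norm_add_le _ _).trans (add_le_add t2 t3)))
    _ = (G * G + 2 * (l * l)) * ‖v‖ ^ 2 := by ring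
    _ ≤ (G * G + 2 * (G * G)) * ‖v‖ ^ 2 := by gcongr
    _ = _ := by ring

end CoefBound

end RoughEuler

end

noncomputable section

namespace RoughEuler

set_option maxSynthPendingDepth 3

/-! ### Local expansion of the scheme and of its linearization -/

/-- Two-level increments over the indices of a grid, dominated by a control. -/
structure RoughData {m : ℕ} (α : ℝ) (x : ℕ → ℕ → E m) (X : ℕ → ℕ → E2 m) (ϖ : ℕ → ℕ → ℝ) :
    Prop where
  ctrl : IsControl ϖ
  add : ∀ i u j, x i j = x i u + x u j
  chen : ∀ i u j, X i j - X i u - X u j = tens (x i u) (x u j)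
  bx : ∀ i j, i ≤ j → ‖x i j‖ ≤ ϖ i j ^ α
  bX : ∀ i j, i ≤ j → ‖X i j‖ ≤ (ϖ i j ^ α) ^ 2

theorem RoughData.x_self {m : ℕ} {α : ℝ} {x : ℕ → ℕ → E m} {X : ℕ → ℕ → E2 m}
    {ϖ : ℕ → ℕ → ℝ} (h : RoughData α x X ϖ) (i : ℕ) : x i i = 0 := by
  have := h.add i i i
  simpa using this

theorem RoughData.X_self {m : ℕ} {α : ℝ} {x : ℕ → ℕ → E m} {X : ℕ → ℕ → E2 m}
    {ϖ : ℕ → ℕ → ℝ} (h : RoughData α x X ϖ) (i : ℕ) : X i i = 0 := by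
  have h1 := h.chen i i i
  have h2 : tens (0 : E m) (0 : E m) = 0 := by ext k; simp [tens]
  rw [h.x_self, h2] at h1
  simpa using h1

/-- Constant in the first order expansion of the scheme. -/
def remC (m : ℕ) (G : ℝ) : ℝ := (m : ℝ) ^ 2 * G ^ 2 + 2

/-- Constant in the additivity defect of the second order expansion of the scheme. -/
def defC (m : ℕ) (G : ℝ) : ℝ := G * (remC m G + G ^ 2 + 2 * (m : ℝ) ^ 2 * G * (G + remC m G))

/-- Constant in the increments of the linearized scheme. -/
def linC (m : ℕ) (G : ℝ) : ℝ := 2 + 2 * (m : ℝ) ^ 2 * G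

/-- Constant in the additivity defect of the expansion of the linearized scheme. -/
def linDefC (m : ℕ) (G : ℝ) : ℝ :=
  G * (G + remC m G) * linC m G + G * (2 * (m : ℝ) ^ 2 * G + 1) + remC m G + G ^ 2
    + (m : ℝ) ^ 2 * (2 * G ^ 2 * linC m G + 4 * G * (G + remC m G))

theorem remC_pos (m : ℕ) (G : ℝ) : 0 < remC m G := by unfold remC; positivity

theorem linC_pos (m : ℕ) {G : ℝ} (hG : 1 ≤ G) : 0 < linC m G := by
  have : 0 < G := by linarith
  unfold linC; positivity

theorem defC_pos (m : ℕ) {G : ℝ} (hG : 1 ≤ G) : 0 < defC m G := by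
  have : 0 < G := by linarith
  have := remC_pos m G
  unfold defC; positivity

theorem linDefC_pos (m : ℕ) {G : ℝ} (hG : 1 ≤ G) : 0 < linDefC m G := by
  have : 0 < G := by linarith
  have := remC_pos m G
  have := linC_pos m hG
  unfold linDefC; positivity

/-- An expansion of the scheme is valid over intervals whose control is at most this threshold to
the power `1 / α`. -/
def shortRoot (α : ℝ) (m : ℕ) (G : ℝ) : ℝ :=
  min (1 / (sewC (3 * α) * defC m G + 1))
    (min (1 / (sewC (3 * α) * linDefC m G + 1)) (1 / (4 * G * linC m G)))

theorem shortRoot_pos {α : ℝ} (hα : 1 / 3 < α) (m : ℕ) {G : ℝ} (hG : 1 ≤ G) :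
    0 < shortRoot α m G := by
  have h0 : 0 < G := by linarith
  have h1 := sewC_pos (θ := 3 * α) (by linarith)
  have h2 := defC_pos m hG
  have h3 := linDefC_pos m hG
  have h4 := linC_pos m hG
  unfold shortRoot
  refine lt_min ?_ (lt_min ?_ ?_) <;> positivity

theorem shortRoot_le_one {α : ℝ} (hα : 1 / 3 < α) (m : ℕ) {G : ℝ} (hG : 1 ≤ G) :
    shortRoot α m G ≤ 1 := by
  have h1 := sewC_pos (θ := 3 * α) (by linarith)
  have h2 := defC_pos m hG
  refine (min_le_left _ _).trans ?_
  rw [div_le_one (by positivity)]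
  nlinarith

theorem shortRoot_def {α : ℝ} (hα : 1 / 3 < α) (m : ℕ) {G : ℝ} (hG : 1 ≤ G) :
    sewC (3 * α) * defC m G * shortRoot α m G ≤ 1 := by
  have h1 := sewC_pos (θ := 3 * α) (by linarith)
  have h2 := defC_pos m hG
  have h : shortRoot α m G ≤ 1 / (sewC (3 * α) * defC m G + 1) := min_le_left _ _
  have h3 := shortRoot_pos hα m hG
  rw [le_div_iff₀ (by positivity)] at h
  nlinarith

theorem shortRoot_linDef {α : ℝ} (hα : 1 / 3 < α) (m : ℕ) {G : ℝ} (hG : 1 ≤ G) :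
    sewC (3 * α) * linDefC m G * shortRoot α m G ≤ 1 := by
  have h1 := sewC_pos (θ := 3 * α) (by linarith)
  have h2 := linDefC_pos m hG
  have h : shortRoot α m G ≤ 1 / (sewC (3 * α) * linDefC m G + 1) :=
    (min_le_right _ _).trans (min_le_left _ _)
  have h3 := shortRoot_pos hα m hG
  rw [le_div_iff₀ (by positivity)] at h
  nlinarith

theorem shortRoot_lin {α : ℝ} (m : ℕ) {G : ℝ} (hG : 1 ≤ G) :
    4 * G * linC m G * shortRoot α m G ≤ 1 := by
  have h2 := linC_pos m hG
  have h : shortRoot α m G ≤ 1 / (4 * G * linC m G) :=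
    (min_le_right _ _).trans (min_le_right _ _)
  rw [le_div_iff₀ (by positivity)] at h
  linarith

/-- Controls at most this constant make an interval short. -/
def shortC (α : ℝ) (m : ℕ) (G : ℝ) : ℝ := shortRoot α m G ^ (1 / α)

theorem shortC_pos {α : ℝ} (hα : 1 / 3 < α) (m : ℕ) {G : ℝ} (hG : 1 ≤ G) : 0 < shortC α m G :=
  Real.rpow_pos_of_pos (shortRoot_pos hα m hG) _

theorem rpow_le_shortRoot {α : ℝ} (hα : 1 / 3 < α) (m : ℕ) {G : ℝ} (hG : 1 ≤ G) {w : ℝ}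
    (h0 : 0 ≤ w) (hw : w ≤ shortC α m G) : w ^ α ≤ shortRoot α m G := by
  have ha : 0 < α := by linarith
  calc w ^ α ≤ (shortC α m G) ^ α := by gcongr
    _ = shortRoot α m G := by
      rw [shortC, ← Real.rpow_mul (shortRoot_pos hα m hG).le, one_div_mul_cancel ha.ne',
        Real.rpow_one]

theorem shortC_le_one {α : ℝ} (hα : 1 / 3 < α) (m : ℕ) {G : ℝ} (hG : 1 ≤ G) :
    shortC α m G ≤ 1 :=
  Real.rpow_le_one (shortRoot_pos hα m hG).le (shortRoot_le_one hα m hG)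
    (by have : 0 < α := by linarith
        positivity)

/-- Lets the drift, which is of first order in the control, be counted among the second level terms
of order `2α ≤ 1`. -/
theorem le_rpow_sq {α w : ℝ} (hα' : α ≤ 1 / 2) (h0 : 0 ≤ w) (h1 : w ≤ 1) :
    w ≤ (w ^ α) ^ 2 := by
  rw [← Real.rpow_natCast, ← Real.rpow_mul h0]
  conv_lhs => rw [← Real.rpow_one w]
  exact Real.rpow_le_rpow_of_exponent_ge_of_imp h0 h1 (by push_cast; linarith)
    (fun _ _ => by norm_num at *)

theorem rpow_three_mul {α w : ℝ} (h0 : 0 ≤ w) : w ^ (3 * α) = (w ^ α) ^ 3 := by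
  rw [← Real.rpow_natCast, ← Real.rpow_mul h0]
  norm_num [mul_comm]

/-! ### Second order expansion of the scheme over a short stretch. -/

section Expansion

variable {V : Type*} [NormedAddCommGroup V] [NormedSpace ℝ V] {m : ℕ} {α G l : ℝ}
  {x : ℕ → ℕ → E m} {X : ℕ → ℕ → E2 m} {ϖ W : ℕ → ℕ → ℝ} {g : V → (E m →L[ℝ] V)}
  {z F : ℕ → V} {S T : ℕ}

/-- Remainder of the second order expansion of a solution `z` of the scheme with drift
increments `F`. -/
def expRem (g : V → (E m →L[ℝ] V)) (x : ℕ → ℕ → E m) (X : ℕ → ℕ → E2 m) (z F : ℕ → V)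
    (i j : ℕ) : V :=
  z j - z i - g (z i) (x i j) - contract (X i j) (secondCoef g (z i)) - ∑ k ∈ Finset.Ico i j, F k

/-- The assumptions under which a stretch `[S, T]` of the grid is short for the scheme. -/
structure ShortStretch (α G l : ℝ) (g : V → (E m →L[ℝ] V)) (x : ℕ → ℕ → E m)
    (X : ℕ → ℕ → E2 m) (ϖ W : ℕ → ℕ → ℝ) (z F : ℕ → V) (S T : ℕ) : Prop where
  lo : 1 / 3 < α
  hi : α ≤ 1 / 2
  coef : CoefBound g G l
  rough : RoughData α x X ϖ
  ctrl : IsControl W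
  le : ∀ i j, i ≤ j → ϖ i j ≤ W i j
  drift : ∀ i j, S ≤ i → i ≤ j → j ≤ T → ‖∑ k ∈ Finset.Ico i j, F k‖ ≤ W i j
  step : ∀ k, S ≤ k → k < T →
    z (k + 1) = z k + F k + g (z k) (x k (k + 1)) + contract (X k (k + 1)) (secondCoef g (z k))
  short : W S T ≤ shortC α m G

namespace ShortStretch

theorem le_short (h : ShortStretch α G l g x X ϖ W z F S T) {i j : ℕ} (hi : S ≤ i)
    (hij : i ≤ j) (hj : j ≤ T) : W i j ≤ shortC α m G :=
  (h.ctrl.mono hi hij hj).trans h.short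

theorem root_le (h : ShortStretch α G l g x X ϖ W z F S T) {i j : ℕ} (hi : S ≤ i)
    (hij : i ≤ j) (hj : j ≤ T) : W i j ^ α ≤ shortRoot α m G :=
  rpow_le_shortRoot h.lo m h.coef.one_le (h.ctrl.nonneg i j) (h.le_short hi hij hj)

theorem root_le_one (h : ShortStretch α G l g x X ϖ W z F S T) {i j : ℕ} (hi : S ≤ i)
    (hij : i ≤ j) (hj : j ≤ T) : W i j ^ α ≤ 1 :=
  (h.root_le hi hij hj).trans (shortRoot_le_one h.lo m h.coef.one_le)

theorem root_nonneg (h : ShortStretch α G l g x X ϖ W z F S T) (i j : ℕ) : 0 ≤ W i j ^ α :=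
  Real.rpow_nonneg (h.ctrl.nonneg i j) _

theorem norm_x_le (h : ShortStretch α G l g x X ϖ W z F S T) {i j : ℕ} (hij : i ≤ j) :
    ‖x i j‖ ≤ W i j ^ α := by
  refine (h.rough.bx i j hij).trans ?_
  have := h.lo
  exact Real.rpow_le_rpow (h.rough.ctrl.nonneg i j) (h.le i j hij) (by linarith)

theorem norm_X_le (h : ShortStretch α G l g x X ϖ W z F S T) {i j : ℕ} (hij : i ≤ j) :
    ‖X i j‖ ≤ (W i j ^ α) ^ 2 := by
  refine (h.rough.bX i j hij).trans ?_
  have := h.lo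
  have h1 := Real.rpow_nonneg (h.rough.ctrl.nonneg i j) α
  exact pow_le_pow_left₀ h1
    (Real.rpow_le_rpow (h.rough.ctrl.nonneg i j) (h.le i j hij) (by linarith)) 2

theorem root_mono (h : ShortStretch α G l g x X ϖ W z F S T) {i i' j' j : ℕ} (h1 : i ≤ i')
    (h2 : i' ≤ j') (h3 : j' ≤ j) : W i' j' ^ α ≤ W i j ^ α := by
  have := h.lo
  exact Real.rpow_le_rpow (h.ctrl.nonneg i' j') (h.ctrl.mono h1 h2 h3) (by linarith)

/-- The bound on `expRem` is a hypothesis because the estimate is used inside the sewing induction,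
where only the a priori bound for the left part is at hand. -/
theorem norm_remainder_le (h : ShortStretch α G l g x X ϖ W z F S T) {i u : ℕ} (hi : S ≤ i)
    (hiu : i ≤ u) (hu : u ≤ T) (hJ : ‖expRem g x X z F i u‖ ≤ (W i u ^ α) ^ 2) :
    ‖z u - z i - g (z i) (x i u)‖ ≤ remC m G * (W i u ^ α) ^ 2 := by
  have hlo := h.lo
  have e : z u - z i - g (z i) (x i u) = contract (X i u) (secondCoef g (z i))
      + (∑ k ∈ Finset.Ico i u, F k + expRem g x X z F i u) := by
    unfold expRem; abel
  have h1 := norm_contract_le_of_le (h.norm_X_le hiu) (h.coef.norm_secondCoef_le (z i))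
  have h2 : ‖∑ k ∈ Finset.Ico i u, F k‖ ≤ (W i u ^ α) ^ 2 :=
    (h.drift i u hi hiu hu).trans (le_rpow_sq h.hi (h.ctrl.nonneg i u)
      ((h.le_short hi hiu hu).trans (shortC_le_one h.lo m h.coef.one_le)))
  have h3 : (m : ℝ) ^ 2 * (W i u ^ α) ^ 2 * (l * G) ≤ (m : ℝ) ^ 2 * (W i u ^ α) ^ 2 * (G * G) := by
    have := h.coef.le
    have := h.coef.one_le
    gcongr
  rw [e]
  have h4 := norm_add_le (contract (X i u) (secondCoef g (z i)))
    (∑ k ∈ Finset.Ico i u, F k + expRem g x X z F i u)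
  have h5 := norm_add_le (∑ k ∈ Finset.Ico i u, F k) (expRem g x X z F i u)
  unfold remC
  nlinarith

theorem norm_increment_le (h : ShortStretch α G l g x X ϖ W z F S T) {i u : ℕ} (hi : S ≤ i)
    (hiu : i ≤ u) (hu : u ≤ T)
    (hR : ‖z u - z i - g (z i) (x i u)‖ ≤ remC m G * (W i u ^ α) ^ 2) :
    ‖z u - z i‖ ≤ (G + remC m G) * W i u ^ α := by
  have e : z u - z i = g (z i) (x i u) + (z u - z i - g (z i) (x i u)) := by abel
  have h1 : ‖g (z i) (x i u)‖ ≤ G * W i u ^ α :=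
    ((g (z i)).le_of_opNorm_le (h.coef.b0 _) _).trans (by
      have := h.coef.one_le
      have := h.norm_x_le hiu
      gcongr)
  have h2 : (W i u ^ α) ^ 2 ≤ W i u ^ α := by
    have := h.root_nonneg i u
    have := h.root_le_one hi hiu hu
    nlinarith
  have h3 := remC_pos m G
  rw [e]
  refine (norm_add_le _ _).trans ?_
  nlinarith

/-- The drift sums are additive and drop out, and Chen's term cancels the first order change of `g`.
What is left pairs an error of order `2α` with `x` and one of order `α` with `X`, so it is of order
`3α > 1`. -/
theorem expRem_defect (h : ShortStretch α G l g x X ϖ W z F S T) {i u j : ℕ} (hiu : i ≤ u)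
    (huj : u ≤ j) :
    expRem g x X z F i j - expRem g x X z F i u - expRem g x X z F u j
      = (g (z u) - g (z i) - secondCoef g (z i) (x i u)) (x u j)
        + contract (X u j) (secondCoef g (z u) - secondCoef g (z i)) := by
  have h1 : ∑ k ∈ Finset.Ico i j, F k = ∑ k ∈ Finset.Ico i u, F k + ∑ k ∈ Finset.Ico u j, F k :=
    (Finset.sum_Ico_consecutive _ hiu huj).symm
  have h2 : X i j = X i u + X u j + tens (x i u) (x u j) := by
    rw [← h.rough.chen i u j]; abel
  unfold expRem
  rw [h1, h2, h.rough.add i u j, add_contract, add_contract, contract_tens, contract_sub]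
  simp only [map_add, sub_apply]
  abel

/-- Second order expansion of the scheme over a short stretch. -/
theorem norm_expRem_le (h : ShortStretch α G l g x X ϖ W z F S T) {i j : ℕ} (hi : S ≤ i)
    (hij : i ≤ j) (hj : j ≤ T) :
    ‖expRem g x X z F i j‖ ≤ sewC (3 * α) * defC m G * (W i j ^ α) ^ 3 := by
  have hlo := h.lo
  have hG := h.coef.one_le
  have l0 := h.coef.nonneg
  have lG := h.coef.le
  have hB := defC_pos m hG
  rw [← rpow_three_mul (h.ctrl.nonneg i j)]
  refine discrete_sewing (expRem g x X z F) h.ctrl (by linarith) hB.le S T ?_ ?_ ?_ i j hi hij hj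
  · intro i _ _
    simp [expRem, h.rough.x_self, h.rough.X_self, contract]
  · intro i h1 h2
    rw [expRem, h.step i h1 (by omega)]
    simp
    abel
  · intro i u j hi hiu huj hj hJ
    rw [rpow_three_mul (h.ctrl.nonneg i u)] at hJ
    rw [rpow_three_mul (h.ctrl.nonneg i j)]
    have o0 := h.root_nonneg i u
    have o0' := h.root_nonneg i j
    have oc := h.root_le hi hiu (huj.trans hj)
    have om := h.root_mono le_rfl hiu huj
    have om' := h.root_mono hiu huj le_rfl
    have hK := shortRoot_def h.lo m hG
    have hs := sewC_pos (θ := 3 * α) (by linarith)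
    have r0 := remC_pos m G
    -- One of the three powers in the a priori bound is spent on its constant, by the choice of
    -- `shortRoot`. This closes the nonlinear bootstrap within the induction.
    have hJ' : ‖expRem g x X z F i u‖ ≤ (W i u ^ α) ^ 2 := by
      refine hJ.trans ?_
      have : sewC (3 * α) * defC m G * W i u ^ α ≤ 1 := by
        refine le_trans ?_ hK
        gcongr
      nlinarith [sq_nonneg (W i u ^ α)]
    have hR := h.norm_remainder_le hi hiu (huj.trans hj) hJ'
    have hI := h.norm_increment_le hi hiu (huj.trans hj) hR
    have t1 := h.coef.first_order (y := z i) (y' := z u) (x := x i u)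
      (R := z u - z i - g (z i) (x i u)) (by abel)
    have t2 := h.coef.secondCoef_lip (z i) (z u)
    rw [h.expRem_defect hiu huj]
    have s1 : ‖(g (z u) - g (z i) - secondCoef g (z i) (x i u)) (x u j)‖
        ≤ G * (remC m G + G ^ 2) * (W i j ^ α) ^ 3 := by
      refine (ContinuousLinearMap.le_opNorm _ _).trans ?_
      calc _ ≤ (G * (remC m G * (W i j ^ α) ^ 2) + G * G ^ 2 * (W i j ^ α) ^ 2) * W i j ^ α := by
            refine mul_le_mul (t1.trans (add_le_add ?_ ?_))
              ((h.norm_x_le huj).trans om') (norm_nonneg _) (by positivity)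
            · refine mul_le_mul lG (hR.trans ?_) (norm_nonneg _) (by positivity)
              gcongr
            · have := (h.norm_x_le hiu).trans om
              gcongr
        _ = _ := by ring
    have s2 : ‖contract (X u j) (secondCoef g (z u) - secondCoef g (z i))‖
        ≤ G * (2 * (m : ℝ) ^ 2 * G * (G + remC m G)) * (W i j ^ α) ^ 3 := by
      have hX : ‖X u j‖ ≤ (W i j ^ α) ^ 2 := by
        refine (h.norm_X_le huj).trans ?_
        have := h.root_nonneg u j
        gcongr
      calc _ ≤ (m : ℝ) ^ 2 * (W i j ^ α) ^ 2 * (2 * G * G * ((G + remC m G) * W i j ^ α)) := by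
            refine norm_contract_le_of_le hX (t2.trans ?_)
            refine mul_le_mul (by gcongr) (hI.trans (by gcongr)) (norm_nonneg _) (by positivity)
        _ = _ := by ring
    refine (norm_add_le _ _).trans ((add_le_add s1 s2).trans (le_of_eq ?_))
    unfold defC
    ring

theorem norm_expRem_le_sq (h : ShortStretch α G l g x X ϖ W z F S T) {i j : ℕ} (hi : S ≤ i)
    (hij : i ≤ j) (hj : j ≤ T) : ‖expRem g x X z F i j‖ ≤ (W i j ^ α) ^ 2 := by
  refine (h.norm_expRem_le hi hij hj).trans ?_
  have hlo := h.lo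
  have hs := sewC_pos (θ := 3 * α) (by linarith)
  have hB := defC_pos m h.coef.one_le
  have : sewC (3 * α) * defC m G * W i j ^ α ≤ 1 := by
    refine le_trans ?_ (shortRoot_def h.lo m h.coef.one_le)
    have := h.root_le hi hij hj
    gcongr
  nlinarith [sq_nonneg (W i j ^ α)]

theorem norm_rem_le (h : ShortStretch α G l g x X ϖ W z F S T) {i j : ℕ} (hi : S ≤ i)
    (hij : i ≤ j) (hj : j ≤ T) :
    ‖z j - z i - g (z i) (x i j)‖ ≤ remC m G * (W i j ^ α) ^ 2 :=
  h.norm_remainder_le hi hij hj (h.norm_expRem_le_sq hi hij hj)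

theorem norm_inc_le (h : ShortStretch α G l g x X ϖ W z F S T) {i j : ℕ} (hi : S ≤ i)
    (hij : i ≤ j) (hj : j ≤ T) : ‖z j - z i‖ ≤ (G + remC m G) * W i j ^ α :=
  h.norm_increment_le hi hij hj (h.norm_rem_le hi hij hj)

end ShortStretch

end Expansion

end RoughEuler

end

noncomputable section

namespace RoughEuler

set_option maxSynthPendingDepth 3

/-! ### Linearized noise flow over a short stretch. -/

section Linearization

variable {V : Type*} [NormedAddCommGroup V] [NormedSpace ℝ V] {m : ℕ} {α G l : ℝ}
  {x : ℕ → ℕ → E m} {X : ℕ → ℕ → E2 m} {ϖ W : ℕ → ℕ → ℝ} {g : V → (E m →L[ℝ] V)}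
  {z F : ℕ → V} {S T : ℕ}

/-- Derivative of one noise step along `z`. -/
def linStep (g : V → (E m →L[ℝ] V)) (x : ℕ → ℕ → E m) (X : ℕ → ℕ → E2 m) (z : ℕ → V) (k : ℕ) :
    V →ₗ[ℝ] V where
  toFun v := v + fderiv ℝ g (z k) v (x k (k + 1))
    + contract (X k (k + 1)) (secondCoefDeriv g (z k) v)
  map_add' v w := by
    rw [secondCoefDeriv_add, contract_add]
    simp only [map_add, add_apply]
    abel
  map_smul' c v := by
    rw [secondCoefDeriv_smul, contract_smul]
    simp only [map_smul, smul_apply, RingHom.id_apply, smul_add]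

/-- Composition of the linearized noise steps `k, …, k + n - 1`. -/
def linFlow (g : V → (E m →L[ℝ] V)) (x : ℕ → ℕ → E m) (X : ℕ → ℕ → E2 m) (z : ℕ → V) :
    ℕ → ℕ → V →ₗ[ℝ] V
  | _, 0 => LinearMap.id
  | k, n + 1 => linFlow g x X z (k + 1) n ∘ₗ linStep g x X z k

theorem linFlow_succ_apply (k n : ℕ) (v : V) :
    linFlow g x X z k (n + 1) v = linStep g x X z (k + n) (linFlow g x X z k n v) := by
  induction n generalizing k v with
  | zero => rfl
  | succ n ih =>
    have h1 : linFlow g x X z k (n + 1 + 1) v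
        = linFlow g x X z (k + 1) (n + 1) (linStep g x X z k v) := rfl
    have h2 : linFlow g x X z k (n + 1) v
        = linFlow g x X z (k + 1) n (linStep g x X z k v) := rfl
    rw [h1, h2, ih, show k + 1 + n = k + (n + 1) by omega]

/-- Remainder of the second order expansion of a solution `v` of the linearized scheme. -/
def linRem (g : V → (E m →L[ℝ] V)) (x : ℕ → ℕ → E m) (X : ℕ → ℕ → E2 m) (z v : ℕ → V)
    (i j : ℕ) : V :=
  v j - v i - fderiv ℝ g (z i) (v i) (x i j) - contract (X i j) (secondCoefDeriv g (z i) (v i))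

namespace ShortStretch

/-- The linearized form of the Chen cancellation. The product rule produces `D²g` with `v` in the
first slot, while the change of `Dg` along the noise has it in the second; the symmetry of `D²g`
reconciles them. -/
theorem linRem_defect (h : ShortStretch α G l g x X ϖ W z F S T) (v : ℕ → V) (i u j : ℕ) :
    linRem g x X z v i j - linRem g x X z v i u - linRem g x X z v u j
      = ((fderiv ℝ g (z u) - fderiv ℝ g (z i)) (v u - v i)
          + fderiv ℝ g (z i) (v u - v i - fderiv ℝ g (z i) (v i) (x i u))
          + (fderiv ℝ g (z u) - fderiv ℝ g (z i)
            - fderiv ℝ (fderiv ℝ g) (z i) (g (z i) (x i u))) (v i)) (x u j)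
        + contract (X u j) (secondCoefDeriv g (z u) (v u - v i)
          + (secondCoefDeriv g (z u) (v i) - secondCoefDeriv g (z i) (v i))) := by
  have h2 : X i j = X i u + X u j + tens (x i u) (x u j) := by
    rw [← h.rough.chen i u j]; abel
  have h3 : secondCoefDeriv g (z i) (v i) (x i u) (x u j)
      = fderiv ℝ (fderiv ℝ g) (z i) (g (z i) (x i u)) (v i) (x u j)
        + fderiv ℝ g (z i) (fderiv ℝ g (z i) (v i) (x i u)) (x u j) := by
    rw [h.coef.symm (z i) (g (z i) (x i u)) (v i)]
    simp [secondCoefDeriv]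
  unfold linRem
  rw [h2, h.rough.add i u j, add_contract, add_contract, contract_tens, secondCoefDeriv_sub,
    sub_add_sub_cancel, contract_sub, h3]
  simp only [map_add, map_sub, sub_apply, add_apply]
  abel

/-- Expansion of the linearized scheme over a short stretch. -/
theorem norm_lin_increment_le (h : ShortStretch α G l g x X ϖ W z F S T) {v : ℕ → V} {S' : ℕ}
    (hS' : S ≤ S') {b : ℝ} (hv : ∀ k, S' ≤ k → k < T → v (k + 1) = linStep g x X z k (v k))
    (hb : ∀ k, S' ≤ k → k ≤ T → ‖v k‖ ≤ b) {i j : ℕ} (hi : S' ≤ i) (hij : i ≤ j) (hj : j ≤ T) :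
    ‖v j - v i‖ ≤ l * b * linC m G * W i j ^ α := by
  have hlo := h.lo
  have hG := h.coef.one_le
  have l0 := h.coef.nonneg
  have lG := h.coef.le
  have hB := linDefC_pos m hG
  have hs := sewC_pos (θ := 3 * α) (by linarith)
  have r0 := remC_pos m G
  have c0 := linC_pos m hG
  have b0 : 0 ≤ b := (norm_nonneg _).trans (hb i hi (hij.trans hj))
  -- Both bounds are conditional on the cubic bound for `linRem`, since they are needed within the
  -- sewing induction as well as after it.
  have hsq : ∀ {i u : ℕ}, S' ≤ i → i ≤ u → u ≤ T →
      ‖linRem g x X z v i u‖ ≤ sewC (3 * α) * (l * b * linDefC m G) * (W i u ^ α) ^ 3 →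
      ‖v u - v i - fderiv ℝ g (z i) (v i) (x i u)‖
        ≤ l * b * (2 * (m : ℝ) ^ 2 * G + 1) * (W i u ^ α) ^ 2 ∧
      ‖v u - v i‖ ≤ l * b * linC m G * W i u ^ α := by
    intro i u hi hiu hu hJ
    have o0 := h.root_nonneg i u
    have o1 := h.root_le_one (hS'.trans hi) hiu hu
    have oc := h.root_le (hS'.trans hi) hiu hu
    have hJ' : ‖linRem g x X z v i u‖ ≤ l * b * (W i u ^ α) ^ 2 := by
      refine hJ.trans ?_
      have : sewC (3 * α) * linDefC m G * W i u ^ α ≤ 1 := by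
        refine le_trans ?_ (shortRoot_linDef h.lo m hG)
        gcongr
      calc _ = (sewC (3 * α) * linDefC m G * W i u ^ α) * (l * b * (W i u ^ α) ^ 2) := by ring
        _ ≤ 1 * (l * b * (W i u ^ α) ^ 2) := by gcongr
        _ = _ := one_mul _
    have hvi := hb i hi (hiu.trans hu)
    have t1 : ‖v u - v i - fderiv ℝ g (z i) (v i) (x i u)‖
        ≤ l * b * (2 * (m : ℝ) ^ 2 * G + 1) * (W i u ^ α) ^ 2 := by
      have e : v u - v i - fderiv ℝ g (z i) (v i) (x i u)
          = contract (X i u) (secondCoefDeriv g (z i) (v i)) + linRem g x X z v i u := by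
        unfold linRem; abel
      rw [e]
      have h1 := norm_contract_le_of_le (h.norm_X_le hiu)
        ((h.coef.norm_secondCoefDeriv_le (z i) (v i)).trans
          (show _ ≤ 2 * l * G * b by gcongr))
      refine (norm_add_le _ _).trans ((add_le_add h1 hJ').trans (le_of_eq ?_))
      ring
    refine ⟨t1, ?_⟩
    have e : v u - v i = fderiv ℝ g (z i) (v i) (x i u)
        + (v u - v i - fderiv ℝ g (z i) (v i) (x i u)) := by abel
    rw [e]
    have t2 : ‖fderiv ℝ g (z i) (v i) (x i u)‖ ≤ l * b * W i u ^ α := by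
      refine (ContinuousLinearMap.le_opNorm _ _).trans ?_
      have h1 : ‖fderiv ℝ g (z i) (v i)‖ ≤ l * b :=
        (ContinuousLinearMap.le_of_opNorm_le _ (h.coef.b1 _) _).trans (by gcongr)
      exact mul_le_mul h1 (h.norm_x_le hiu) (norm_nonneg _) (by positivity)
    have t3 : l * b * (2 * (m : ℝ) ^ 2 * G + 1) * (W i u ^ α) ^ 2
        ≤ l * b * (2 * (m : ℝ) ^ 2 * G + 1) * (W i u ^ α) := by
      have : (W i u ^ α) ^ 2 ≤ W i u ^ α := by nlinarith
      gcongr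
    refine (norm_add_le _ _).trans ((add_le_add t2 (t1.trans t3)).trans (le_of_eq ?_))
    unfold linC
    ring
  refine (hsq hi hij hj ?_).2
  rw [← rpow_three_mul (h.ctrl.nonneg i j)]
  refine discrete_sewing (linRem g x X z v) h.ctrl (by linarith) (by positivity) S' T
    ?_ ?_ ?_ i j hi hij hj
  · intro i _ _
    simp [linRem, h.rough.x_self, h.rough.X_self, contract]
  · intro i h1 h2
    rw [linRem, hv i h1 (by omega)]
    simp only [linStep, LinearMap.coe_mk, AddHom.coe_mk]
    abel
  · intro i u j hi hiu huj hj hJ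
    rw [rpow_three_mul (h.ctrl.nonneg i u)] at hJ
    rw [rpow_three_mul (h.ctrl.nonneg i j)]
    obtain ⟨t1, t2⟩ := hsq hi hiu (huj.trans hj) hJ
    have hSi := hS'.trans hi
    have o0 := h.root_nonneg i u
    have o0' := h.root_nonneg i j
    have om := h.root_mono le_rfl hiu huj
    have om' := h.root_mono hiu huj le_rfl
    have hvi := hb i hi (hiu.trans (huj.trans hj))
    have hR := h.norm_rem_le hSi hiu (huj.trans hj)
    have hI := h.norm_inc_le hSi hiu (huj.trans hj)
    generalize hw : W i j ^ α = w at *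
    have hR' : ‖z u - z i - g (z i) (x i u)‖ ≤ remC m G * w ^ 2 := hR.trans (by gcongr)
    have hI' : ‖z u - z i‖ ≤ (G + remC m G) * w := hI.trans (by gcongr)
    have t1' : ‖v u - v i - fderiv ℝ g (z i) (v i) (x i u)‖
        ≤ l * b * (2 * (m : ℝ) ^ 2 * G + 1) * w ^ 2 := t1.trans (by gcongr)
    have t2' : ‖v u - v i‖ ≤ l * b * linC m G * w := t2.trans (by gcongr)
    have a1 : ‖(fderiv ℝ g (z u) - fderiv ℝ g (z i)) (v u - v i)‖
        ≤ l * b * (G * (G + remC m G) * linC m G) * w ^ 2 := by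
      calc _ ≤ (G * ((G + remC m G) * w)) * (l * b * linC m G * w) := by
            refine (ContinuousLinearMap.le_opNorm _ _).trans (mul_le_mul
              ((h.coef.lip1 (z i) (z u)).trans ?_) t2' (norm_nonneg _) (by positivity))
            gcongr
        _ = _ := by ring
    have a2 : ‖fderiv ℝ g (z i) (v u - v i - fderiv ℝ g (z i) (v i) (x i u))‖
        ≤ l * b * (G * (2 * (m : ℝ) ^ 2 * G + 1)) * w ^ 2 := by
      calc _ ≤ G * (l * b * (2 * (m : ℝ) ^ 2 * G + 1) * w ^ 2) :=
            (ContinuousLinearMap.le_opNorm _ _).trans (mul_le_mul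
              ((h.coef.b1 (z i)).trans lG) t1' (norm_nonneg _) (by positivity))
        _ = _ := by ring
    have a3 : ‖(fderiv ℝ g (z u) - fderiv ℝ g (z i)
            - fderiv ℝ (fderiv ℝ g) (z i) (g (z i) (x i u))) (v i)‖
        ≤ l * b * (remC m G + G ^ 2) * w ^ 2 := by
      have := h.coef.first_order_deriv (y := z i) (y' := z u) (x := x i u)
        (R := z u - z i - g (z i) (x i u)) (by abel)
      calc _ ≤ (l * (remC m G * w ^ 2) + l * G ^ 2 * w ^ 2) * b := by
            refine (ContinuousLinearMap.le_opNorm _ _).trans (mul_le_mul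
              (this.trans ?_) hvi (norm_nonneg _) (by positivity))
            have := (h.norm_x_le hiu).trans om
            gcongr
        _ = _ := by ring
    have hX : ‖X u j‖ ≤ w ^ 2 := (h.norm_X_le huj).trans (by
      have := h.root_nonneg u j
      gcongr)
    have a4 : ‖secondCoefDeriv g (z u) (v u - v i)
          + (secondCoefDeriv g (z u) (v i) - secondCoefDeriv g (z i) (v i))‖
        ≤ l * b * (2 * G ^ 2 * linC m G + 4 * G * (G + remC m G)) * w := by
      have e1 : ‖secondCoefDeriv g (z u) (v u - v i)‖ ≤ 2 * G * G * (l * b * linC m G * w) := by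
        refine (h.coef.norm_secondCoefDeriv_le _ _).trans ?_
        gcongr
      have e2 : ‖secondCoefDeriv g (z u) (v i) - secondCoefDeriv g (z i) (v i)‖
          ≤ 4 * l * G * ((G + remC m G) * w) * b := by
        refine (h.coef.secondCoefDeriv_lip _ _ _).trans ?_
        gcongr
      refine (norm_add_le _ _).trans ((add_le_add e1 e2).trans (le_of_eq ?_))
      ring
    rw [h.linRem_defect v i u j]
    refine (norm_add_le _ _).trans ?_
    have hx : ‖x u j‖ ≤ w := (h.norm_x_le huj).trans om'
    have p1 := (ContinuousLinearMap.le_opNorm _ (x u j)).trans (mul_le_mul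
      ((norm_add_le _ _).trans (add_le_add ((norm_add_le _ _).trans (add_le_add a1 a2)) a3)) hx
      (norm_nonneg _) (by positivity))
    have p2 := norm_contract_le_of_le hX a4
    refine (add_le_add p1 p2).trans (le_of_eq ?_)
    unfold linDefC
    ring

/-- The linearized noise flow over a short stretch is close to the identity. -/
theorem norm_linFlow_sub_le (h : ShortStretch α G l g x X ϖ W z F S T) {k : ℕ} (hk : S ≤ k)
    (hkT : k ≤ T) (v : V) :
    ‖linFlow g x X z k (T - k) v - v‖ ≤ l / (2 * G) * ‖v‖ := by
  have hG := h.coef.one_le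
  have l0 := h.coef.nonneg
  have lG := h.coef.le
  have c0 := linC_pos m hG
  let p : ℕ → V := fun j => linFlow g x X z k (j - k) v
  have hp : ∀ j, k ≤ j → j < T → p (j + 1) = linStep g x X z j (p j) := by
    intro j hj _
    have : j + 1 - k = (j - k) + 1 := by omega
    simp only [p]
    rw [this, linFlow_succ_apply, show k + (j - k) = j by omega]
  have hpk : p k = v := by simp [p, linFlow]
  -- The a priori bound is the maximum of `‖p‖` itself; since the relative increment `l / (4 G)` is
  -- at most 1/4, it is absorbed and the maximum is at most `2 ‖v‖`.
  obtain ⟨j₀, hj₀, hmax⟩ := Finset.exists_max_image (Finset.Icc k T) (fun j => ‖p j‖)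
    ⟨k, Finset.mem_Icc.2 ⟨le_rfl, hkT⟩⟩
  rw [Finset.mem_Icc] at hj₀
  have hb : ∀ j, k ≤ j → j ≤ T → ‖p j‖ ≤ ‖p j₀‖ := fun j h1 h2 =>
    hmax j (Finset.mem_Icc.2 ⟨h1, h2⟩)
  have key : ∀ j, k ≤ j → j ≤ T → ‖p j - v‖ ≤ l / (4 * G) * ‖p j₀‖ := by
    intro j h1 h2
    have := h.norm_lin_increment_le hk hp hb le_rfl h1 h2
    rw [hpk] at this
    refine this.trans ?_
    have h3 := h.root_le hk h1 h2
    have h4 := shortRoot_lin (α := α) m hG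
    have h5 : linC m G * W k j ^ α ≤ 1 / (4 * G) := by
      rw [le_div_iff₀ (by positivity)]
      calc linC m G * W k j ^ α * (4 * G) = 4 * G * linC m G * W k j ^ α := by ring
        _ ≤ 4 * G * linC m G * shortRoot α m G := by gcongr
        _ ≤ 1 := h4
    calc l * ‖p j₀‖ * linC m G * W k j ^ α = l * ‖p j₀‖ * (linC m G * W k j ^ α) := by ring
      _ ≤ l * ‖p j₀‖ * (1 / (4 * G)) := by gcongr
      _ = _ := by ring
  have hle : l / (4 * G) ≤ 1 / 4 := by
    rw [div_le_div_iff₀ (by positivity) (by norm_num)]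
    linarith
  have h1 : ‖p j₀‖ ≤ 2 * ‖v‖ := by
    have e := key j₀ hj₀.1 hj₀.2
    have e2 : ‖p j₀‖ ≤ ‖v‖ + ‖p j₀ - v‖ := by
      have := norm_add_le v (p j₀ - v)
      rwa [add_sub_cancel] at this
    have e3 : l / (4 * G) * ‖p j₀‖ ≤ 1 / 4 * ‖p j₀‖ := by gcongr
    linarith [norm_nonneg (p j₀)]
  calc ‖linFlow g x X z k (T - k) v - v‖ ≤ l / (4 * G) * ‖p j₀‖ := key T hkT le_rfl
    _ ≤ l / (4 * G) * (2 * ‖v‖) := by gcongr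
    _ = l / (2 * G) * ‖v‖ := by ring

end ShortStretch

end Linearization

end RoughEuler

end

noncomputable section

namespace RoughEuler

set_option maxSynthPendingDepth 3

/-! ### Dissipative estimate over a unit of time -/

theorem isControl_length {q : ℝ} (hq : 0 ≤ q) :
    IsControl (fun i j => q * ((j - i : ℕ) : ℝ)) where
  nonneg i j := by positivity
  superadd i u j h1 h2 := by
    rw [← mul_add, ← Nat.cast_add, show u - i + (j - u) = j - i by omega]

/-- Either `t ^ β` is below `δ`, or `t` is so large that `t ^ (β - 1) ≤ δ ^ (1 - 1 / β)`. Fractional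
powers of the control thus become linear and additive along a partition. -/
theorem rpow_le_add_mul {δ β t : ℝ} (hδ : 0 < δ) (hβ : 0 < β) (hβ1 : β ≤ 1) (ht : 0 ≤ t) :
    t ^ β ≤ δ + δ ^ (1 - 1 / β) * t := by
  rcases le_or_gt (t ^ β) δ with h | h
  · have := Real.rpow_nonneg hδ.le (1 - 1 / β)
    nlinarith [mul_nonneg this ht]
  · have ht0 : 0 < t := by
      rcases ht.eq_or_lt with e | e
      · rw [← e, Real.zero_rpow hβ.ne'] at h; linarith
      · exact e
    have h1 : δ ^ (1 / β) ≤ t := by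
      calc δ ^ (1 / β) ≤ (t ^ β) ^ (1 / β) := by gcongr
        _ = t := by rw [← Real.rpow_mul ht, mul_one_div_cancel hβ.ne', Real.rpow_one]
    have h2 : t ^ (β - 1) ≤ δ ^ (1 - 1 / β) := by
      calc t ^ (β - 1) ≤ (δ ^ (1 / β)) ^ (β - 1) :=
            Real.rpow_le_rpow_of_nonpos (by positivity) h1 (by linarith)
        _ = δ ^ (1 - 1 / β) := by
            rw [← Real.rpow_mul hδ.le]
            congr 1
            field_simp
    have h3 : t ^ β = t ^ (β - 1) * t := by
      rw [← Real.rpow_add_one ht0.ne']; ring_nf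
    rw [h3]
    have := mul_le_mul_of_nonneg_right h2 ht
    linarith

section Dissipative

variable {V : Type*} [NormedAddCommGroup V] [InnerProductSpace ℝ V]

/-- The explicit Euler step of a dissipative vector field is a contraction up to `O(h)`. -/
theorem norm_add_smul_drift_le {f : V → V} {L F D₁ D₂ h : ℝ} (hF : 0 ≤ F) (hL : 0 ≤ L)
    (hD1 : 0 < D₁) (hD2 : 0 < D₂)
    (hlin : ∀ y, ‖f y‖ ≤ F + L * ‖y‖) (hdiss : ∀ y, inner ℝ y (f y) ≤ D₁ - D₂ * ‖y‖ ^ 2)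
    (h0 : 0 ≤ h) (h1 : h ≤ 1) (hhL : h * L ^ 2 ≤ D₂ / 2) (hhD : h * D₂ ≤ 1) (y : V) :
    ‖y + h • f y‖ ≤ Real.exp (-(D₂ / 2) * h) * ‖y‖ + (2 * (D₁ + F ^ 2) + F + L + D₂) * h := by
  have hexp : 1 - h * D₂ / 2 ≤ Real.exp (-(D₂ / 2) * h) := by
    have := Real.add_one_le_exp (-(D₂ / 2) * h)
    linarith
  have hy := norm_nonneg y
  have hred : ‖y + h • f y‖ ≤ (1 - h * D₂ / 2) * ‖y‖ + (2 * (D₁ + F ^ 2) + F + L + D₂) * h := by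
    have hf := hlin y
    -- For `‖y‖ ≥ 1` the squares are compared, and the cross term on the right, bounded below
    -- through `‖y‖ ≥ 1`, pays for the additive error. For `‖y‖ < 1` the whole drift step is `O(h)`.
    rcases le_or_gt 1 ‖y‖ with hy1 | hy1
    · have hR : 0 ≤ (1 - h * D₂ / 2) * ‖y‖ + (2 * (D₁ + F ^ 2) + F + L + D₂) * h := by
        have : 0 ≤ 1 - h * D₂ / 2 := by linarith
        positivity
      refine abs_le_of_sq_le_sq' ?_ hR |>.2
      have e : ‖y + h • f y‖ ^ 2 = ‖y‖ ^ 2 + 2 * h * inner ℝ y (f y) + h ^ 2 * ‖f y‖ ^ 2 := by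
        rw [norm_add_sq_real, inner_smul_right, norm_smul, Real.norm_eq_abs, mul_pow, sq_abs]
        ring
      have e1 : ‖f y‖ ^ 2 ≤ 2 * F ^ 2 + 2 * L ^ 2 * ‖y‖ ^ 2 := by
        have := pow_le_pow_left₀ (norm_nonneg _) hf 2
        nlinarith [sq_nonneg (F - L * ‖y‖)]
      have e2 : h ^ 2 * ‖f y‖ ^ 2 ≤ 2 * h * F ^ 2 + h * D₂ * ‖y‖ ^ 2 := by
        have a1 : h ^ 2 * ‖f y‖ ^ 2 ≤ h ^ 2 * (2 * F ^ 2 + 2 * L ^ 2 * ‖y‖ ^ 2) := by gcongr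
        have a2 : h ^ 2 * (2 * F ^ 2) ≤ 2 * h * F ^ 2 := by
          have : h ^ 2 ≤ h := by nlinarith
          nlinarith [sq_nonneg F]
        have a3 : h ^ 2 * (2 * L ^ 2 * ‖y‖ ^ 2) ≤ h * D₂ * ‖y‖ ^ 2 := by
          have : h * (h * L ^ 2) ≤ h * (D₂ / 2) := by gcongr
          nlinarith [sq_nonneg ‖y‖]
        linarith
      have e3 : 2 * h * inner ℝ y (f y) ≤ 2 * h * (D₁ - D₂ * ‖y‖ ^ 2) := by
        have := hdiss y
        gcongr
      have e4 : ‖y + h • f y‖ ^ 2 ≤ (1 - h * D₂) * ‖y‖ ^ 2 + 2 * h * (D₁ + F ^ 2) := by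
        rw [e]; linarith
      refine e4.trans ?_
      have b1 : (1 - h * D₂) * ‖y‖ ^ 2 ≤ ((1 - h * D₂ / 2) * ‖y‖) ^ 2 := by
        nlinarith [sq_nonneg (h * D₂ * ‖y‖)]
      have b2 : 2 * h * (D₁ + F ^ 2) ≤
          2 * ((1 - h * D₂ / 2) * ‖y‖) * ((2 * (D₁ + F ^ 2) + F + L + D₂) * h) := by
        have c1 : 1 / 2 ≤ (1 - h * D₂ / 2) * ‖y‖ := by nlinarith
        have c2 : 2 * h * (D₁ + F ^ 2) ≤ (2 * (D₁ + F ^ 2) + F + L + D₂) * h := by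
          nlinarith [mul_nonneg h0 hF, mul_nonneg h0 hL, mul_nonneg h0 hD2.le]
        have c3 : 0 ≤ (2 * (D₁ + F ^ 2) + F + L + D₂) * h := by positivity
        nlinarith
      have b3 := sq_nonneg ((2 * (D₁ + F ^ 2) + F + L + D₂) * h)
      rw [add_sq]
      linarith
    · have e : ‖y + h • f y‖ ≤ ‖y‖ + h * (F + L * ‖y‖) := by
        refine (norm_add_le _ _).trans ?_
        rw [norm_smul, Real.norm_of_nonneg h0]
        gcongr
      have e1 : h * (L * ‖y‖) ≤ h * L := by
        have : L * ‖y‖ ≤ L := by nlinarith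
        gcongr
      have e2 : h * D₂ / 2 * ‖y‖ ≤ h * D₂ := by
        have : 0 ≤ h * D₂ := by positivity
        nlinarith
      have e3 : 0 ≤ h * (D₁ + F ^ 2) := by positivity
      linarith
  refine hred.trans ?_
  gcongr

/-- An interval of the partition costs of order `c ^ (3α)` and there are of order `1 / c` of them.
As `3α > 1`, the total error is small for small `c`, even against a factor proportional to the
solution. -/
theorem exists_short_threshold {α a σ L D₂ c₀ : ℝ} (hα : 1 / 3 < α) (hσ : 0 < σ) (hc₀ : 0 < c₀)
    (hD2 : 0 < D₂) :
    ∃ c, 0 < c ∧ c ≤ c₀ ∧ c * L ^ 2 ≤ D₂ / 2 ∧ c * D₂ ≤ 1 ∧ a * c ^ (3 * α - 1) ≤ σ := by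
  have t0 : Tendsto (fun c : ℝ => c) (𝓝[>] 0) (𝓝 0) := tendsto_nhdsWithin_of_tendsto_nhds tendsto_id
  have t1 : Tendsto (fun c : ℝ => c * L ^ 2) (𝓝[>] 0) (𝓝 (0 * L ^ 2)) := t0.mul_const _
  have t2 : Tendsto (fun c : ℝ => c * D₂) (𝓝[>] 0) (𝓝 (0 * D₂)) := t0.mul_const _
  have t3 : Tendsto (fun c : ℝ => a * c ^ (3 * α - 1)) (𝓝[>] 0) (𝓝 (a * 0 ^ (3 * α - 1))) :=
    (t0.rpow_const (Or.inr (by linarith))).const_mul a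
  rw [zero_mul] at t1 t2
  rw [Real.zero_rpow (by linarith), mul_zero] at t3
  have := (self_mem_nhdsWithin (a := (0 : ℝ)) (s := Ioi 0)) |> fun h =>
    (Filter.eventually_iff.2 h : ∀ᶠ c : ℝ in 𝓝[>] 0, c ∈ Ioi (0 : ℝ))
  obtain ⟨c, h1, h2, h3, h4, h5⟩ := (this.and ((t0.eventually_le_const hc₀).and
    ((t1.eventually_le_const (show 0 < D₂ / 2 by positivity)).and
      ((t2.eventually_le_const one_pos).and (t3.eventually_le_const hσ))))).exists
  exact ⟨c, h1, h2, h3, h4, h5⟩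

/-- Noise constant in the local dissipative estimate. -/
def noiseC (α : ℝ) (m : ℕ) (G : ℝ) : ℝ :=
  G + (m : ℝ) ^ 2 * G ^ 2 + sewC (3 * α) * defC m G

theorem noiseC_pos {α : ℝ} (hα : 1 / 3 < α) (m : ℕ) {G : ℝ} (hG : 1 ≤ G) : 0 < noiseC α m G := by
  have hs := sewC_pos (θ := 3 * α) (by linarith)
  have hB := defC_pos m hG
  unfold noiseC
  positivity

/-- The assumptions under which `z` solves the scheme on the indices `0, …, N`. -/
structure IsSchemeSol {m : ℕ} (α G l L : ℝ) (f : V → V) (g : V → (E m →L[ℝ] V)) (Δ : ℝ)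
    (x : ℕ → ℕ → E m) (X : ℕ → ℕ → E2 m) (ϖ : ℕ → ℕ → ℝ) (z : ℕ → V) (N : ℕ) : Prop where
  lo : 1 / 3 < α
  hi : α ≤ 1 / 2
  coef : CoefBound g G l
  rough : RoughData α x X ϖ
  lip : ∀ a b, ‖f a - f b‖ ≤ L * ‖a - b‖
  L_nonneg : 0 ≤ L
  mesh_pos : 0 < Δ
  length : Δ * N ≤ 1
  step : ∀ k, k < N → z (k + 1) = z k + Δ • f (z k) + g (z k) (x k (k + 1))
        + contract (X k (k + 1)) (secondCoef g (z k))

/-- The control of path and drift on which the partition into short intervals is based. -/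
def pathControl (ϖ : ℕ → ℕ → ℝ) (Δ M : ℝ) (i j : ℕ) : ℝ := ϖ i j + (1 + M) * Δ * ((j - i : ℕ) : ℝ)

theorem isControl_pathControl {ϖ : ℕ → ℕ → ℝ} (h : IsControl ϖ) {Δ M : ℝ} (hΔ : 0 ≤ Δ)
    (hM : 0 ≤ M) : IsControl (pathControl ϖ Δ M) :=
  h.add (isControl_length (by positivity))

namespace IsSchemeSol

variable {m : ℕ} {α G l L F D₁ D₂ Δ M : ℝ} {f : V → V} {g : V → (E m →L[ℝ] V)}
  {x : ℕ → ℕ → E m} {X : ℕ → ℕ → E2 m} {ϖ : ℕ → ℕ → ℝ} {z : ℕ → V} {N : ℕ}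

theorem norm_le_linear (h : IsSchemeSol α G l L f g Δ x X ϖ z N) (hF : ‖f 0‖ ≤ F) (y : V) :
    ‖f y‖ ≤ F + L * ‖y‖ := by
  have := h.lip y 0
  rw [sub_zero] at this
  have h2 := norm_add_le (f y - f 0) (f 0)
  rw [sub_add_cancel] at h2
  linarith

theorem length_le_one (h : IsSchemeSol α G l L f g Δ x X ϖ z N) (i : ℕ) {j : ℕ} (hj : j ≤ N) :
    Δ * ((j - i : ℕ) : ℝ) ≤ 1 := by
  have : ((j - i : ℕ) : ℝ) ≤ N := by exact_mod_cast (by omega : j - i ≤ N)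
  exact (mul_le_mul_of_nonneg_left this h.mesh_pos.le).trans h.length

theorem shortStretch (h : IsSchemeSol α G l L f g Δ x X ϖ z N) (hM : ∀ k, k ≤ N → ‖f (z k)‖ ≤ M)
    {i j : ℕ} (hj : j ≤ N) (hW : pathControl ϖ Δ M i j ≤ shortC α m G) :
    ShortStretch α G l g x X ϖ (pathControl ϖ Δ M) z (fun k => Δ • f (z k)) i j := by
  have hM0 : 0 ≤ M := (norm_nonneg _).trans (hM 0 (Nat.zero_le _))
  have hΔ := h.mesh_pos
  refine { lo := h.lo, hi := h.hi, coef := h.coef, rough := h.rough,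
           ctrl := isControl_pathControl h.rough.ctrl hΔ.le hM0
           le := fun a b _ => ?_, drift := fun a b _ _ hb => ?_
           step := fun k _ hk => by rw [h.step k (by omega)], short := hW }
  · unfold pathControl
    have : 0 ≤ (1 + M) * Δ * ((b - a : ℕ) : ℝ) := by positivity
    linarith
  · refine (norm_sum_le _ _).trans ?_
    calc ∑ k ∈ Finset.Ico a b, ‖Δ • f (z k)‖ ≤ ∑ k ∈ Finset.Ico a b, Δ * (1 + M) := by
          refine Finset.sum_le_sum fun k hk => ?_
          rw [norm_smul, Real.norm_of_nonneg hΔ.le]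
          have := hM k (by rw [Finset.mem_Ico] at hk; omega)
          gcongr
          linarith
      _ = (1 + M) * Δ * ((b - a : ℕ) : ℝ) := by
          rw [Finset.sum_const, Nat.card_Ico, nsmul_eq_mul]; ring
      _ ≤ pathControl ϖ Δ M a b := by
          have := h.rough.ctrl.nonneg a b
          unfold pathControl
          linarith

/-- Comparison of the scheme with one Euler step of the drift, over a short interval. -/
theorem exists_expansion (h : IsSchemeSol α G l L f g Δ x X ϖ z N)
    (hM : ∀ k, k ≤ N → ‖f (z k)‖ ≤ M) {c : ℝ} (hc0 : 0 < c) (hc : c ≤ shortC α m G)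
    {i j : ℕ} (hij : i < j) (hj : j ≤ N) (hsh : j = i + 1 ∨ pathControl ϖ Δ M i j ≤ c) :
    ∃ R J : V, z j = (z i + (Δ * ((j - i : ℕ) : ℝ)) • f (z i)) + R + g (z i) (x i j)
      + contract (X i j) (secondCoef g (z i)) + J ∧
      ‖R‖ ≤ L * (G + remC m G) * (Δ * ((j - i : ℕ) : ℝ)) ∧
      ‖J‖ ≤ sewC (3 * α) * defC m G * c ^ (3 * α) := by
  have hlo := h.lo
  have hG := h.coef.one_le
  have hΔ := h.mesh_pos
  have hL := h.L_nonneg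
  have hs := sewC_pos (θ := 3 * α) (by linarith)
  have hB := defC_pos m hG
  have hr0 := remC_pos m G
  -- A single step is the scheme itself: both errors vanish and no shortness is needed.
  by_cases hone : j = i + 1
  · refine ⟨0, 0, ?_, by simp only [norm_zero]; positivity,
      by simp only [norm_zero]; positivity⟩
    subst hone
    rw [h.step i (by omega)]
    simp
  · have hWs : pathControl ϖ Δ M i j ≤ c := by tauto
    have hst := h.shortStretch hM hj (hWs.trans hc)
    refine ⟨∑ k ∈ Finset.Ico i j, Δ • (f (z k) - f (z i)), expRem g x X z
      (fun k => Δ • f (z k)) i j, ?_, ?_, ?_⟩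
    · have e1 : ∑ k ∈ Finset.Ico i j, Δ • (f (z k) - f (z i))
          = ∑ k ∈ Finset.Ico i j, Δ • f (z k) - (Δ * ((j - i : ℕ) : ℝ)) • f (z i) := by
        simp_rw [smul_sub]
        rw [Finset.sum_sub_distrib, Finset.sum_const, Nat.card_Ico, ← Nat.cast_smul_eq_nsmul ℝ,
          smul_smul, mul_comm Δ]
      rw [e1]
      unfold expRem
      abel
    · refine (norm_sum_le _ _).trans ?_
      calc _ ≤ ∑ k ∈ Finset.Ico i j, Δ * (L * (G + remC m G)) := by
            refine Finset.sum_le_sum fun k hk => ?_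
            rw [Finset.mem_Ico] at hk
            rw [norm_smul, Real.norm_of_nonneg hΔ.le]
            have a1 := hst.norm_inc_le le_rfl hk.1 hk.2.le
            have a2 := hst.root_le_one le_rfl hk.1 hk.2.le
            have a3 : (G + remC m G) * pathControl ϖ Δ M i k ^ α ≤ (G + remC m G) * 1 := by gcongr
            have := h.lip (z k) (z i)
            gcongr
            refine this.trans ?_
            gcongr
            linarith
        _ = L * (G + remC m G) * (Δ * ((j - i : ℕ) : ℝ)) := by
            rw [Finset.sum_const, Nat.card_Ico, nsmul_eq_mul]; ring
    · refine (hst.norm_expRem_le le_rfl hij.le le_rfl).trans ?_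
      rw [← rpow_three_mul (hst.ctrl.nonneg i j)]
      have := hst.ctrl.nonneg i j
      gcongr

/-- One Euler step of the drift over the whole interval contracts, and freezing the drift costs a
multiple of the elapsed time. The noise is split by `rpow_le_add_mul` at the level `c ^ (3α)` of the
expansion error, leaving a fixed cost of that order and a part linear in `ϖ`. -/
theorem dissipative_local (h : IsSchemeSol α G l L f g Δ x X ϖ z N)
    (hM : ∀ k, k ≤ N → ‖f (z k)‖ ≤ M) (hF0 : 0 ≤ F) (hF : ‖f 0‖ ≤ F)
    (hD1 : 0 < D₁) (hD2 : 0 < D₂)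
    (hdiss : ∀ y, inner ℝ y (f y) ≤ D₁ - D₂ * ‖y‖ ^ 2)
    (hΔL : Δ * L ^ 2 ≤ D₂ / 2) (hΔD : Δ * D₂ ≤ 1)
    {c : ℝ} (hc0 : 0 < c) (hc : c ≤ shortC α m G) (hcL : c * L ^ 2 ≤ D₂ / 2) (hcD : c * D₂ ≤ 1)
    {i j : ℕ} (hij : i < j) (hj : j ≤ N) (hsh : j = i + 1 ∨ pathControl ϖ Δ M i j ≤ c) :
    ‖z j‖ ≤ Real.exp (-(D₂ / 2) * (Δ * ((j - i : ℕ) : ℝ))) * ‖z i‖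
      + (2 * (D₁ + F ^ 2) + F + L + D₂ + L * (G + remC m G)) * (Δ * ((j - i : ℕ) : ℝ))
      + noiseC α m G * c ^ (3 * α)
      + (G * (c ^ (3 * α)) ^ (1 - 1 / α) + (m : ℝ) ^ 2 * G ^ 2 * (c ^ (3 * α)) ^ (1 - 1 / (2 * α)))
        * ϖ i j := by
  have hlo := h.lo
  have hhi := h.hi
  have hG := h.coef.one_le
  have hΔ := h.mesh_pos
  have hL := h.L_nonneg
  have hlG := h.coef.le
  have hl0 := h.coef.nonneg
  have hM0 : 0 ≤ M := (norm_nonneg _).trans (hM 0 (Nat.zero_le _))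
  obtain ⟨R, J, hzj, hR, hJ⟩ := h.exists_expansion hM hc0 hc hij hj hsh
  have hδ0 : 0 < c ^ (3 * α) := Real.rpow_pos_of_pos hc0 _
  have hh1 := h.length_le_one i hj
  have hϖ0 := h.rough.ctrl.nonneg i j
  have hhc : Δ * ((j - i : ℕ) : ℝ) * L ^ 2 ≤ D₂ / 2 ∧ Δ * ((j - i : ℕ) : ℝ) * D₂ ≤ 1 := by
    rcases hsh with e | e
    · have : Δ * ((j - i : ℕ) : ℝ) = Δ := by rw [e]; simp
      rw [this]; exact ⟨hΔL, hΔD⟩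
    · have : Δ * ((j - i : ℕ) : ℝ) ≤ c := by
        refine le_trans ?_ e
        unfold pathControl
        rw [mul_assoc]
        have : 0 ≤ Δ * ((j - i : ℕ) : ℝ) := by positivity
        nlinarith
      exact ⟨le_trans (by gcongr) hcL, le_trans (by gcongr) hcD⟩
  have hh0 : 0 ≤ Δ * ((j - i : ℕ) : ℝ) := by positivity
  generalize Δ * ((j - i : ℕ) : ℝ) = t at *
  generalize c ^ (3 * α) = δ at *
  have hdr := norm_add_smul_drift_le hF0 hL hD1 hD2 (h.norm_le_linear hF) hdiss hh0 hh1
    hhc.1 hhc.2 (z i)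
  have n1 : ‖g (z i) (x i j)‖ ≤ G * (δ + δ ^ (1 - 1 / α) * ϖ i j) := by
    refine ((g (z i)).le_of_opNorm_le (h.coef.b0 _) _).trans ?_
    have := (h.rough.bx i j hij.le).trans
      (rpow_le_add_mul hδ0 (show 0 < α by linarith) (by linarith) hϖ0)
    gcongr
  have n2 : ‖contract (X i j) (secondCoef g (z i))‖
      ≤ (m : ℝ) ^ 2 * (δ + δ ^ (1 - 1 / (2 * α)) * ϖ i j) * (G * G) := by
    refine norm_contract_le_of_le ?_ ((h.coef.norm_secondCoef_le _).trans (by gcongr))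
    refine (h.rough.bX i j hij.le).trans ?_
    rw [← Real.rpow_natCast, ← Real.rpow_mul hϖ0, mul_comm α]
    exact rpow_le_add_mul hδ0 (by push_cast; linarith) (by push_cast; linarith) hϖ0
  have tri : ‖z j‖ ≤ ‖z i + t • f (z i)‖ + ‖R‖ + ‖g (z i) (x i j)‖
      + ‖contract (X i j) (secondCoef g (z i))‖ + ‖J‖ := by
    rw [hzj]
    refine (norm_add_le _ _).trans (add_le_add_left ?_ _)
    refine (norm_add_le _ _).trans (add_le_add_left ?_ _)
    refine (norm_add_le _ _).trans (add_le_add_left ?_ _)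
    exact norm_add_le _ _
  calc ‖z j‖ ≤ _ := tri
    _ ≤ (Real.exp (-(D₂ / 2) * t) * ‖z i‖ + (2 * (D₁ + F ^ 2) + F + L + D₂) * t)
        + L * (G + remC m G) * t + G * (δ + δ ^ (1 - 1 / α) * ϖ i j)
        + (m : ℝ) ^ 2 * (δ + δ ^ (1 - 1 / (2 * α)) * ϖ i j) * (G * G)
        + sewC (3 * α) * defC m G * δ :=
        add_le_add (add_le_add (add_le_add (add_le_add hdr hR) n1) n2) hJ
    _ = _ := by unfold noiseC; ring

end IsSchemeSol

/-- Local contraction estimates chain along a greedy partition of a unit of time. -/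
theorem contraction_chain {r : ℕ → ℝ} {W ϖ : ℕ → ℕ → ℝ} {κ Δ A K C c : ℝ} {N : ℕ}
    (hW : IsControl W) (hϖ : IsControl ϖ) (hκ : 0 ≤ κ) (hΔ : 0 ≤ Δ) (hA : 0 ≤ A) (hK : 0 ≤ K)
    (hC : 0 ≤ C) (hc : 0 < c) (hN : Δ * N ≤ 1)
    (hloc : ∀ i j, i < j → j ≤ N → (j = i + 1 ∨ W i j ≤ c) →
      r j ≤ Real.exp (-κ * (Δ * ((j - i : ℕ) : ℝ))) * r i + A * (Δ * ((j - i : ℕ) : ℝ))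
        + K + C * ϖ i j) {j : ℕ} (hj0 : 0 < j) (hj : j ≤ N) :
    Real.exp (κ * (Δ * j)) * r j
      ≤ r 0 + Real.exp κ * (K * (1 + 2 * W 0 j / c) + A * (Δ * j) + C * ϖ 0 j) := by
  have hbW : IsControl (fun i j => Real.exp κ * A * Δ * ((j - i : ℕ) : ℝ)
      + (Real.exp κ * C) * ϖ i j) := by
    refine (isControl_length (by positivity)).add ⟨fun i j => ?_, fun i u j h1 h2 => ?_⟩
    · have := hϖ.nonneg i j
      positivity
    · rw [← mul_add]
      have := hϖ.superadd i u j h1 h2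
      gcongr
  -- The weight `exp (κ Δ k)` compensates the contraction, and the outer exponential turns additive
  -- errors into the multiplicative ones that `greedy_chain` handles.
  have := greedy_chain (Φ := fun k => Real.exp (Real.exp (κ * (Δ * k)) * r k)) (W := W)
    (b := fun i j => Real.exp κ * A * Δ * ((j - i : ℕ) : ℝ) + (Real.exp κ * C) * ϖ i j)
    (a := Real.exp κ * K) (c := c) hW hc (by positivity) 0 N
    (fun _ => (Real.exp_pos _).le)
    (fun i u j _ h1 h2 _ => hbW.superadd i u j h1.le h2.le)
    (by
      intro i j _ hij hj hsh
      rw [← Real.exp_add, Real.exp_le_exp]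
      have le1 := hloc i j hij hj hsh
      have hjt : κ * (Δ * j) ≤ κ := by
        have h1 : Δ * (j : ℝ) ≤ 1 := by
          refine le_trans ?_ hN
          gcongr
        nlinarith
      have e1 : Real.exp (κ * (Δ * j)) * (Real.exp (-κ * (Δ * ((j - i : ℕ) : ℝ))) * r i)
          = Real.exp (κ * (Δ * i)) * r i := by
        rw [← mul_assoc, ← Real.exp_add, Nat.cast_sub hij.le]
        ring_nf
      have e2 : Real.exp (κ * (Δ * j)) * (A * (Δ * ((j - i : ℕ) : ℝ)) + K + C * ϖ i j)
          ≤ Real.exp κ * (A * (Δ * ((j - i : ℕ) : ℝ)) + K + C * ϖ i j) := by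
        have := hϖ.nonneg i j
        gcongr
      have e3 : Real.exp (κ * (Δ * j)) * r j ≤ _ :=
        mul_le_mul_of_nonneg_left le1 (Real.exp_pos (κ * (Δ * j))).le
      linarith) 0 j le_rfl hj0 hj
  rw [← Real.exp_add, Real.exp_le_exp] at this
  simp only [Nat.cast_zero, mul_zero, Real.exp_zero, one_mul, Nat.sub_zero] at this
  linarith

/-- Bounds for the scheme over the indices `0, …, N` covering at least half a unit of time,
in terms of the control of the driving path. -/
theorem dissipative_block {m : ℕ} {α G L F D₁ D₂ : ℝ} (hα : 1 / 3 < α)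
    (hG : 1 ≤ G) (hL : 0 ≤ L) (hF : 0 ≤ F) (hD1 : 0 < D₁) (hD2 : 0 < D₂) :
    ∃ C ρ : ℝ, 0 ≤ C ∧ 0 ≤ ρ ∧ ρ < 1 ∧ ∀ (f : V → V) (g : V → (E m →L[ℝ] V)) (l Δ : ℝ)
      (x : ℕ → ℕ → E m) (X : ℕ → ℕ → E2 m) (ϖ : ℕ → ℕ → ℝ) (z : ℕ → V) (N : ℕ),
      IsSchemeSol α G l L f g Δ x X ϖ z N → ‖f 0‖ ≤ F →
      (∀ y, inner ℝ y (f y) ≤ D₁ - D₂ * ‖y‖ ^ 2) →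
      Δ * L ^ 2 ≤ D₂ / 2 → Δ * D₂ ≤ 1 → 1 / 2 ≤ Δ * N →
      (∀ k, k ≤ N → ‖z k‖ ≤ 2 * ‖z 0‖ + C * (1 + ϖ 0 N)) ∧
        ‖z N‖ ≤ ρ * ‖z 0‖ + C * (1 + ϖ 0 N) := by
  obtain ⟨κ, hκ⟩ : ∃ κ, κ = D₂ / 2 := ⟨_, rfl⟩
  have hκ0 : 0 < κ := by rw [hκ]; positivity
  have hK'0 := noiseC_pos hα m hG
  generalize hK' : noiseC α m G = K' at *
  have hρ0 : Real.exp (-κ / 2) < 1 := by rw [Real.exp_lt_one_iff]; linarith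
  -- The bound 1/2 allows the maximum of the solution to be absorbed; the other one keeps `ρ = exp
  -- (-κ / 2) + 2 σ` below 1.
  obtain ⟨σ, hσ0, hσ1, hσ2⟩ : ∃ σ, 0 < σ ∧ σ ≤ 1 / 2 ∧ σ ≤ (1 - Real.exp (-κ / 2)) / 4 :=
    ⟨min (1 / 2) ((1 - Real.exp (-κ / 2)) / 4), lt_min (by norm_num) (by linarith),
      min_le_left _ _, min_le_right _ _⟩
  obtain ⟨c, hc0, hc1, hcL, hcD, hcσ⟩ := exists_short_threshold (α := α)
    (a := 2 * Real.exp κ * K' * L) (L := L) hα hσ0 (shortC_pos hα m hG) hD2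
  have hδ0 : 0 < c ^ (3 * α) := Real.rpow_pos_of_pos hc0 _
  have hδc : c ^ (3 * α - 1) = c ^ (3 * α) / c := by
    rw [Real.rpow_sub hc0, Real.rpow_one]
  rw [hδc] at hcσ
  have hr0 := remC_pos m G
  obtain ⟨A, hA⟩ : ∃ A, A = 2 * (D₁ + F ^ 2) + F + L + D₂ + L * (G + remC m G) := ⟨_, rfl⟩
  obtain ⟨C', hC'⟩ : ∃ C', C' = G * (c ^ (3 * α)) ^ (1 - 1 / α)
    + (m : ℝ) ^ 2 * G ^ 2 * (c ^ (3 * α)) ^ (1 - 1 / (2 * α)) := ⟨_, rfl⟩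
  have hA0 : 0 ≤ A := by rw [hA]; positivity
  have hC'0 : 0 ≤ C' := by rw [hC']; positivity
  have hloc := fun (f : V → V) (g : V → (E m →L[ℝ] V)) (l Δ : ℝ)
      (x : ℕ → ℕ → E m) (X : ℕ → ℕ → E2 m) (ϖ : ℕ → ℕ → ℝ) (z : ℕ → V) (N : ℕ) (M : ℝ)
      (h : IsSchemeSol α G l L f g Δ x X ϖ z N) (hM : ∀ k, k ≤ N → ‖f (z k)‖ ≤ M)
      (hF' : ‖f 0‖ ≤ F) (hdiss : ∀ y, inner ℝ y (f y) ≤ D₁ - D₂ * ‖y‖ ^ 2)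
      (h1 : Δ * L ^ 2 ≤ D₂ / 2) (h2 : Δ * D₂ ≤ 1) (i j : ℕ) (hij : i < j) (hj : j ≤ N)
      (hsh : j = i + 1 ∨ pathControl ϖ Δ M i j ≤ c) =>
      h.dissipative_local hM hF hF' hD1 hD2 hdiss h1 h2 hc0 hc1 hcL hcD hij hj hsh
  rw [hK', ← hκ, ← hA, ← hC'] at hloc
  clear hA hC' hr0
  generalize c ^ (3 * α) = δ at *
  obtain ⟨B, hB⟩ : ∃ B, B = Real.exp κ * (K' * δ * (1 + 2 / c * (1 + F)) + A + C'
    + K' * δ * (2 / c)) := ⟨_, rfl⟩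
  have hB0 : 0 ≤ B := by rw [hB]; positivity
  refine ⟨2 * B, Real.exp (-κ / 2) + 2 * σ, by positivity, by positivity, by linarith, ?_⟩
  intro f g l Δ x X ϖ z N h hf0 hdiss hΔL hΔD hN2
  have hΔ := h.mesh_pos
  have hN1 := h.length
  -- The drift is bounded by `F + L Z` with `Z` the maximum over the block, so the number of short
  -- intervals grows linearly in `Z`. By the choice of `c`, this feedback costs only `σ Z`.
  obtain ⟨k₀, hk₀, hmax⟩ := Finset.exists_max_image (Finset.range (N + 1)) (fun j => ‖z j‖)
    ⟨0, by simp⟩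
  have hZle : ∀ k, k ≤ N → ‖z k‖ ≤ ‖z k₀‖ := fun k hk => hmax k (by simp; omega)
  obtain ⟨Z, hZ⟩ : ∃ Z, Z = ‖z k₀‖ := ⟨_, rfl⟩
  rw [← hZ] at hZle
  have hZ0 : 0 ≤ Z := by rw [hZ]; exact norm_nonneg _
  have hfM : ∀ k, k ≤ N → ‖f (z k)‖ ≤ F + L * Z := fun k hk => (h.norm_le_linear hf0 _).trans (by
    have := hZle k hk
    gcongr)
  have hϖN0 : 0 ≤ ϖ 0 N := h.rough.ctrl.nonneg 0 N
  have chain : ∀ j, 0 < j → j ≤ N →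
      Real.exp (κ * (Δ * j)) * ‖z j‖ ≤ ‖z 0‖ + B * (1 + ϖ 0 N) + σ * Z := by
    intro j hj0 hj
    have := contraction_chain (r := fun k => ‖z k‖)
      (isControl_pathControl h.rough.ctrl hΔ.le (show 0 ≤ F + L * Z by positivity))
      h.rough.ctrl hκ0.le hΔ.le hA0 (show 0 ≤ K' * δ by positivity) hC'0 hc0 hN1
      (hloc f g l Δ x X ϖ z N (F + L * Z) h hfM hf0 hdiss
        (by rw [hκ]; exact hΔL) hΔD) hj0 hj
    refine this.trans ?_
    have hjt := h.length_le_one 0 hj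
    rw [Nat.sub_zero] at hjt
    have hϖj : ϖ 0 j ≤ ϖ 0 N := h.rough.ctrl.mono le_rfl (Nat.zero_le _) hj
    have hW0 : pathControl ϖ Δ (F + L * Z) 0 j ≤ ϖ 0 N + 1 + (F + L * Z) := by
      unfold pathControl
      rw [Nat.sub_zero]
      have : (1 + (F + L * Z)) * Δ * (j : ℝ) ≤ (1 + (F + L * Z)) * 1 := by
        rw [mul_assoc]; gcongr
      linarith
    generalize pathControl ϖ Δ (F + L * Z) 0 j = w at *
    generalize ϖ 0 j = v at *
    generalize ϖ 0 N = v' at *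
    have a1 : Real.exp κ * (K' * δ * (1 + 2 * w / c) + A * (Δ * j) + C' * v)
        ≤ Real.exp κ * (K' * δ * (1 + 2 * (v' + 1 + (F + L * Z)) / c) + A * 1 + C' * v') := by
      gcongr
    have a5 : Real.exp κ * (K' * δ * (1 + 2 * (v' + 1 + (F + L * Z)) / c) + A * 1 + C' * v')
        = Real.exp κ * (K' * δ * (1 + 2 / c * (1 + F)) + A + K' * δ * (2 / c) * v' + C' * v')
          + 2 * Real.exp κ * K' * L * (δ / c) * Z := by
      field_simp; ring
    have a4 : 2 * Real.exp κ * K' * L * (δ / c) * Z ≤ σ * Z := by gcongr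
    have a6 : Real.exp κ * (K' * δ * (1 + 2 / c * (1 + F)) + A + K' * δ * (2 / c) * v' + C' * v')
        ≤ B * (1 + v') := by
      rw [hB, mul_assoc (Real.exp κ)]
      refine mul_le_mul_of_nonneg_left ?_ (Real.exp_pos κ).le
      have p1 : 0 ≤ K' * δ * (1 + 2 / c * (1 + F)) * v' := by positivity
      have p2 : 0 ≤ A * v' := by positivity
      have p3 : 0 ≤ K' * δ * (2 / c) := by positivity
      linarith
    linarith
  have hBϖ : 0 ≤ B * (1 + ϖ 0 N) := by positivity
  have hZb : Z ≤ 2 * ‖z 0‖ + 2 * B * (1 + ϖ 0 N) := by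
    have hk0N : k₀ ≤ N := by rw [Finset.mem_range] at hk₀; omega
    rcases Nat.eq_zero_or_pos k₀ with e | e
    · rw [e] at hZ
      linarith [norm_nonneg (z 0)]
    · have h1 := chain k₀ e hk0N
      rw [← hZ] at h1
      have h2 : 1 ≤ Real.exp (κ * (Δ * k₀)) := Real.one_le_exp (by positivity)
      have h3 : Z ≤ Real.exp (κ * (Δ * k₀)) * Z := by nlinarith
      have h4 : σ * Z ≤ 1 / 2 * Z := by gcongr
      linarith
  refine ⟨fun k hk => (hZle k hk).trans hZb, ?_⟩
  have hNpos : 0 < N := by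
    rcases Nat.eq_zero_or_pos N with e | e
    · rw [e] at hN2; norm_num at hN2
    · exact e
  have h1 := chain N hNpos le_rfl
  generalize ϖ 0 N = v at *
  have h2 : ‖z N‖ ≤ Real.exp (-κ / 2) * (‖z 0‖ + B * (1 + v) + σ * Z) := by
    have e1 : Real.exp (-(κ * (Δ * N))) ≤ Real.exp (-κ / 2) := by
      rw [Real.exp_le_exp]; nlinarith
    have e3 : ‖z N‖ = Real.exp (-(κ * (Δ * N))) * (Real.exp (κ * (Δ * N)) * ‖z N‖) := by
      rw [← mul_assoc, ← Real.exp_add]; simp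
    have e4 : 0 ≤ ‖z 0‖ + B * (1 + v) + σ * Z := by positivity
    rw [e3]
    calc _ ≤ Real.exp (-(κ * (Δ * N))) * (‖z 0‖ + B * (1 + v) + σ * Z) := by gcongr
      _ ≤ _ := by gcongr
  have h3 : σ * Z ≤ 2 * σ * ‖z 0‖ + B * (1 + v) := by
    have a : σ * Z ≤ σ * (2 * ‖z 0‖ + 2 * B * (1 + v)) := by gcongr
    have b : σ * (2 * B * (1 + v)) ≤ 1 / 2 * (2 * B * (1 + v)) := by
      have : 0 ≤ 2 * B * (1 + v) := by linarith
      gcongr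
    linarith
  have h4 : Real.exp (-κ / 2) * (B * (1 + v) + σ * Z) ≤ 1 * (B * (1 + v) + σ * Z) := by
    have : 0 ≤ B * (1 + v) + σ * Z := by positivity
    gcongr
  linarith

end Dissipative

end RoughEuler

end

noncomputable section

namespace RoughEuler

set_option maxSynthPendingDepth 3

/-! ### Growth of the difference of two solutions -/

/-- Since `exp s ≥ exp (-L)`, an additive error is a relative one, at the price of the factor `exp
L`. -/
theorem exp_add_le_exp {s b L : ℝ} (hs : -L ≤ s) (hb : 0 ≤ b) :
    Real.exp s + b ≤ Real.exp (s + Real.exp L * b) := by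
  have h1 : 1 ≤ Real.exp s * Real.exp L := by
    rw [← Real.exp_add]
    exact Real.one_le_exp (by linarith)
  have h2 := Real.add_one_le_exp (Real.exp L * b)
  rw [Real.exp_add]
  have h3 := mul_le_mul_of_nonneg_left h2 (Real.exp_pos s).le
  nlinarith

theorem le_mul_exp_of_sq_le {a b s : ℝ} (hb : 0 ≤ b) (h : a ^ 2 ≤ b ^ 2 * (1 + 2 * s)) :
    a ≤ b * Real.exp s := by
  have h1 : a ^ 2 ≤ (b * Real.exp s) ^ 2 := by
    refine h.trans ?_
    rw [mul_pow, ← Real.exp_nat_mul]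
    have := Real.add_one_le_exp (2 * s)
    push_cast
    gcongr
    linarith
  exact (abs_le_of_sq_le_sq' h1 (by positivity)).2

section Difference

variable {V : Type*} [NormedAddCommGroup V] [InnerProductSpace ℝ V]

/-- Perturbed version of the estimate for one step of the drift: `u` is close to `v`, and `w` is
the difference of the drifts belonging to `v`. -/
theorem norm_add_smul_le_mul_exp {u v w : V} {ε L ell Δ : ℝ} (hε0 : 0 ≤ ε) (hε : ε ≤ 1 / 2)
    (hL : 0 ≤ L) (hell : |ell| ≤ L) (hΔ0 : 0 ≤ Δ) (hΔ1 : Δ ≤ 1) (huv : ‖u - v‖ ≤ ε * ‖v‖)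
    (hw : ‖w‖ ≤ L * ‖v‖) (hin : inner ℝ v w ≤ ell * ‖v‖ ^ 2) :
    ‖u + Δ • w‖ ≤ ‖u‖ * Real.exp (Δ * ell + L ^ 2 * Δ ^ 2 / 2 + ε * Δ * (16 * L + 6 * L ^ 2)) := by
  have hv0 := norm_nonneg v
  have hu0 := norm_nonneg u
  have hd : |‖v‖ - ‖u‖| ≤ ε * ‖v‖ := by
    rw [abs_sub_comm]
    exact (abs_norm_sub_norm_le u v).trans huv
  have hv2 : ‖v‖ ≤ 2 * ‖u‖ := by
    have := (abs_le.1 hd).2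
    nlinarith
  have hd2 : |‖v‖ ^ 2 - ‖u‖ ^ 2| ≤ 6 * ε * ‖u‖ ^ 2 := by
    have e : ‖v‖ ^ 2 - ‖u‖ ^ 2 = (‖v‖ - ‖u‖) * (‖v‖ + ‖u‖) := by ring
    rw [e, abs_mul, abs_of_nonneg (by positivity : 0 ≤ ‖v‖ + ‖u‖)]
    calc |‖v‖ - ‖u‖| * (‖v‖ + ‖u‖) ≤ ε * (2 * ‖u‖) * (2 * ‖u‖ + ‖u‖) := by
          gcongr
          exact hd.trans (by gcongr)
      _ = 6 * ε * ‖u‖ ^ 2 := by ring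
  refine le_mul_exp_of_sq_le hu0 ?_
  have e : ‖u + Δ • w‖ ^ 2 = ‖u‖ ^ 2 + 2 * Δ * (inner ℝ v w + inner ℝ (u - v) w)
      + Δ ^ 2 * ‖w‖ ^ 2 := by
    rw [norm_add_sq_real, inner_smul_right, norm_smul, Real.norm_eq_abs, mul_pow, sq_abs,
      inner_sub_left]
    ring
  have i1 : inner ℝ (u - v) w ≤ ε * L * ‖v‖ ^ 2 := by
    refine (real_inner_le_norm _ _).trans ?_
    calc ‖u - v‖ * ‖w‖ ≤ (ε * ‖v‖) * (L * ‖v‖) := by gcongr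
      _ = _ := by ring
  have i2 : ‖w‖ ^ 2 ≤ L ^ 2 * ‖v‖ ^ 2 := by
    rw [← mul_pow]; gcongr
  -- The coefficient has no definite sign, so replacing `‖v‖²` by `‖u‖²` is estimated in absolute
  -- value.
  have i3 : (2 * Δ * ell + Δ ^ 2 * L ^ 2) * (‖v‖ ^ 2 - ‖u‖ ^ 2)
      ≤ (2 * Δ * L + Δ * L ^ 2) * (6 * ε * ‖u‖ ^ 2) := by
    refine (le_abs_self _).trans ?_
    rw [abs_mul]
    refine mul_le_mul ?_ hd2 (abs_nonneg _) (by positivity)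
    have j1 : |Δ ^ 2 * L ^ 2| ≤ Δ * L ^ 2 := by
      rw [abs_of_nonneg (by positivity)]
      have : Δ ^ 2 ≤ Δ := by nlinarith
      gcongr
    have j2 : |2 * Δ * ell| ≤ 2 * Δ * L := by
      rw [abs_mul, abs_of_nonneg (by positivity)]
      gcongr
    exact (abs_add_le _ _).trans (add_le_add j2 j1)
  have i4 : 2 * Δ * (ε * L) * ‖v‖ ^ 2 ≤ 8 * Δ * ε * L * ‖u‖ ^ 2 := by
    have : ‖v‖ ^ 2 ≤ (2 * ‖u‖) ^ 2 := by gcongr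
    calc 2 * Δ * (ε * L) * ‖v‖ ^ 2 ≤ 2 * Δ * (ε * L) * (2 * ‖u‖) ^ 2 := by gcongr
      _ = _ := by ring
  have i5 : 2 * Δ * (inner ℝ v w + inner ℝ (u - v) w)
      ≤ 2 * Δ * (ell * ‖v‖ ^ 2 + ε * L * ‖v‖ ^ 2) := by gcongr
  have i6 : Δ ^ 2 * ‖w‖ ^ 2 ≤ Δ ^ 2 * (L ^ 2 * ‖v‖ ^ 2) := by gcongr
  have i7 : 0 ≤ Δ * L * (ε * ‖u‖ ^ 2) := by positivity
  have i8 : 0 ≤ Δ * L ^ 2 * (ε * ‖u‖ ^ 2) := by positivity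
  rw [e]
  nlinarith

/-- Constant in the linear error of the scheme. -/
def nonlinC (m : ℕ) (G : ℝ) : ℝ := G + 3 * (m : ℝ) ^ 2 * G ^ 2

/-- Cost of one interval of the greedy partition in the growth of a difference. -/
def growthC (m : ℕ) (G L : ℝ) : ℝ :=
  Real.exp L * (1 + 2 * (m : ℝ) ^ 2 * G) + 1 + 16 * L + 6 * L ^ 2 + 2 * L * Real.exp L

theorem growthC_pos (m : ℕ) {G L : ℝ} (hG : 1 ≤ G) (hL : 0 ≤ L) : 0 < growthC m G L := by
  unfold growthC
  positivity

/-- Two solutions of the scheme, `v` being the difference, at distance at most `r`, with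
one-sided Lipschitz constants `ell`. -/
structure SchemePair {m : ℕ} (α G l L : ℝ) (f : V → V) (g : V → (E m →L[ℝ] V)) (Δ : ℝ)
    (x : ℕ → ℕ → E m) (X : ℕ → ℕ → E2 m) (ϖ : ℕ → ℕ → ℝ) (y z : ℕ → V) (N : ℕ)
    (M r : ℝ) (ell : ℕ → ℝ) : Prop where
  sol : IsSchemeSol α G l L f g Δ x X ϖ z N
  step : ∀ k, k < N → y (k + 1) = y k + Δ • f (y k) + g (y k) (x k (k + 1))
        + contract (X k (k + 1)) (secondCoef g (y k))
  drift : ∀ k, k ≤ N → ‖f (z k)‖ ≤ M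
  r_nonneg : 0 ≤ r
  close : ∀ k, k < N → ‖y k - z k‖ ≤ r
  ell_abs : ∀ k, |ell k| ≤ L
  ell_le : ∀ k, k < N → inner ℝ (y k - z k) (f (y k) - f (z k)) ≤ ell k * ‖y k - z k‖ ^ 2

namespace SchemePair

variable {m : ℕ} {α G l L Δ M r : ℝ} {f : V → V} {g : V → (E m →L[ℝ] V)}
  {x : ℕ → ℕ → E m} {X : ℕ → ℕ → E2 m} {ϖ : ℕ → ℕ → ℝ} {y z : ℕ → V} {N : ℕ} {ell : ℕ → ℝ}

theorem mesh_le_one (h : SchemePair α G l L f g Δ x X ϖ y z N M r ell) {k : ℕ} (hk : k < N) :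
    Δ ≤ 1 := by
  have h1 := h.sol.mesh_pos
  have h2 := h.sol.length
  have h3 : (1 : ℝ) ≤ N := by exact_mod_cast (by omega : 1 ≤ N)
  nlinarith

/-- The Taylor remainders of the noise coefficients are quadratic in the difference. One factor is
bounded by `r`, so they act as a linear term whose size tends to 0 with the neighbourhood. -/
theorem exists_step (h : SchemePair α G l L f g Δ x X ϖ y z N M r ell) {k : ℕ} (hk : k < N) :
    ∃ n : V, y (k + 1) - z (k + 1)
        = linStep g x X z k (y k - z k) + Δ • (f (y k) - f (z k)) + n ∧
      ‖n‖ ≤ nonlinC m G * r * (‖x k (k + 1)‖ + ‖X k (k + 1)‖) * ‖y k - z k‖ := by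
  have hc := h.sol.coef
  have hr := h.r_nonneg
  have hG0 : 0 ≤ G := zero_le_one.trans hc.one_le
  refine ⟨(g (y k) - g (z k) - fderiv ℝ g (z k) (y k - z k)) (x k (k + 1))
    + contract (X k (k + 1)) (secondCoef g (y k) - secondCoef g (z k)
      - secondCoefDeriv g (z k) (y k - z k)), ?_, ?_⟩
  · rw [h.step k hk, h.sol.step k hk, contract_sub, contract_sub, smul_sub]
    simp only [linStep, LinearMap.coe_mk, AddHom.coe_mk, sub_apply]
    abel
  · have hv := h.close k hk
    have t1 := hc.taylor0 (z k) (y k - z k)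
    have t2 := hc.secondCoef_taylor (z k) (y k - z k)
    rw [add_sub_cancel] at t1 t2
    have hv2 : ‖y k - z k‖ ^ 2 ≤ r * ‖y k - z k‖ := by
      rw [pow_two]; gcongr
    have s1 : ‖(g (y k) - g (z k) - fderiv ℝ g (z k) (y k - z k)) (x k (k + 1))‖
        ≤ G * (r * ‖y k - z k‖) * ‖x k (k + 1)‖ := by
      refine (ContinuousLinearMap.le_opNorm _ _).trans ?_
      gcongr
      refine t1.trans ?_
      have := hc.le
      gcongr
    have s2 := norm_contract_le_of_le (le_refl ‖X k (k + 1)‖)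
      (t2.trans (show _ ≤ 3 * G ^ 2 * (r * ‖y k - z k‖) by gcongr))
    refine (norm_add_le _ _).trans ((add_le_add s1 s2).trans ?_)
    have p1 : 0 ≤ G * (r * ‖y k - z k‖) * ‖X k (k + 1)‖ := by positivity
    have p2 : 0 ≤ 3 * (m : ℝ) ^ 2 * G ^ 2 * (r * ‖y k - z k‖) * ‖x k (k + 1)‖ := by positivity
    unfold nonlinC
    linarith

theorem norm_drift_sub_le (h : SchemePair α G l L f g Δ x X ϖ y z N M r ell) (k : ℕ) :
    ‖f (y k) - f (z k)‖ ≤ L * ‖y k - z k‖ := h.sol.lip _ _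

theorem neg_le_exponent (h : SchemePair α G l L f g Δ x X ϖ y z N M r ell) {k : ℕ} (hk : k < N) :
    -L ≤ Δ * ell k + L ^ 2 * Δ ^ 2 / 2 := by
  have h1 := h.mesh_le_one hk
  have h2 := h.sol.mesh_pos
  have h3 := (abs_le.1 (h.ell_abs k)).1
  have h4 := h.sol.L_nonneg
  have h5 : 0 ≤ L ^ 2 * Δ ^ 2 / 2 := by positivity
  nlinarith

/-- A single step may carry arbitrarily large noise, for which the flow argument fails. Both levels
are at most `1 + ϖ`, which gives a cost linear in `ϖ` with a factor `l`, independent of the size of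
the drift. -/
theorem single_step (h : SchemePair α G l L f g Δ x X ϖ y z N M r ell) {k : ℕ} (hk : k < N) :
    ‖y (k + 1) - z (k + 1)‖ ≤ ‖y k - z k‖ * Real.exp (growthC m G L * l
      + (Δ * ell k + L ^ 2 * Δ ^ 2 / 2
        + 4 * Real.exp L * (nonlinC m G * r * (‖x k (k + 1)‖ + ‖X k (k + 1)‖))
        + growthC m G L * l * ϖ k (k + 1))) := by
  obtain ⟨n, hn, hnb⟩ := h.exists_step hk
  have hc := h.sol.coef
  have l0 := hc.nonneg
  have hG := hc.one_le
  have hL := h.sol.L_nonneg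
  have hlo := h.sol.lo
  have hhi := h.sol.hi
  have hr := h.r_nonneg
  have hϖ := h.sol.rough.ctrl.nonneg k (k + 1)
  have hdr := norm_add_smul_le_mul_exp (u := y k - z k) (v := y k - z k)
    (w := f (y k) - f (z k)) le_rfl (by norm_num) hL (h.ell_abs k) h.sol.mesh_pos.le
    (h.mesh_le_one hk) (by simp) (h.norm_drift_sub_le k) (h.ell_le k hk)
  simp only [zero_mul, add_zero] at hdr
  have hsL := h.neg_le_exponent hk
  generalize he : nonlinC m G * r * (‖x k (k + 1)‖ + ‖X k (k + 1)‖) = e at *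
  have he0 : 0 ≤ e := by rw [← he]; unfold nonlinC; positivity
  generalize Δ * ell k + L ^ 2 * Δ ^ 2 / 2 = s at *
  have hx : ‖x k (k + 1)‖ ≤ 1 + ϖ k (k + 1) := by
    have := rpow_le_add_mul one_pos (show 0 < α by linarith) (by linarith) hϖ
    rw [Real.one_rpow, one_mul] at this
    exact (h.sol.rough.bx k (k + 1) (by omega)).trans this
  have hX : ‖X k (k + 1)‖ ≤ 1 + ϖ k (k + 1) := by
    refine (h.sol.rough.bX k (k + 1) (by omega)).trans ?_
    rw [← Real.rpow_natCast, ← Real.rpow_mul hϖ]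
    have := rpow_le_add_mul one_pos (show 0 < α * (2 : ℕ) by push_cast; linarith)
      (by push_cast; linarith) hϖ
    rwa [Real.one_rpow, one_mul] at this
  have n1 : ‖fderiv ℝ g (z k) (y k - z k) (x k (k + 1))‖
      ≤ l * ‖y k - z k‖ * (1 + ϖ k (k + 1)) :=
    (ContinuousLinearMap.le_opNorm _ _).trans (mul_le_mul
      (ContinuousLinearMap.le_of_opNorm_le _ (hc.b1 _) _) hx (norm_nonneg _) (by positivity))
  have n2 := norm_contract_le_of_le hX (hc.norm_secondCoefDeriv_le (z k) (y k - z k))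
  have e1 : y (k + 1) - z (k + 1) = (y k - z k + Δ • (f (y k) - f (z k)))
      + fderiv ℝ g (z k) (y k - z k) (x k (k + 1))
      + contract (X k (k + 1)) (secondCoefDeriv g (z k) (y k - z k)) + n := by
    rw [hn]
    simp only [linStep, LinearMap.coe_mk, AddHom.coe_mk]
    abel
  have tri : ‖y (k + 1) - z (k + 1)‖ ≤ ‖y k - z k + Δ • (f (y k) - f (z k))‖
      + ‖fderiv ℝ g (z k) (y k - z k) (x k (k + 1))‖
      + ‖contract (X k (k + 1)) (secondCoefDeriv g (z k) (y k - z k))‖ + ‖n‖ := by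
    rw [e1]
    refine (norm_add_le _ _).trans (add_le_add_left ?_ _)
    refine (norm_add_le _ _).trans (add_le_add_left ?_ _)
    exact norm_add_le _ _
  set b := l * (1 + 2 * (m : ℝ) ^ 2 * G) * (1 + ϖ k (k + 1)) + e with hb
  have hb0 : 0 ≤ b := by positivity
  calc ‖y (k + 1) - z (k + 1)‖
      ≤ ‖y k - z k‖ * Real.exp s + l * ‖y k - z k‖ * (1 + ϖ k (k + 1))
        + (m : ℝ) ^ 2 * (1 + ϖ k (k + 1)) * (2 * l * G * ‖y k - z k‖) + e * ‖y k - z k‖ :=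
        tri.trans (add_le_add (add_le_add (add_le_add hdr n1) n2) hnb)
    _ = ‖y k - z k‖ * (Real.exp s + b) := by rw [hb]; ring
    _ ≤ ‖y k - z k‖ * Real.exp (s + Real.exp L * b) := by
        gcongr
        exact exp_add_le_exp hsL hb0
    _ ≤ _ := by
        refine mul_le_mul_of_nonneg_left (Real.exp_le_exp.2 ?_) (norm_nonneg _)
        have q1 : Real.exp L * (1 + 2 * (m : ℝ) ^ 2 * G) ≤ growthC m G L := by
          unfold growthC
          have := Real.exp_pos L
          nlinarith [mul_nonneg hL this.le, sq_nonneg L]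
        have q2 : Real.exp L * (1 + 2 * (m : ℝ) ^ 2 * G) * (l * (1 + ϖ k (k + 1)))
            ≤ growthC m G L * (l * (1 + ϖ k (k + 1))) := by gcongr
        have q3 : 0 ≤ Real.exp L * e := by positivity
        rw [hb]
        linarith

/-- The difference at index `k` is transported to `j` by the linearized noise flow. The flow from
`k` is the flow from `k + 1` after one linearized step, so consecutive transported differences
differ only by the transported drift difference and quadratic error. As the flow is `ε`-close to the
identity with `ε ≤ l`, the drift acts with its one-sided constant up to an error of order `l`. -/
theorem short_step (h : SchemePair α G l L f g Δ x X ϖ y z N M r ell) {i j : ℕ} (hij : i < j)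
    (hj : j ≤ N) (hW : pathControl ϖ Δ M i j ≤ shortC α m G) :
    ‖y j - z j‖ ≤ ‖y i - z i‖ * Real.exp (growthC m G L * l
      + ∑ k ∈ Finset.Ico i j, (Δ * ell k + L ^ 2 * Δ ^ 2 / 2
        + 4 * Real.exp L * (nonlinC m G * r * (‖x k (k + 1)‖ + ‖X k (k + 1)‖)))) := by
  have hst := h.sol.shortStretch h.drift hj hW
  have hc := h.sol.coef
  have l0 := hc.nonneg
  have lG := hc.le
  have hG := hc.one_le
  have hL := h.sol.L_nonneg
  have hr := h.r_nonneg
  have hΔ := h.sol.mesh_pos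
  obtain ⟨ε, hε⟩ : ∃ ε, ε = l / (2 * G) := ⟨_, rfl⟩
  have hε0 : 0 ≤ ε := by rw [hε]; positivity
  have hε1 : ε ≤ 1 / 2 := by
    rw [hε, div_le_div_iff₀ (by positivity) (by norm_num)]; linarith
  have hεl : ε ≤ l := by
    rw [hε, div_le_iff₀ (by positivity)]; nlinarith
  obtain ⟨c₁, hc₁⟩ : ∃ c₁, c₁ = 16 * L + 6 * L ^ 2 + 2 * L * Real.exp L := ⟨_, rfl⟩
  have hc₁0 : 0 ≤ c₁ := by rw [hc₁]; positivity
  let u : ℕ → V := fun k => linFlow g x X z k (j - k) (y k - z k)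
  have hu : ∀ k, i ≤ k → k ≤ j → ‖u k - (y k - z k)‖ ≤ ε * ‖y k - z k‖ := by
    intro k h1 h2
    rw [hε]
    exact hst.norm_linFlow_sub_le h1 h2 _
  have step : ∀ k, i ≤ k → k < j → ‖u (k + 1)‖ ≤ ‖u k‖ * Real.exp (Δ * ell k + L ^ 2 * Δ ^ 2 / 2
      + 4 * Real.exp L * (nonlinC m G * r * (‖x k (k + 1)‖ + ‖X k (k + 1)‖)) + ε * c₁ * Δ) := by
    intro k hik hkj
    have hkN : k < N := by omega
    obtain ⟨n, hn, hnb⟩ := h.exists_step hkN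
    have hsL := h.neg_le_exponent hkN
    generalize he : nonlinC m G * r * (‖x k (k + 1)‖ + ‖X k (k + 1)‖) = e at *
    have he0 : 0 ≤ e := by rw [← he]; unfold nonlinC; positivity
    have huk := hu k hik hkj.le
    have hdr := norm_add_smul_le_mul_exp (u := u k) (v := y k - z k)
      (w := f (y k) - f (z k)) hε0 hε1 hL (h.ell_abs k) hΔ.le
      (h.mesh_le_one hkN) huk (h.norm_drift_sub_le k) (h.ell_le k hkN)
    have hv2 : ‖y k - z k‖ ≤ 2 * ‖u k‖ := by
      have := (abs_le.1 ((abs_norm_sub_norm_le (u k) (y k - z k)).trans huk)).1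
      nlinarith [norm_nonneg (y k - z k)]
    have e0 : j - k = (j - (k + 1)) + 1 := by omega
    have e1 : u (k + 1) = u k + linFlow g x X z (k + 1) (j - (k + 1))
          (Δ • (f (y k) - f (z k))) + linFlow g x X z (k + 1) (j - (k + 1)) n := by
      simp only [u]
      rw [hn, map_add, map_add, e0]
      rfl
    have f1 := hst.norm_linFlow_sub_le (k := k + 1) (by omega) hkj (Δ • (f (y k) - f (z k)))
    have f2 := hst.norm_linFlow_sub_le (k := k + 1) (by omega) hkj n
    rw [← hε] at f1 f2
    generalize linFlow g x X z (k + 1) (j - (k + 1)) = Λ at *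
    have f3 : ‖Λ n‖ ≤ 4 * e * ‖u k‖ := by
      have a1 : ‖Λ n‖ ≤ ‖Λ n - n‖ + ‖n‖ := by
        have := norm_add_le (Λ n - n) n
        rwa [sub_add_cancel] at this
      have a2 : ε * ‖n‖ ≤ 1 * ‖n‖ := by gcongr; linarith
      have a3 : e * ‖y k - z k‖ ≤ e * (2 * ‖u k‖) := by gcongr
      linarith
    have f4 : ‖Λ (Δ • (f (y k) - f (z k))) - Δ • (f (y k) - f (z k))‖
        ≤ 2 * L * ε * Δ * ‖u k‖ := by
      refine f1.trans ?_
      rw [norm_smul, Real.norm_of_nonneg hΔ.le]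
      calc ε * (Δ * ‖f (y k) - f (z k)‖) ≤ ε * (Δ * (L * (2 * ‖u k‖))) := by
            have := h.norm_drift_sub_le k
            gcongr
            exact this.trans (by gcongr)
        _ = _ := by ring
    have e2 : u (k + 1) = (u k + Δ • (f (y k) - f (z k)))
        + (Λ (Δ • (f (y k) - f (z k))) - Δ • (f (y k) - f (z k))) + Λ n := by
      rw [e1]; abel
    have tri : ‖u (k + 1)‖ ≤ ‖u k + Δ • (f (y k) - f (z k))‖
        + ‖Λ (Δ • (f (y k) - f (z k))) - Δ • (f (y k) - f (z k))‖ + ‖Λ n‖ := by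
      rw [e2]
      exact (norm_add_le _ _).trans (add_le_add_left (norm_add_le _ _) _)
    set s := Δ * ell k + L ^ 2 * Δ ^ 2 / 2 with hs
    have hpos : 0 ≤ ε * Δ * (16 * L + 6 * L ^ 2) := by positivity
    calc ‖u (k + 1)‖ ≤ ‖u k‖ * Real.exp (s + ε * Δ * (16 * L + 6 * L ^ 2))
          + 2 * L * ε * Δ * ‖u k‖ + 4 * e * ‖u k‖ :=
          tri.trans (add_le_add (add_le_add hdr f4) f3)
      _ = ‖u k‖ * (Real.exp (s + ε * Δ * (16 * L + 6 * L ^ 2)) + (2 * L * ε * Δ + 4 * e)) := by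
          ring
      _ ≤ ‖u k‖ * Real.exp (s + ε * Δ * (16 * L + 6 * L ^ 2)
            + Real.exp L * (2 * L * ε * Δ + 4 * e)) := by
          gcongr
          exact exp_add_le_exp (by linarith) (by positivity)
      _ = _ := by
          congr 2
          rw [hc₁]; ring
  have chain : ∀ k, i ≤ k → k ≤ j → ‖u k‖ ≤ ‖u i‖ * Real.exp (∑ k ∈ Finset.Ico i k,
      (Δ * ell k + L ^ 2 * Δ ^ 2 / 2
      + 4 * Real.exp L * (nonlinC m G * r * (‖x k (k + 1)‖ + ‖X k (k + 1)‖)) + ε * c₁ * Δ)) := by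
    intro k hik
    induction k, hik using Nat.le_induction with
    | base => intro _; simp
    | succ k hik ih =>
      intro hk
      rw [Finset.sum_Ico_succ_top hik, Real.exp_add, ← mul_assoc]
      refine (step k hik (by omega)).trans ?_
      have := ih (by omega)
      gcongr
  have huj : u j = y j - z j := by simp [u, linFlow]
  have hui : ‖u i‖ ≤ ‖y i - z i‖ * Real.exp ε := by
    have h1 := hu i le_rfl hij.le
    have h2 : ‖u i‖ ≤ ‖u i - (y i - z i)‖ + ‖y i - z i‖ := by
      have := norm_add_le (u i - (y i - z i)) (y i - z i)
      rwa [sub_add_cancel] at this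
    have h3 := Real.add_one_le_exp ε
    nlinarith [norm_nonneg (y i - z i)]
  have fin := chain j hij.le le_rfl
  rw [huj] at fin
  rw [Finset.sum_add_distrib] at fin
  refine fin.trans ?_
  have hsum : ∑ k ∈ Finset.Ico i j, ε * c₁ * Δ ≤ l * c₁ := by
    rw [Finset.sum_const, Nat.card_Ico, nsmul_eq_mul]
    have := h.sol.length_le_one i hj
    calc ((j - i : ℕ) : ℝ) * (ε * c₁ * Δ) = ε * c₁ * (Δ * ((j - i : ℕ) : ℝ)) := by ring
      _ ≤ ε * c₁ * 1 := by gcongr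
      _ ≤ l * c₁ := by rw [mul_one]; gcongr
  refine (mul_le_mul_of_nonneg_right hui (Real.exp_pos _).le).trans ?_
  rw [mul_assoc, ← Real.exp_add]
  refine mul_le_mul_of_nonneg_left (Real.exp_le_exp.2 ?_) (norm_nonneg _)
  have hg : l * c₁ + ε ≤ growthC m G L * l := by
    have : 0 ≤ Real.exp L * (1 + 2 * (m : ℝ) ^ 2 * G) * l := by positivity
    rw [hc₁]
    unfold growthC
    linarith
  linarith

/-- Growth of the difference of two solutions over the indices `0, …, N`. -/
theorem growth (h : SchemePair α G l L f g Δ x X ϖ y z N M r ell) :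
    ‖y N - z N‖ ≤ ‖y 0 - z 0‖ * Real.exp (∑ k ∈ Finset.range N, (Δ * ell k + L ^ 2 * Δ ^ 2 / 2
        + 4 * Real.exp L * (nonlinC m G * r * (‖x k (k + 1)‖ + ‖X k (k + 1)‖)))
      + growthC m G L * (2 + 2 / shortC α m G) * l * (1 + ϖ 0 N + M)) := by
  have hc := h.sol.coef
  have l0 := hc.nonneg
  have hG := hc.one_le
  have hL := h.sol.L_nonneg
  have hΔ := h.sol.mesh_pos
  have hM0 : 0 ≤ M := (norm_nonneg _).trans (h.drift 0 (Nat.zero_le _))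
  have hs := shortC_pos h.sol.lo m hG
  have hg := growthC_pos m hG hL
  have hϖ := h.sol.rough.ctrl.nonneg 0 N
  rcases Nat.eq_zero_or_pos N with hN | hN
  · subst hN
    simp only [Finset.range_zero, Finset.sum_empty, zero_add]
    refine le_mul_of_one_le_right (norm_nonneg _) (Real.one_le_exp ?_)
    positivity
  have key := greedy_chain (Φ := fun k => ‖y k - z k‖) (W := pathControl ϖ Δ M)
    (b := fun i j => ∑ k ∈ Finset.Ico i j, (Δ * ell k + L ^ 2 * Δ ^ 2 / 2
        + 4 * Real.exp L * (nonlinC m G * r * (‖x k (k + 1)‖ + ‖X k (k + 1)‖)))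
        + growthC m G L * l * ϖ i j) (a := growthC m G L * l) (c := shortC α m G)
    (isControl_pathControl h.sol.rough.ctrl hΔ.le hM0) hs (by positivity) 0 N
    (fun _ => norm_nonneg _)
    (fun i u j _ h1 h2 _ => by
      have := h.sol.rough.ctrl.superadd i u j h1.le h2.le
      have e := mul_le_mul_of_nonneg_left this (show 0 ≤ growthC m G L * l by positivity)
      rw [← Finset.sum_Ico_consecutive _ h1.le h2.le]
      linarith)
    (fun i j _ hij hj hsh => by
      rcases hsh with e | e
      · subst e
        rw [Nat.Ico_succ_singleton, Finset.sum_singleton]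
        exact h.single_step (by omega)
      · refine (h.short_step hij hj e).trans ?_
        have := h.sol.rough.ctrl.nonneg i j
        have : 0 ≤ growthC m G L * l * ϖ i j := by positivity
        refine mul_le_mul_of_nonneg_left (Real.exp_le_exp.2 ?_) (norm_nonneg _)
        linarith) 0 N le_rfl hN le_rfl
  refine key.trans ?_
  rw [Nat.Ico_zero_eq_range]
  refine mul_le_mul_of_nonneg_left (Real.exp_le_exp.2 ?_) (norm_nonneg _)
  have hW : pathControl ϖ Δ M 0 N ≤ ϖ 0 N + 1 + M := by
    unfold pathControl
    have := h.sol.length_le_one 0 (le_refl N)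
    rw [mul_assoc]
    nlinarith
  have hq : growthC m G L * l * (1 + 2 * pathControl ϖ Δ M 0 N / shortC α m G)
      + growthC m G L * l * ϖ 0 N
      ≤ growthC m G L * (2 + 2 / shortC α m G) * l * (1 + ϖ 0 N + M) := by
    have a1 : growthC m G L * l * (1 + 2 * pathControl ϖ Δ M 0 N / shortC α m G)
        ≤ growthC m G L * l * (1 + 2 * (ϖ 0 N + 1 + M) / shortC α m G) := by gcongr
    have a2 : growthC m G L * (2 + 2 / shortC α m G) * l * (1 + ϖ 0 N + M)
        = growthC m G L * l * (1 + 2 * (ϖ 0 N + 1 + M) / shortC α m G)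
          + growthC m G L * l * ϖ 0 N + growthC m G L * l * (1 + ϖ 0 N + 2 * M) := by
      field_simp; ring
    have a3 : 0 ≤ growthC m G L * l * (1 + ϖ 0 N + 2 * M) := by positivity
    linarith
  linarith

end SchemePair

end Difference

end RoughEuler

end

noncomputable section

namespace RoughEuler

/-! ### Variation as a superadditive functional -/

section VarPow

variable {F : Type*} [NormedAddCommGroup F] {r : ℝ} {A : ℝ → ℝ → F} {s t u : Set ℝ}

theorem varPow_mono (h : s ⊆ t) : varPow r A s ≤ varPow r A t := by
  refine iSup_le fun v => ?_
  exact le_iSup (fun u : ℕ × {u : ℕ → ℝ // Monotone u ∧ ∀ i, u i ∈ t} =>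
    ∑ i ∈ Finset.range u.1, ‖A (u.2.1 i) (u.2.1 (i + 1))‖ₑ ^ r)
    ⟨v.1, v.2.1, v.2.2.1, fun i => h (v.2.2.2 i)⟩

theorem varPow_empty : varPow r A ∅ = 0 := by
  have : IsEmpty (ℕ × {u : ℕ → ℝ // Monotone u ∧ ∀ i, u i ∈ (∅ : Set ℝ)}) :=
    ⟨fun v => v.2.2.2 0⟩
  exact iSup_of_empty _

theorem sum_le_varPow (n : ℕ) {v : ℕ → ℝ} (hv : Monotone v) (hs : ∀ i, v i ∈ s) :
    ∑ i ∈ Finset.range n, ‖A (v i) (v (i + 1))‖ₑ ^ r ≤ varPow r A s :=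
  le_iSup (fun u : ℕ × {u : ℕ → ℝ // Monotone u ∧ ∀ i, u i ∈ s} =>
    ∑ i ∈ Finset.range u.1, ‖A (u.2.1 i) (u.2.1 (i + 1))‖ₑ ^ r) ⟨n, v, hv, hs⟩

theorem enorm_rpow_le_varPow {a b : ℝ} (ha : a ∈ s) (hb : b ∈ s) (hab : a ≤ b) :
    ‖A a b‖ₑ ^ r ≤ varPow r A s := by
  have hm : Monotone fun i : ℕ => if i = 0 then a else b := by
    intro i j hij
    dsimp only
    split_ifs <;> first | exact le_rfl | exact hab | omega
  have h := sum_le_varPow (r := r) (A := A) (s := s) 1 hm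
    (fun i => by split_ifs <;> assumption)
  simpa using h

theorem varPow_add_le (hs : s ⊆ u) (ht : t ⊆ u) (hst : ∀ a ∈ s, ∀ b ∈ t, a ≤ b) :
    varPow r A s + varPow r A t ≤ varPow r A u := by
  rcases s.eq_empty_or_nonempty with e | ⟨a, ha⟩
  · rw [e, varPow_empty, zero_add]
    exact varPow_mono ht
  rcases t.eq_empty_or_nonempty with e | ⟨b, hb⟩
  · rw [e, varPow_empty, add_zero]
    exact varPow_mono hs
  have : Nonempty (ℕ × {u : ℕ → ℝ // Monotone u ∧ ∀ i, u i ∈ s}) :=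
    ⟨0, fun _ => a, monotone_const, fun _ => ha⟩
  have : Nonempty (ℕ × {u : ℕ → ℝ // Monotone u ∧ ∀ i, u i ∈ t}) :=
    ⟨0, fun _ => b, monotone_const, fun _ => hb⟩
  refine ENNReal.iSup_add_iSup_le ?_
  rintro ⟨n, v, hv, hvs⟩ ⟨n', v', hv', hvs'⟩
  -- The two partitions are concatenated. The joining increment, of index `n`, is an extra
  -- nonnegative term and is dropped.
  have hm : Monotone fun i : ℕ => if i ≤ n then v i else v' (i - (n + 1)) := by
    intro i j hij
    dsimp only
    split_ifs with h1 h2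
    · exact hv hij
    · exact hst _ (hvs _) _ (hvs' _)
    · omega
    · exact hv' (by omega)
  refine le_trans ?_ (sum_le_varPow (n + 1 + n') hm (fun i => ?_))
  · rw [Finset.sum_range_add, Finset.sum_range_succ]
    refine add_le_add (le_trans (le_of_eq ?_) le_self_add) (le_of_eq ?_)
    · refine Finset.sum_congr rfl fun i hi => ?_
      have := Finset.mem_range.1 hi
      rw [if_pos (by omega), if_pos (by omega)]
    · refine Finset.sum_congr rfl fun i _ => ?_
      rw [if_neg (by omega), if_neg (by omega)]
      rw [show n + 1 + i - (n + 1) = i by omega, show n + 1 + i + 1 - (n + 1) = i + 1 by omega]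
  · split_ifs
    · exact hs (hvs _)
    · exact ht (hvs' _)

theorem varPow_of_subsingleton (hr : 0 < r) (hA : ∀ a, A a a = 0) (hs : s.Subsingleton) :
    varPow r A s = 0 := by
  refine le_antisymm (iSup_le fun v => ?_) (zero_le)
  refine le_of_eq (Finset.sum_eq_zero fun i _ => ?_)
  rw [hs (v.2.2.2 i) (v.2.2.2 (i + 1)), hA, enorm_zero, ENNReal.zero_rpow_of_pos hr]

theorem varPow_Icc_le {a b C : ℝ}
    (h : ∀ c ∈ Icc a b, ∀ d ∈ Icc a b, c ≤ d → ‖A c d‖ₑ ^ r ≤ ENNReal.ofReal (C * (d - c)))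
    (hC : 0 ≤ C) : varPow r A (Icc a b) ≤ ENNReal.ofReal (C * (b - a)) := by
  refine iSup_le fun v => ?_
  obtain ⟨n, v, hv, hs⟩ := v
  calc ∑ i ∈ Finset.range n, ‖A (v i) (v (i + 1))‖ₑ ^ r
      ≤ ∑ i ∈ Finset.range n, ENNReal.ofReal (C * (v (i + 1) - v i)) :=
        Finset.sum_le_sum fun i _ => h _ (hs i) _ (hs (i + 1)) (hv (Nat.le_succ i))
    _ = ENNReal.ofReal (∑ i ∈ Finset.range n, C * (v (i + 1) - v i)) := by
        rw [ENNReal.ofReal_sum_of_nonneg]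
        intro i _
        exact mul_nonneg hC (sub_nonneg.2 (hv (Nat.le_succ i)))
    _ ≤ _ := by
        rw [← Finset.mul_sum, Finset.sum_range_sub]
        refine ENNReal.ofReal_le_ofReal (mul_le_mul_of_nonneg_left ?_ hC)
        linarith [(hs n).2, (hs 0).1]

end VarPow

/-- Superadditivity of a functional of the subintervals of `[0,1]`. -/
def SuperaddOn (Q : ℝ → ℝ → ℝ≥0∞) : Prop :=
  ∀ s u t, 0 ≤ s → s ≤ u → u ≤ t → t ≤ 1 → Q s u + Q u t ≤ Q s t

theorem SuperaddOn.add {Q Q' : ℝ → ℝ → ℝ≥0∞} (h : SuperaddOn Q) (h' : SuperaddOn Q') :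
    SuperaddOn fun s t => Q s t + Q' s t := fun s u t h0 h1 h2 h3 => by
  calc Q s u + Q' s u + (Q u t + Q' u t) = (Q s u + Q u t) + (Q' s u + Q' u t) := by
        rw [add_add_add_comm]
    _ ≤ _ := add_le_add (h s u t h0 h1 h2 h3) (h' s u t h0 h1 h2 h3)

theorem SuperaddOn.const_mul {Q : ℝ → ℝ → ℝ≥0∞} (h : SuperaddOn Q) (k : ℝ≥0∞) :
    SuperaddOn fun s t => k * Q s t := fun s u t h0 h1 h2 h3 => by
  rw [← mul_add]
  exact mul_le_mul_right (h s u t h0 h1 h2 h3) k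

theorem superaddOn_length {C : ℝ} (hC : 0 ≤ C) :
    SuperaddOn fun s t => ENNReal.ofReal (C * (t - s)) := fun s u t _ h1 h2 _ => by
  rw [← ENNReal.ofReal_add (mul_nonneg hC (by linarith)) (mul_nonneg hC (by linarith))]
  exact le_of_eq (by ring_nf)

theorem superaddOn_varPow_Icc {F : Type*} [NormedAddCommGroup F] (r : ℝ) (A : ℝ → ℝ → F) :
    SuperaddOn fun s t => varPow r A (Icc s t) := fun _ _ _ _ h1 h2 _ =>
  varPow_add_le (Icc_subset_Icc_right h2) (Icc_subset_Icc_left h1)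
    fun _ ha _ hb => ha.2.trans hb.1

theorem superaddOn_varPow_grid {F : Type*} [NormedAddCommGroup F] (r : ℝ) (A : ℝ → ℝ → F)
    (Δ : ℝ) : SuperaddOn fun s t => varPow r A (grid Δ s t) := fun _ _ _ _ h1 h2 _ =>
  varPow_add_le (fun _ h => ⟨h.1, h.2.1, h.2.2.trans h2⟩) (fun _ h => ⟨h.1, h1.trans h.2.1, h.2.2⟩)
    fun _ ha _ hb => ha.2.2.trans hb.2.1

/-- The least discrete control above a quantity is dominated by any superadditive functional
above it. -/
theorem ofReal_chainSup_le {Q : ℝ → ℝ → ℝ≥0∞} (hQ : SuperaddOn Q) {Δ : ℝ} (hΔ : 0 ≤ Δ)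
    {c : ℕ → ℕ → ℝ} (hc : ∀ i j, 0 ≤ c i j) {N : ℕ} (hN : N * Δ ≤ 1)
    (h : ∀ i j, i ≤ j → j ≤ N → ENNReal.ofReal (c i j) ≤ Q (i * Δ) (j * Δ)) {n : ℕ} (hn : n ≤ N) :
    ENNReal.ofReal (chainSup c 0 n) ≤ Q 0 (n * Δ) := by
  induction n using Nat.strong_induction_on with
  | _ n ih =>
  rcases Nat.eq_zero_or_pos n with e | e
  · subst e
    rw [chainSup_of_le c le_rfl, ENNReal.ofReal_zero]
    exact zero_le
  · obtain ⟨k, _, h2, h3⟩ := exists_chainSup_eq c hc e (fun k _ => chainSup_nonneg c hc 0 k)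
    rw [h3, ENNReal.ofReal_add (chainSup_nonneg c hc 0 k) (hc k n)]
    have hkn : (k : ℝ) * Δ ≤ n * Δ := by gcongr
    have hnN : (n : ℝ) * Δ ≤ N * Δ := by gcongr
    refine (add_le_add (ih k h2 (by omega)) (h k n h2.le hn)).trans ?_
    exact hQ 0 (k * Δ) (n * Δ) le_rfl (by positivity) hkn (hnN.trans hN)

/-! ### Greedy counts -/

section Greedy

variable {W Q : ℝ → ℝ → ℝ≥0∞} {γ : ℝ}

theorem greedy_mem_Icc (W : ℝ → ℝ → ℝ≥0∞) (γ : ℝ) (i : ℕ) : greedy W γ 0 1 i ∈ Icc (0 : ℝ) 1 := by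
  induction i with
  | zero => simp [greedy]
  | succ i ih =>
    have hb : ∀ t ∈ {t | greedy W γ 0 1 i < t ∧ ENNReal.ofReal γ ≤ W (greedy W γ 0 1 i) t} ∪ {1},
        (0 : ℝ) ≤ t := by
      rintro t (ht | ht)
      · exact ih.1.trans ht.1.le
      · rw [ht]; norm_num
    rw [greedy]
    exact ⟨le_csInf ⟨1, Or.inr rfl⟩ hb, csInf_le ⟨0, hb⟩ (Or.inr rfl)⟩

theorem greedy_lt_succ (hsmall : ∀ s, 0 ≤ s → s < 1 → ∃ δ > 0, ∀ t, s < t → t < s + δ →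
      W s t < ENNReal.ofReal γ) {i : ℕ} (hi : greedy W γ 0 1 i < 1) :
    greedy W γ 0 1 i < greedy W γ 0 1 (i + 1) := by
  obtain ⟨δ, hδ, h⟩ := hsmall _ (greedy_mem_Icc W γ i).1 hi
  have : min (greedy W γ 0 1 i + δ) 1 ≤ greedy W γ 0 1 (i + 1) := by
    rw [greedy]
    refine le_csInf ⟨1, Or.inr rfl⟩ ?_
    rintro t (ht | ht)
    · refine (min_le_left _ _).trans ?_
      by_contra hlt
      exact absurd ht.2 (not_le.2 (h t ht.1 (not_le.1 hlt)))
    · rw [ht]; exact min_le_right _ _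
  exact lt_of_lt_of_le (lt_min (by linarith) hi) this

theorem greedy_le_succ (W : ℝ → ℝ → ℝ≥0∞) (γ : ℝ) (i : ℕ) :
    greedy W γ 0 1 i ≤ greedy W γ 0 1 (i + 1) := by
  conv_rhs => rw [greedy]
  refine le_csInf ⟨1, Or.inr rfl⟩ ?_
  rintro t (ht | ht)
  · exact ht.1.le
  · rw [ht]; exact (greedy_mem_Icc W γ i).2

/-- `W` need not be continuous, so the threshold may not be reached at the infimum `τ_{i+1}` itself.
It is reached at points arbitrarily close above, one of which lies before `τ_{i+2}` because the
times increase strictly. -/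
theorem greedy_two_steps (hQ : SuperaddOn Q)
    (hW : ∀ s t, 0 ≤ s → s < t → t ≤ 1 → ENNReal.ofReal γ ≤ W s t → 1 ≤ Q s t)
    (hsmall : ∀ s, 0 ≤ s → s < 1 → ∃ δ > 0, ∀ t, s < t → t < s + δ → W s t < ENNReal.ofReal γ)
    {i : ℕ} (hi : greedy W γ 0 1 (i + 1) < 1) :
    1 ≤ Q (greedy W γ 0 1 i) (greedy W γ 0 1 (i + 2)) := by
  have h1 := greedy_lt_succ hsmall hi
  have h2 := (greedy_mem_Icc W γ (i + 2)).2
  have h0 := (greedy_mem_Icc W γ i).1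
  rw [greedy] at h1
  obtain ⟨t, ht, hlt⟩ := exists_lt_of_csInf_lt (Set.Nonempty.inr (Set.singleton_nonempty 1)) h1
  rcases ht with ht | ht
  · calc 1 ≤ Q (greedy W γ 0 1 i) t := hW _ _ h0 ht.1 (hlt.le.trans h2) ht.2
      _ ≤ _ := le_self_add.trans (hQ _ t _ h0 ht.1.le hlt.le h2)
  · rw [ht] at hlt
    exact absurd h2 (not_le.2 hlt)

theorem greedyCount_le (hQ : SuperaddOn Q)
    (hW : ∀ s t, 0 ≤ s → s < t → t ≤ 1 → ENNReal.ofReal γ ≤ W s t → 1 ≤ Q s t)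
    (hsmall : ∀ s, 0 ≤ s → s < 1 → ∃ δ > 0, ∀ t, s < t → t < s + δ → W s t < ENNReal.ofReal γ) :
    greedyCount W γ 0 1 ≤ 2 + 2 * Q 0 1 := by
  have hmono : Monotone (greedy W γ 0 1) := monotone_nat_of_le_succ (greedy_le_succ W γ)
  have claim : ∀ j : ℕ, (∀ i, i < 2 * j → greedy W γ 0 1 i < 1) →
      (j : ℝ≥0∞) ≤ Q 0 (greedy W γ 0 1 (2 * j)) := by
    intro j
    induction j with
    | zero => intro _; simp
    | succ j ih =>
      intro h
      have e1 := ih fun i hi => h i (by omega)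
      have e2 := greedy_two_steps hQ hW hsmall (i := 2 * j) (h (2 * j + 1) (by omega))
      push_cast
      exact (add_le_add e1 e2).trans (hQ 0 _ _ le_rfl (greedy_mem_Icc W γ _).1
        (hmono (by omega)) (greedy_mem_Icc W γ _).2)
  refine iSup₂_le fun i hi => ?_
  -- Pairing the steps: all indices below `2 * ((i + 1) / 2)` are at most `i`, and rounding is paid
  -- for by the constant 2.
  have e := claim ((i + 1) / 2) fun k hk => (hmono (by omega : k ≤ i)).trans_lt hi
  have e2 : Q 0 (greedy W γ 0 1 (2 * ((i + 1) / 2))) ≤ Q 0 1 :=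
    le_self_add.trans (hQ 0 _ 1 le_rfl (greedy_mem_Icc W γ _).1 (greedy_mem_Icc W γ _).2 le_rfl)
  have e3 : ((i : ℝ≥0∞) + 1) ≤ 2 + 2 * (((i + 1) / 2 : ℕ) : ℝ≥0∞) := by
    exact_mod_cast (by omega : i + 1 ≤ 2 + 2 * ((i + 1) / 2))
  exact e3.trans (by gcongr; exact e.trans e2)

end Greedy

end RoughEuler

end

noncomputable section

namespace RoughEuler

set_option maxSynthPendingDepth 3

/-! ### Increments of a rough path on the grid -/

theorem enorm_rpow_eq {F : Type*} [NormedAddCommGroup F] (v : F) {r : ℝ} (hr : 0 ≤ r) :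
    ‖v‖ₑ ^ r = ENNReal.ofReal (‖v‖ ^ r) := by
  rw [← ofReal_norm, ENNReal.ofReal_rpow_of_nonneg (norm_nonneg _) hr]

theorem inc_self {m : ℕ} (w : ℝ → T2 m) (s : ℝ) : inc w s s = 1 := by simp [inc]

section Grid

variable {m : ℕ} {a : ℝ}

/-- First level of the increments over the grid of mesh `Δ`. -/
def gridX (Δ : ℝ) (w : PathSpace m a) (i j : ℕ) : E m := (inc w.1 (i * Δ) (j * Δ)).lvl1

/-- Second level of the increments over the grid of mesh `Δ`. -/
def gridXX (Δ : ℝ) (w : PathSpace m a) (i j : ℕ) : E2 m := (inc w.1 (i * Δ) (j * Δ)).lvl2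

/-- The cost `‖x‖^p + ‖𝕏‖^q` of a single grid increment. -/
def gridCost (Δ : ℝ) (w : PathSpace m a) (i j : ℕ) : ℝ :=
  ‖gridX Δ w i j‖ ^ (1 / a) + ‖gridXX Δ w i j‖ ^ (1 / a / 2)

/-- The variation over the grid as a discrete control. -/
def gridControl (Δ : ℝ) (w : PathSpace m a) : ℕ → ℕ → ℝ := chainSup (gridCost Δ w)

theorem gridCost_nonneg (Δ : ℝ) (w : PathSpace m a) (i j : ℕ) : 0 ≤ gridCost Δ w i j := by
  unfold gridCost
  positivity

theorem gridControl_nonneg (Δ : ℝ) (w : PathSpace m a) (i j : ℕ) : 0 ≤ gridControl Δ w i j :=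
  chainSup_nonneg _ (gridCost_nonneg Δ w) i j

theorem roughData_grid (ha : 0 < a) (Δ : ℝ) (w : PathSpace m a) :
    RoughData a (gridX Δ w) (gridXX Δ w) (gridControl Δ w) where
  ctrl := isControl_chainSup _ (gridCost_nonneg Δ w)
  add i u j := by
    have h : inc w.1 (i * Δ) (j * Δ) = inc w.1 (i * Δ) (u * Δ) * inc w.1 (u * Δ) (j * Δ) := by
      simp [inc, mul_assoc]
    rw [gridX, h, T2.mul_lvl1]
    rfl
  chen i u j := inc_chen _ _ _ _
  bx i j hij := by
    rcases hij.eq_or_lt with e | e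
    · subst e
      rw [gridX, inc_self, T2.one_lvl1, norm_zero]
      exact Real.rpow_nonneg (chainSup_nonneg _ (gridCost_nonneg Δ w) _ _) _
    · have h : ‖gridX Δ w i j‖ ^ (1 / a) ≤ gridControl Δ w i j :=
        (le_add_of_nonneg_right (by positivity) :
          _ ≤ gridCost Δ w i j).trans (le_chainSup (gridCost Δ w) e)
      calc ‖gridX Δ w i j‖ = (‖gridX Δ w i j‖ ^ (1 / a)) ^ a := by
            rw [← Real.rpow_mul (norm_nonneg _), one_div_mul_cancel ha.ne', Real.rpow_one]
        _ ≤ _ := by gcongr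
  bX i j hij := by
    rcases hij.eq_or_lt with e | e
    · subst e
      rw [gridXX, inc_self, T2.one_lvl2, norm_zero]
      positivity
    · have h : ‖gridXX Δ w i j‖ ^ (1 / a / 2) ≤ gridControl Δ w i j :=
        (le_add_of_nonneg_left (by positivity) :
          _ ≤ gridCost Δ w i j).trans (le_chainSup (gridCost Δ w) e)
      have h0 := gridControl_nonneg Δ w i j
      calc ‖gridXX Δ w i j‖ = (‖gridXX Δ w i j‖ ^ (1 / a / 2)) ^ (a * 2) := by
            rw [← Real.rpow_mul (norm_nonneg _), show 1 / a / 2 * (a * 2) = 1 by field_simp,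
              Real.rpow_one]
        _ ≤ gridControl Δ w i j ^ (a * 2) := by gcongr
        _ = _ := by
          rw [Real.rpow_mul h0]
          exact_mod_cast rfl

theorem ofReal_gridCost_le {Δ : ℝ} (ha : 0 < a) (hΔ : 0 ≤ Δ) (w : PathSpace m a) {i j : ℕ}
    (hij : i ≤ j) : ENNReal.ofReal (gridCost Δ w i j)
      ≤ xVarPow w (Icc (i * Δ) (j * Δ)) + xxVarPow w (Icc (i * Δ) (j * Δ)) := by
  have h : (i : ℝ) * Δ ≤ j * Δ := by gcongr
  rw [gridCost, ENNReal.ofReal_add (by positivity) (by positivity),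
    ← enorm_rpow_eq _ (by positivity), ← enorm_rpow_eq _ (by positivity)]
  exact add_le_add
    (enorm_rpow_le_varPow (A := fun u v => (inc w.1 u v).lvl1) (left_mem_Icc.2 h)
      (right_mem_Icc.2 h) h)
    (enorm_rpow_le_varPow (A := fun u v => (inc w.1 u v).lvl2) (left_mem_Icc.2 h)
      (right_mem_Icc.2 h) h)

/-- Random costs are formed with the finite supremum `gridControl`, which is clearly measurable. The
variation over `[0,1]` serves only as an upper bound, so its measurability is never required. -/
theorem ofReal_gridControl_le {Δ : ℝ} (ha : 0 < a) (hΔ : 0 ≤ Δ) (w : PathSpace m a) {N : ℕ}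
    (hN : N * Δ ≤ 1) : ENNReal.ofReal (gridControl Δ w 0 N)
      ≤ xVarPow w (Icc 0 1) + xxVarPow w (Icc 0 1) := by
  have hQ : SuperaddOn fun s t => xVarPow w (Icc s t) + xxVarPow w (Icc s t) :=
    (superaddOn_varPow_Icc _ _).add (superaddOn_varPow_Icc _ _)
  refine (ofReal_chainSup_le hQ hΔ (gridCost_nonneg Δ w) hN
    (fun i j hij _ => ofReal_gridCost_le ha hΔ w hij) le_rfl).trans ?_
  exact add_le_add (varPow_mono (Icc_subset_Icc_right hN)) (varPow_mono (Icc_subset_Icc_right hN))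

theorem measurable_lvl1 (t : ℝ) : Measurable fun w : PathSpace m a => (w.1 t).lvl1 := by
  refine measurable_iff_comap_le.2 (le_trans le_sup_left (le_iSup (fun t : ℝ =>
    MeasurableSpace.comap (fun w : PathSpace m a => (w.1 t).lvl1) inferInstance ⊔
    MeasurableSpace.comap (fun w : PathSpace m a => (w.1 t).lvl2) inferInstance) t))

theorem measurable_lvl2 (t : ℝ) : Measurable fun w : PathSpace m a => (w.1 t).lvl2 := by
  refine measurable_iff_comap_le.2 (le_trans le_sup_right (le_iSup (fun t : ℝ =>
    MeasurableSpace.comap (fun w : PathSpace m a => (w.1 t).lvl1) inferInstance ⊔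
    MeasurableSpace.comap (fun w : PathSpace m a => (w.1 t).lvl2) inferInstance) t))

theorem measurable_tens {Ω : Type*} [MeasurableSpace Ω] {x y : Ω → E m} (hx : Measurable x)
    (hy : Measurable y) : Measurable fun w => tens (x w) (y w) := by
  have h : Continuous fun v : E m × E m => tens v.1 v.2 := by
    unfold tens
    fun_prop
  exact h.measurable.comp (hx.prodMk hy)

theorem measurable_inc_lvl1 (s t : ℝ) :
    Measurable fun w : PathSpace m a => (inc w.1 s t).lvl1 := by
  simp only [inc, T2.mul_lvl1, T2.inv_lvl1]
  exact (measurable_lvl1 s).neg.add (measurable_lvl1 t)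

theorem measurable_inc_lvl2 (s t : ℝ) :
    Measurable fun w : PathSpace m a => (inc w.1 s t).lvl2 := by
  simp only [inc, T2.mul_lvl2, T2.inv_lvl1, T2.inv_lvl2]
  exact ((measurable_tens (measurable_lvl1 s).neg (measurable_lvl1 t)).add
    ((measurable_tens (measurable_lvl1 s) (measurable_lvl1 s)).sub (measurable_lvl2 s))).add
      (measurable_lvl2 t)

theorem measurable_gridCost (Δ : ℝ) (i j : ℕ) :
    Measurable fun w : PathSpace m a => gridCost Δ w i j :=
  ((measurable_inc_lvl1 _ _).norm.pow_const _).add ((measurable_inc_lvl2 _ _).norm.pow_const _)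

theorem measurable_gridControl (Δ : ℝ) (i j : ℕ) :
    Measurable fun w : PathSpace m a => gridControl Δ w i j :=
  measurable_chainSup _ (measurable_gridCost Δ) i j

end Grid

/-! ### Bounds of the greedy counts -/

theorem one_le_mul_of_ofReal_le_rpow {V : ℝ≥0∞} {t b : ℝ} (ht : 0 < t) (hb : 0 < b)
    (h : ENNReal.ofReal t ≤ V ^ b) : 1 ≤ ENNReal.ofReal ((1 / t) ^ (1 / b)) * V := by
  have h1 : ENNReal.ofReal (t ^ (1 / b)) ≤ V := by
    rw [← ENNReal.ofReal_rpow_of_pos ht]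
    calc ENNReal.ofReal t ^ (1 / b) ≤ (V ^ b) ^ (1 / b) := by gcongr
      _ = V := by rw [← ENNReal.rpow_mul, mul_one_div_cancel hb.ne', ENNReal.rpow_one]
  calc (1 : ℝ≥0∞) = ENNReal.ofReal ((1 / t) ^ (1 / b)) * ENNReal.ofReal (t ^ (1 / b)) := by
        rw [← ENNReal.ofReal_mul (by positivity), ← Real.mul_rpow (by positivity) ht.le,
          one_div_mul_cancel ht.ne', Real.one_rpow, ENNReal.ofReal_one]
    _ ≤ _ := by gcongr

/-- Hölder regularity of the individual path. The constant is random, but it only serves to make the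
greedy times strictly increasing. -/
theorem exists_variation_le {m : ℕ} {a : ℝ} (ha : 0 < a) (w : PathSpace m a) :
    ∃ K : ℝ, 0 ≤ K ∧ ∀ s t, 0 ≤ s → s ≤ t → t ≤ 1 →
      xVarPow w (Icc s t) + xxVarPow w (Icc s t) ≤ ENNReal.ofReal (K * (t - s)) := by
  obtain ⟨C, hC⟩ := w.2.2.1 1 one_pos
  have key : ∀ s t, 0 ≤ s → s ≤ t → t ≤ 1 → ∀ b : ℝ, 0 < b → ∀ v : ℝ,
      0 ≤ v → v ≤ C * |t - s| ^ b → v ^ (1 / b) ≤ |C| ^ (1 / b) * (t - s) := by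
    intro s t _ hst _ b hb v hv h
    have hts : 0 ≤ t - s := by linarith
    rw [abs_of_nonneg hts] at h
    have h' : v ≤ |C| * (t - s) ^ b := h.trans (by gcongr; exact le_abs_self C)
    calc v ^ (1 / b) ≤ (|C| * (t - s) ^ b) ^ (1 / b) := by gcongr
      _ = _ := by
        rw [Real.mul_rpow (abs_nonneg _) (by positivity), ← Real.rpow_mul hts,
          mul_one_div_cancel hb.ne', Real.rpow_one]
  have hmem : ∀ s t, 0 ≤ s → t ≤ 1 → ∀ c ∈ Icc s t, c ∈ Icc (-1 : ℝ) 1 := fun s t h0 h1 c hc =>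
    ⟨by linarith [hc.1], by linarith [hc.2]⟩
  have he : 1 / (2 * a) = 1 / a / 2 := by field_simp
  refine ⟨|C| ^ (1 / a) + |C| ^ (1 / a / 2), by positivity, fun s t h0 hst h1 => ?_⟩
  rw [add_mul, ENNReal.ofReal_add (mul_nonneg (by positivity) (by linarith))
    (mul_nonneg (by positivity) (by linarith))]
  refine add_le_add (varPow_Icc_le (fun c hc d hd hcd => ?_) (by positivity))
    (varPow_Icc_le (fun c hc d hd hcd => ?_) (by positivity))
  · rw [enorm_rpow_eq _ (by positivity)]
    exact ENNReal.ofReal_le_ofReal (key c d (h0.trans hc.1) hcd (hd.2.trans h1) a ha _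
      (norm_nonneg _) (hC c (hmem s t h0 h1 c hc) d (hmem s t h0 h1 d hd)).1)
  · rw [enorm_rpow_eq _ (by positivity), ← he]
    exact ENNReal.ofReal_le_ofReal (key c d (h0.trans hc.1) hcd (hd.2.trans h1) (2 * a)
      (by positivity) _ (norm_nonneg _) (hC c (hmem s t h0 h1 c hc) d (hmem s t h0 h1 d hd)).2)

theorem Nstar_le {m : ℕ} {a γ : ℝ} (ha : 0 < a) (hγ : 0 < γ) (w : PathSpace m a) :
    Nstar γ w ≤ 2 + 2 * (ENNReal.ofReal ((1 / γ) ^ (1 / a))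
      * (xVarPow w (Icc 0 1) + xxVarPow w (Icc 0 1))) := by
  have hQ : SuperaddOn fun s t => xVarPow w (Icc s t) + xxVarPow w (Icc s t) :=
    (superaddOn_varPow_Icc _ _).add (superaddOn_varPow_Icc _ _)
  refine greedyCount_le (hQ.const_mul (ENNReal.ofReal ((1 / γ) ^ (1 / a)))) ?_ ?_
  · intro s t _ _ _ h
    exact one_le_mul_of_ofReal_le_rpow hγ ha h
  · intro s h0 h1
    obtain ⟨K, hK, h⟩ := exists_variation_le ha w
    refine ⟨min (1 - s) (γ ^ (1 / a) / (K + 1)), lt_min (by linarith) (by positivity),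
      fun t hst ht => ?_⟩
    have e1 := min_le_left (1 - s) (γ ^ (1 / a) / (K + 1))
    have e2 := min_le_right (1 - s) (γ ^ (1 / a) / (K + 1))
    have e3 : K * (t - s) < γ ^ (1 / a) := by
      have : t - s < γ ^ (1 / a) / (K + 1) := by linarith
      rw [lt_div_iff₀ (by positivity)] at this
      nlinarith
    have e4 : xVarPow w (Icc s t) + xxVarPow w (Icc s t) < ENNReal.ofReal γ ^ (1 / a) := by
      refine (h s t h0 hst.le (by linarith)).trans_lt ?_
      rw [ENNReal.ofReal_rpow_of_pos hγ]
      exact (ENNReal.ofReal_lt_ofReal_iff (by positivity)).2 e3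
    calc roughVar w (Icc s t) < (ENNReal.ofReal γ ^ (1 / a)) ^ a := ENNReal.rpow_lt_rpow e4 ha
      _ = _ := by rw [← ENNReal.rpow_mul, one_div_mul_cancel ha.ne', ENNReal.rpow_one]

theorem exists_quarter_le {t₁ t₂ t₃ t₄ : ℝ≥0∞} {lam : ℝ} (hlam : 0 < lam)
    (h : ENNReal.ofReal lam ≤ t₁ + t₂ + t₃ + t₄) :
    ENNReal.ofReal (lam / 4) ≤ t₁ ∨ ENNReal.ofReal (lam / 4) ≤ t₂ ∨
      ENNReal.ofReal (lam / 4) ≤ t₃ ∨ ENNReal.ofReal (lam / 4) ≤ t₄ := by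
  by_contra! hcon
  obtain ⟨h1, h2, h3, h4⟩ := hcon
  have := ENNReal.add_lt_add (ENNReal.add_lt_add (ENNReal.add_lt_add h1 h2) h3) h4
  rw [← ENNReal.ofReal_add (by positivity) (by positivity),
    ← ENNReal.ofReal_add (by positivity) (by positivity),
    ← ENNReal.ofReal_add (by positivity) (by positivity)] at this
  rw [show lam / 4 + lam / 4 + lam / 4 + lam / 4 = lam by ring] at this
  exact absurd h (not_le.2 this)

theorem one_le_of_ofReal_le {t s : ℝ} (ht : 0 < t) (h : ENNReal.ofReal t ≤ ENNReal.ofReal s) :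
    1 ≤ ENNReal.ofReal (1 / t * s) := by
  rw [ENNReal.one_le_ofReal]
  have : t ≤ s := by
    rcases ENNReal.ofReal_le_ofReal_iff'.1 h with e | e
    · exact e
    · linarith
  rw [one_div_mul_eq_div, le_div_iff₀ ht]
  linarith

theorem Lf_nonneg {d : ℕ} (f : E d → E d) : 0 ≤ Lf f := Real.iSup_nonneg fun _ => norm_nonneg _

theorem subsingleton_grid {Δ s t : ℝ} (hΔ : 0 < Δ) (h : t < s + Δ) :
    (grid Δ s t).Subsingleton := by
  rintro u ⟨⟨k, rfl⟩, h1, h2⟩ v ⟨⟨n, rfl⟩, h3, h4⟩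
  have e : ∀ k n : ℕ, s ≤ k * Δ → (n : ℝ) * Δ ≤ t → n ≤ k := by
    intro k n h1 h2
    by_contra! hlt
    have : (k : ℝ) + 1 ≤ n := by exact_mod_cast hlt
    nlinarith
  rw [le_antisymm (e n k h3 h2) (e k n h1 h4)]

/-- When the four terms add up to `lam`, one of them reaches `lam / 4`; the sum of the controls,
scaled accordingly, is superadditive and then at least 1. An interval shorter than the mesh contains
at most one grid point, so the grid variations vanish there and the greedy times increase strictly.
-/
theorem NstarS_le {d m : ℕ} {a Cp lam Δ B : ℝ} {f : E d → E d} {g : E d → (E m →L[ℝ] E d)}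
    {z : PathSpace m a → E d} {w : PathSpace m a} (ha : 0 < a) (hlam : 0 < lam) (hΔ : 0 < Δ)
    (hB : ∀ u ∈ grid Δ 0 1, ‖f (z (shift u w))‖ ≤ B) (hB0 : 0 ≤ B) :
    NstarS Cp lam f g Δ z w ≤ 2 + 2 * (ENNReal.ofReal (4 / lam * Lf f)
      + ENNReal.ofReal ((4 / lam) ^ (1 / a)) * (ENNReal.ofReal ((4 * Cp + 1) * Lg g) ^ (1 / a)
          * xVarPow w (Icc 0 1))
      + ENNReal.ofReal ((4 / lam) ^ (1 / (2 * a))) *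
          (ENNReal.ofReal ((4 * Cp + 1) * Lg g) ^ (1 / a) * xxVarPow w (Icc 0 1))
      + ENNReal.ofReal (8 * B)) := by
  have hLf := Lf_nonneg f
  have q1 : SuperaddOn fun s t => ENNReal.ofReal (4 / lam * Lf f * (t - s)) :=
    superaddOn_length (by positivity)
  have q2 : SuperaddOn fun s t => ENNReal.ofReal ((4 / lam) ^ (1 / a)) *
      (ENNReal.ofReal ((4 * Cp + 1) * Lg g) ^ (1 / a) * xVarPow w (grid Δ s t)) :=
    ((superaddOn_varPow_grid _ _ Δ).const_mul _).const_mul _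
  have q3 : SuperaddOn fun s t => ENNReal.ofReal ((4 / lam) ^ (1 / (2 * a))) *
      (ENNReal.ofReal ((4 * Cp + 1) * Lg g) ^ (1 / a) * xxVarPow w (grid Δ s t)) :=
    ((superaddOn_varPow_grid _ _ Δ).const_mul _).const_mul _
  have q4 : SuperaddOn fun s t => ENNReal.ofReal (8 * B * (t - s)) :=
    superaddOn_length (by positivity)
  have hsup : ∀ s t, 0 ≤ s → t ≤ 1 →
      ⨆ u ∈ grid Δ s t, ‖f (z (shift u w))‖ₑ ≤ ENNReal.ofReal B := by
    intro s t h0 h1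
    refine iSup₂_le fun u hu => ?_
    rw [← ofReal_norm]
    exact ENNReal.ofReal_le_ofReal (hB u ⟨hu.1, h0.trans hu.2.1, hu.2.2.trans h1⟩)
  have hlast : ∀ s t, 0 ≤ s → s ≤ t → t ≤ 1 →
      ENNReal.ofReal (2 * lam * (t - s)) * ⨆ u ∈ grid Δ s t, ‖f (z (shift u w))‖ₑ
        ≤ ENNReal.ofReal (2 * lam * (t - s) * B) := by
    intro s t h0 hst h1
    rw [ENNReal.ofReal_mul (p := 2 * lam * (t - s)) (mul_nonneg (by positivity) (by linarith))]
    exact mul_le_mul_right (hsup s t h0 h1) _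
  have hq : 4 / lam = 1 / (lam / 4) := by field_simp
  have hmain := greedyCount_le (W := controlSum Cp lam f g Δ z w) (γ := lam)
    (((q1.add q2).add q3).add q4) ?_ ?_
  · refine hmain.trans ?_
    have hsub : grid Δ 0 1 ⊆ Icc 0 1 := fun u hu => hu.2
    simp only [sub_zero, mul_one]
    gcongr
    · exact varPow_mono hsub
    · exact varPow_mono hsub
  · intro s t h0 hst h1 h
    rcases exists_quarter_le hlam h with e | e | e | e
    · refine le_trans (one_le_of_ofReal_le (by positivity) e) ?_
      rw [hq, ← mul_assoc]
      exact le_self_add.trans (le_self_add.trans le_self_add)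
    · refine le_trans (one_le_mul_of_ofReal_le_rpow (by positivity) ha e) ?_
      rw [← hq]
      exact le_add_self.trans (le_self_add.trans le_self_add)
    · refine le_trans (one_le_mul_of_ofReal_le_rpow (by positivity) (by positivity) e) ?_
      rw [← hq]
      exact le_add_self.trans le_self_add
    · refine le_trans (one_le_of_ofReal_le (by positivity)
        (e.trans (hlast s t h0 hst.le h1))) ?_
      rw [show 1 / (lam / 4) * (2 * lam * (t - s) * B) = 8 * B * (t - s) by field_simp; ring]
      exact le_add_self
  · intro s h0 h1
    have hden : 0 < Lf f + 2 * lam * B + 1 := by positivity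
    refine ⟨min (min Δ (1 - s)) (lam / (Lf f + 2 * lam * B + 1)),
      lt_min (lt_min hΔ (by linarith)) (by positivity), fun t hst ht => ?_⟩
    have e1 := min_le_left (min Δ (1 - s)) (lam / (Lf f + 2 * lam * B + 1))
    have e2 := min_le_right (min Δ (1 - s)) (lam / (Lf f + 2 * lam * B + 1))
    have e3 := min_le_left Δ (1 - s)
    have e4 := min_le_right Δ (1 - s)
    have hsub := subsingleton_grid hΔ (show t < s + Δ by linarith)
    have hx : xVarPow w (grid Δ s t) = 0 :=
      varPow_of_subsingleton (by positivity) (fun u => by rw [inc_self]; rfl) hsub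
    have hxx : xxVarPow w (grid Δ s t) = 0 :=
      varPow_of_subsingleton (by positivity) (fun u => by rw [inc_self]; rfl) hsub
    have e5 : (t - s) * (Lf f + 2 * lam * B + 1) < lam := by
      have : t - s < lam / (Lf f + 2 * lam * B + 1) := by linarith
      rwa [lt_div_iff₀ hden] at this
    unfold controlSum
    rw [hx, hxx, mul_zero, ENNReal.zero_rpow_of_pos ha,
      ENNReal.zero_rpow_of_pos (by positivity), add_zero, add_zero]
    calc _ ≤ ENNReal.ofReal (Lf f * (t - s)) + ENNReal.ofReal (2 * lam * (t - s) * B) :=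
          add_le_add le_rfl (hlast s t h0 hst.le (by linarith))
      _ = ENNReal.ofReal (Lf f * (t - s) + 2 * lam * (t - s) * B) := by
          rw [ENNReal.ofReal_add (mul_nonneg hLf (by linarith))
            (mul_nonneg (mul_nonneg (by positivity) (by linarith)) hB0)]
      _ < _ := (ENNReal.ofReal_lt_ofReal_iff hlam).2 (by nlinarith)

/-- The bounds need only the first power of the variation `v`; the moment in the theorem is that of
`v ^ (p + 2)`. -/
theorem variation_le_one_add_roughVar {m : ℕ} {a : ℝ} (ha : 0 < a) (w : PathSpace m a) :
    xVarPow w (Icc 0 1) + xxVarPow w (Icc 0 1)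
      ≤ 1 + roughVar w (Icc 0 1) ^ (1 / a * (1 / a + 2)) := by
  unfold roughVar
  rw [← ENNReal.rpow_mul, show a * (1 / a * (1 / a + 2)) = 1 / a + 2 by field_simp]
  generalize xVarPow w (Icc 0 1) + xxVarPow w (Icc 0 1) = v
  rcases le_total v 1 with h | h
  · exact h.trans le_self_add
  · refine le_trans ?_ le_add_self
    calc v = v ^ (1 : ℝ) := (ENNReal.rpow_one v).symm
      _ ≤ _ := ENNReal.rpow_le_rpow_of_exponent_le h (by
        have : 0 < 1 / a := by positivity
        linarith)

end RoughEuler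

end

noncomputable section

namespace RoughEuler

/-! ### A maximal ergodic lemma -/

section Ergodic

variable {Ω : Type*}

/-- The maximum of the first Birkhoff sums `0, φ, φ + φ ∘ T, …`. -/
def birkhoffMax (T : Ω → Ω) (φ : Ω → ℝ) : ℕ → Ω → ℝ
  | 0 => fun _ => 0
  | n + 1 => fun w => max 0 (φ w + birkhoffMax T φ n (T w))

theorem birkhoffMax_nonneg (T : Ω → Ω) (φ : Ω → ℝ) (n : ℕ) (w : Ω) : 0 ≤ birkhoffMax T φ n w := by
  cases n with
  | zero => exact le_rfl
  | succ n => exact le_max_left _ _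

theorem birkhoffMax_le_succ (T : Ω → Ω) (φ : Ω → ℝ) (n : ℕ) (w : Ω) :
    birkhoffMax T φ n w ≤ birkhoffMax T φ (n + 1) w := by
  induction n generalizing w with
  | zero => exact le_max_left _ _
  | succ n ih => exact max_le_max le_rfl (add_le_add le_rfl (ih (T w)))

theorem sum_le_birkhoffMax (T : Ω → Ω) (φ : Ω → ℝ) (n : ℕ) (w : Ω) :
    ∑ k ∈ Finset.range n, φ (T^[k] w) ≤ birkhoffMax T φ n w := by
  induction n generalizing w with
  | zero => simp [birkhoffMax]
  | succ n ih =>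
    rw [Finset.sum_range_succ']
    refine le_trans ?_ (le_max_right _ _)
    have := ih (T w)
    simp only [← Function.iterate_succ_apply] at this
    simp only [Function.iterate_zero, id]
    linarith

variable [MeasurableSpace Ω] {P : Measure Ω} {T : Ω → Ω} {φ : Ω → ℝ}

theorem measurable_birkhoffMax (hT : Measurable T) (hφ : Measurable φ) (n : ℕ) :
    Measurable (birkhoffMax T φ n) := by
  induction n with
  | zero => exact measurable_const
  | succ n ih => exact measurable_const.max (hφ.add (ih.comp hT))

theorem integrable_birkhoffMax [IsFiniteMeasure P] (hT : MeasurePreserving T P P)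
    (hφ : Integrable φ P) (n : ℕ) : Integrable (birkhoffMax T φ n) P := by
  induction n with
  | zero => exact integrable_const 0
  | succ n ih =>
    exact (integrable_const (0 : ℝ)).sup (hφ.add ((hT.integrable_comp ih.1).2 ih))

/-- Boundedness of the maxima `M_n` is an invariant event. Were it null, `M_{n+1} - M_n ∘ T = max
(-M_n ∘ T) φ` would tend to `φ`, dominated by `|φ|`, while its integrals are nonnegative because
`M_n` increases and `T` preserves the measure. This contradicts the negative mean of `φ`. -/
theorem ae_bddAbove_birkhoffMax [IsProbabilityMeasure P] (hT : Ergodic T P) (hm : Measurable φ)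
    (hφ : Integrable φ P) (hneg : ∫ w, φ w ∂P < 0) :
    ∀ᵐ w ∂P, BddAbove (range fun n => birkhoffMax T φ n w) := by
  have hTm := hT.toMeasurePreserving.measurable
  have hB : MeasurableSet {w | BddAbove (range fun n => birkhoffMax T φ n w)} :=
    measurableSet_bddAbove_range fun n => measurable_birkhoffMax hTm hm n
  have hinv : T ⁻¹' {w | BddAbove (range fun n => birkhoffMax T φ n w)}
      = {w | BddAbove (range fun n => birkhoffMax T φ n w)} := by
    ext w
    simp only [mem_preimage, mem_ofPred_eq]
    constructor
    · rintro ⟨b, hb⟩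
      refine ⟨max 0 (φ w + b), ?_⟩
      rintro _ ⟨n, rfl⟩
      refine (birkhoffMax_le_succ T φ n w).trans (max_le_max le_rfl (add_le_add le_rfl ?_))
      exact hb ⟨n, rfl⟩
    · rintro ⟨b, hb⟩
      refine ⟨b - φ w, ?_⟩
      rintro _ ⟨n, rfl⟩
      have h1 : birkhoffMax T φ (n + 1) w ≤ b := hb ⟨n + 1, rfl⟩
      have h2 : φ w + birkhoffMax T φ n (T w) ≤ birkhoffMax T φ (n + 1) w := le_max_right _ _
      dsimp only
      linarith
  rcases hT.toPreErgodic.ae_mem_or_ae_notMem hB hinv with h | h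
  · exact h
  exfalso
  have hF : ∀ n w, birkhoffMax T φ (n + 1) w - birkhoffMax T φ n (T w)
      = max (-birkhoffMax T φ n (T w)) (φ w) := by
    intro n w
    change max 0 (φ w + birkhoffMax T φ n (T w)) - _ = _
    rw [← max_sub_sub_right]
    simp
  have hlim := tendsto_integral_of_dominated_convergence (μ := P)
    (F := fun n w => birkhoffMax T φ (n + 1) w - birkhoffMax T φ n (T w)) (f := φ)
    (fun w => |φ w|)
    (fun n => ((measurable_birkhoffMax hTm hm (n + 1)).sub
      ((measurable_birkhoffMax hTm hm n).comp hTm)).aestronglyMeasurable) hφ.abs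
    (fun n => Eventually.of_forall fun w => by
      rw [hF, Real.norm_eq_abs, abs_le]
      have h1 := birkhoffMax_nonneg T φ n (T w)
      refine ⟨(neg_abs_le _).trans (le_max_right _ _), max_le ?_ (le_abs_self _)⟩
      linarith [abs_nonneg (φ w)])
    (by
      filter_upwards [h] with w hw
      have hw' : ¬ BddAbove (range fun n => birkhoffMax T φ n (T w)) := fun hb =>
        hw (hinv.subset (show w ∈ T ⁻¹' _ from hb))
      have ht := tendsto_atTop_atTop_of_monotone'
        (monotone_nat_of_le_succ fun n => birkhoffMax_le_succ T φ n (T w)) hw'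
      refine tendsto_const_nhds.congr' ?_
      filter_upwards [ht.eventually_ge_atTop (-φ w)] with n hn
      rw [hF, max_eq_right (by linarith)])
  have hge : ∀ n : ℕ, 0 ≤ ∫ w, (birkhoffMax T φ (n + 1) w - birkhoffMax T φ n (T w)) ∂P := by
    intro n
    have hi := integrable_birkhoffMax hT.toMeasurePreserving hφ n
    have hi' := integrable_birkhoffMax hT.toMeasurePreserving hφ (n + 1)
    have hc : Integrable (fun w => birkhoffMax T φ n (T w)) P :=
      (hT.toMeasurePreserving.integrable_comp hi.1).2 hi
    have e : ∫ w, birkhoffMax T φ n (T w) ∂P = ∫ w, birkhoffMax T φ n w ∂P := by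
      rw [← integral_map hTm.aemeasurable (by
        rw [hT.toMeasurePreserving.map_eq]; exact hi.1), hT.toMeasurePreserving.map_eq]
    rw [integral_sub hi' hc, e, sub_nonneg]
    exact integral_mono hi hi' fun w => birkhoffMax_le_succ T φ n w
  exact absurd (ge_of_tendsto' hlim hge) (not_le.2 hneg)

/-- The Birkhoff sums of a function with negative mean decrease linearly, up to a random
constant. -/
theorem exists_birkhoff_le [IsProbabilityMeasure P] (hT : Ergodic T P) (hm : Measurable φ)
    (hφ : Integrable φ P) {ε : ℝ} (hneg : ∫ w, φ w ∂P < -ε) :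
    ∃ C : Ω → ℝ, Measurable C ∧
      ∀ᵐ w ∂P, ∀ n : ℕ, ∑ k ∈ Finset.range n, φ (T^[k] w) ≤ C w - ε * n := by
  have hTm := hT.toMeasurePreserving.measurable
  have hb := ae_bddAbove_birkhoffMax hT (hm.add_const ε) (hφ.add (integrable_const ε)) (by
    rw [integral_add hφ (integrable_const ε), integral_const, probReal_univ, one_smul]
    linarith)
  refine ⟨fun w => ⨆ n, birkhoffMax T (fun w => φ w + ε) n w,
    Measurable.iSup fun n => measurable_birkhoffMax hTm (hm.add_const ε) n, ?_⟩
  filter_upwards [hb] with w hw n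
  have h1 := (sum_le_birkhoffMax T (fun w => φ w + ε) n w).trans (le_ciSup hw n)
  rw [Finset.sum_add_distrib, Finset.sum_const, Finset.card_range, nsmul_eq_mul] at h1
  linarith

/-- A stationary sequence which contracts up to an integrable error is integrable. -/
theorem lintegral_le_of_contraction [IsFiniteMeasure P] (hT : MeasurePreserving T P P)
    {u ξ : Ω → ℝ≥0∞} (hu : Measurable u) (hfin : ∀ w, u w < ⊤) {ρ σ : ℝ≥0∞}
    (hρ : ρ + σ = 1) (h : ∀ᵐ w ∂P, u (T w) ≤ ρ * u w + ξ w) :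
    σ * ∫⁻ w, u w ∂P ≤ ∫⁻ w, ξ w ∂P := by
  -- The integral of `u` may be infinite a priori, so it cannot be cancelled directly. Truncation at
  -- `n` leaves the finite integral of `min (ρ u) n` on both sides.
  have key : ∀ n : ℕ, ∫⁻ w, σ * ({w | u w ≤ n}.indicator u w) ∂P ≤ ∫⁻ w, ξ w ∂P := by
    intro n
    have hmin : Measurable fun w => min (ρ * u w) (n : ℝ≥0∞) := (hu.const_mul ρ).min measurable_const
    have hne : ∫⁻ w, min (ρ * u w) (n : ℝ≥0∞) ∂P ≠ ⊤ := by
      refine ne_top_of_le_ne_top ?_ (lintegral_mono fun w => min_le_right _ _)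
      rw [lintegral_const]
      exact ENNReal.mul_ne_top (ENNReal.natCast_ne_top n) (measure_ne_top _ _)
    have h1 : ∫⁻ w, min (u w) (n : ℝ≥0∞) ∂P
        ≤ ∫⁻ w, min (ρ * u w) (n : ℝ≥0∞) ∂P + ∫⁻ w, ξ w ∂P := by
      rw [← hT.lintegral_comp (hu.min measurable_const), ← lintegral_add_left hmin]
      refine lintegral_mono_ae ?_
      filter_upwards [h] with w hw
      rcases le_total (ρ * u w) n with e | e
      · rw [min_eq_left e]
        exact (min_le_left _ _).trans hw
      · rw [min_eq_right e]
        exact (min_le_right _ _).trans le_self_add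
    have h2 : ∫⁻ w, min (ρ * u w) (n : ℝ≥0∞) ∂P + ∫⁻ w, σ * ({w | u w ≤ n}.indicator u w) ∂P
        ≤ ∫⁻ w, min (u w) (n : ℝ≥0∞) ∂P := by
      rw [← lintegral_add_left hmin]
      refine lintegral_mono fun w => ?_
      by_cases e : u w ≤ n
      · rw [indicator_of_mem (by exact e), min_eq_left e]
        refine (add_le_add (min_le_left _ _) le_rfl).trans ?_
        rw [← add_mul, hρ, one_mul]
      · rw [indicator_of_notMem (by exact e), mul_zero, add_zero]
        refine le_min ((min_le_left _ _).trans ?_) (min_le_right _ _)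
        exact mul_le_of_le_one_left (zero_le) (hρ ▸ le_self_add)
    exact (ENNReal.add_le_add_iff_left hne).1 (h2.trans h1)
  have hind : ∀ n : ℕ, Measurable fun w => {w | u w ≤ n}.indicator u w := fun n =>
    hu.indicator (measurableSet_le hu measurable_const)
  have hsup : ∀ w, ⨆ n : ℕ, {w | u w ≤ n}.indicator u w = u w := by
    intro w
    refine le_antisymm (iSup_le fun n => indicator_le_self' (fun _ _ => zero_le) w) ?_
    obtain ⟨n, hn⟩ := ENNReal.exists_nat_gt (hfin w).ne
    refine le_iSup_of_le n ?_
    rw [indicator_of_mem (by exact hn.le)]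
  have hmono : Monotone fun (n : ℕ) w => {w | u w ≤ n}.indicator u w := by
    intro n n' hn w
    refine indicator_le_indicator_of_subset (fun w (hw : u w ≤ n) => ?_) (fun _ => zero_le) w
    exact hw.trans (by exact_mod_cast hn)
  calc σ * ∫⁻ w, u w ∂P = σ * ⨆ n : ℕ, ∫⁻ w, {w | u w ≤ n}.indicator u w ∂P := by
        rw [← lintegral_iSup hind hmono]
        simp only [hsup]
    _ = ⨆ n : ℕ, ∫⁻ w, σ * ({w | u w ≤ n}.indicator u w) ∂P := by
        rw [ENNReal.mul_iSup]
        exact iSup_congr fun n => (lintegral_const_mul _ (hind n)).symm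
    _ ≤ _ := iSup_le key

end Ergodic

/-! ### Chains of blocks -/

/-- A sequence which grows at a controlled rate over blocks of at most `N` steps, with a cost for
each block, grows at that rate plus the average cost per step. -/
theorem block_chain {N : ℕ} (hN : 1 ≤ N) {v lam Ψ : ℕ → ℝ} (hv : ∀ k, 0 ≤ v k)
    (hΨ : ∀ k, 0 ≤ Ψ k) {n : ℕ}
    (block : ∀ i j, i ≤ j → j ≤ n → j ≤ i + N →
      v j ≤ v i * Real.exp (∑ k ∈ Finset.Ico i j, lam k + Ψ i)) :
    v n ≤ v 0 * Real.exp (Ψ 0 + ∑ k ∈ Finset.range n, (lam k + Ψ k / N)) := by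
  -- After an initial block from 0, blocks start exactly at indices congruent to `i` modulo `N`.
  -- Leaving the residue free avoids any appeal to ergodicity of the `N`-fold shift.
  have phase : ∀ i < N, ∀ j ≤ n, v j ≤ v 0 * Real.exp (∑ k ∈ Finset.range j, lam k + Ψ 0
      + ∑ k ∈ Finset.range j with k % N = i, Ψ k) := by
    intro i hi j
    induction j using Nat.strong_induction_on with
    | _ j ih =>
    intro hj
    rcases le_or_gt j N with hjN | hjN
    · refine (block 0 j (Nat.zero_le _) hj (by omega)).trans ?_
      refine mul_le_mul_of_nonneg_left (Real.exp_le_exp.2 ?_) (hv 0)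
      rw [Nat.Ico_zero_eq_range]
      exact le_add_of_nonneg_right (Finset.sum_nonneg fun k _ => hΨ k)
    · obtain ⟨s, hs1, hs2, hs3⟩ : ∃ s, s % N = i ∧ s < j ∧ j ≤ s + N := by
        have e := Nat.div_add_mod (j - 1 - i) N
        have e' := Nat.mod_lt (j - 1 - i) hN
        refine ⟨i + N * ((j - 1 - i) / N), ?_, by omega, by omega⟩
        rw [Nat.add_mul_mod_self_left, Nat.mod_eq_of_lt hi]
      refine (block s j hs2.le hj hs3).trans ?_
      refine (mul_le_mul_of_nonneg_right (ih s hs2 (by omega)) (Real.exp_pos _).le).trans ?_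
      rw [mul_assoc, ← Real.exp_add]
      refine mul_le_mul_of_nonneg_left (Real.exp_le_exp.2 ?_) (hv 0)
      rw [← Finset.sum_range_add_sum_Ico lam hs2.le]
      have hsub : insert s {k ∈ Finset.range s | k % N = i} ⊆ {k ∈ Finset.range j | k % N = i} := by
        intro k hk
        simp only [Finset.mem_insert, Finset.mem_filter, Finset.mem_range] at hk ⊢
        rcases hk with rfl | hk
        · exact ⟨hs2, hs1⟩
        · exact ⟨hk.1.trans hs2, hk.2⟩
      have := Finset.sum_le_sum_of_subset_of_nonneg hsub fun k _ _ => hΨ k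
      rw [Finset.sum_insert (by simp)] at this
      linarith
  have hN0 : (0 : ℝ) < N := by exact_mod_cast hN
  have hfib : ∑ i ∈ Finset.range N, ∑ k ∈ Finset.range n with k % N = i, Ψ k
      = ∑ k ∈ Finset.range n, Ψ k :=
    Finset.sum_fiberwise_of_maps_to (fun k _ => Finset.mem_range.2 (Nat.mod_lt _ hN)) _
  -- Some residue costs no more than the average over all residues.
  obtain ⟨i, hi, hle⟩ := Finset.exists_le_of_sum_le (s := Finset.range N)
    (f := fun i => ∑ k ∈ Finset.range n with k % N = i, Ψ k)
    (g := fun _ => (∑ k ∈ Finset.range n, Ψ k) / N) ⟨0, Finset.mem_range.2 hN⟩ (by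
      rw [hfib, Finset.sum_const, Finset.card_range, nsmul_eq_mul, mul_div_cancel₀ _ hN0.ne'])
  refine (phase i (Finset.mem_range.1 hi) n le_rfl).trans ?_
  refine mul_le_mul_of_nonneg_left (Real.exp_le_exp.2 ?_) (hv 0)
  rw [Finset.sum_add_distrib, ← Finset.sum_div]
  linarith

/-- If the rates have negative averages, then a sequence which starts small enough remains in the
region where the block estimate holds, and decays exponentially. -/
theorem block_chain_bootstrap {N : ℕ} (hN : 1 ≤ N) {v lam Ψ : ℕ → ℝ} (hv : ∀ k, 0 ≤ v k)
    (hΨ : ∀ k, 0 ≤ Ψ k) {r C ε : ℝ} (hε : 0 ≤ ε)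
    (block : ∀ i j, i ≤ j → j ≤ i + N → (∀ k < j, v k ≤ r) →
      v j ≤ v i * Real.exp (∑ k ∈ Finset.Ico i j, lam k + Ψ i))
    (havg : ∀ n : ℕ, ∑ k ∈ Finset.range n, (lam k + Ψ k / N) ≤ C - ε * n)
    (h0 : v 0 * Real.exp (Ψ 0 + C) ≤ r) (n : ℕ) :
    v n ≤ v 0 * Real.exp (Ψ 0 + C - ε * n) := by
  have hr : ∀ n : ℕ, v 0 * Real.exp (Ψ 0 + C - ε * n) ≤ r := by
    intro n
    refine le_trans (mul_le_mul_of_nonneg_left (Real.exp_le_exp.2 ?_) (hv 0)) h0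
    have : 0 ≤ ε * n := by positivity
    linarith
  induction n using Nat.strong_induction_on with
  | _ n ih =>
  refine (block_chain hN hv hΨ (n := n) fun i j hij hj hjN => block i j hij hjN fun k hk =>
    (ih k (by omega)).trans (hr k)).trans ?_
  refine mul_le_mul_of_nonneg_left (Real.exp_le_exp.2 ?_) (hv 0)
  linarith [havg n]

end RoughEuler

end

noncomputable section

namespace RoughEuler

set_option maxSynthPendingDepth 3

/-! ### The local one-sided Lipschitz constant -/

theorem DriftRegular.norm_fderiv_le {d : ℕ} {f : E d → E d} (hf : DriftRegular f) (a : E d) :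
    ‖fderiv ℝ f a‖ ≤ Lf f := le_ciSup hf.2 a

theorem DriftRegular.lip {d : ℕ} {f : E d → E d} (hf : DriftRegular f) (a b : E d) :
    ‖f a - f b‖ ≤ Lf f * ‖a - b‖ :=
  norm_sub_le_of_fderiv_le (hf.1.differentiable one_ne_zero) hf.norm_fderiv_le b a

section Ellr

variable {d : ℕ} {f : E d → E d} {L : ℝ}

theorem abs_quotient_le (hf : ∀ a b, ‖f a - f b‖ ≤ L * ‖a - b‖) (hL : 0 ≤ L) (y z : E d) :
    |inner ℝ (y - z) (f y - f z) / ‖y - z‖ ^ 2| ≤ L := by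
  rcases eq_or_ne ‖y - z‖ 0 with e | e
  · rw [e]; simpa using hL
  · have h0 : 0 < ‖y - z‖ := lt_of_le_of_ne (norm_nonneg _) e.symm
    rw [abs_div, abs_of_pos (pow_pos h0 2), div_le_iff₀ (pow_pos h0 2)]
    calc |inner ℝ (y - z) (f y - f z)| ≤ ‖y - z‖ * ‖f y - f z‖ := abs_real_inner_le_norm _ _
      _ ≤ ‖y - z‖ * (L * ‖y - z‖) := by gcongr; exact hf y z
      _ = _ := by ring

theorem bddAbove_quotients (hf : ∀ a b, ‖f a - f b‖ ≤ L * ‖a - b‖) (hL : 0 ≤ L) (z : E d) (r : ℝ) :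
    BddAbove {c | ∃ y, 0 < ‖y - z‖ ∧ ‖y - z‖ < r ∧
      c = inner ℝ (y - z) (f y - f z) / ‖y - z‖ ^ 2} := by
  refine ⟨L, ?_⟩
  rintro c ⟨y, _, _, rfl⟩
  exact (abs_le.1 (abs_quotient_le hf hL y z)).2

theorem inner_le_ellr (hf : ∀ a b, ‖f a - f b‖ ≤ L * ‖a - b‖) (hL : 0 ≤ L) {y z : E d} {r : ℝ}
    (h : ‖y - z‖ < r) : inner ℝ (y - z) (f y - f z) ≤ ellr f z r * ‖y - z‖ ^ 2 := by
  rcases (norm_nonneg (y - z)).eq_or_lt with e | e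
  · have : y - z = 0 := norm_eq_zero.1 e.symm
    rw [this]; simp
  · rw [← div_le_iff₀ (pow_pos e 2)]
    exact le_csSup (bddAbove_quotients hf hL z r) ⟨y, e, h, rfl⟩

theorem abs_ellr_le (hf : ∀ a b, ‖f a - f b‖ ≤ L * ‖a - b‖) (hL : 0 ≤ L) (z : E d) (r : ℝ) :
    |ellr f z r| ≤ L := by
  unfold ellr
  rcases Set.eq_empty_or_nonempty {c | ∃ y, 0 < ‖y - z‖ ∧ ‖y - z‖ < r ∧
      c = inner ℝ (y - z) (f y - f z) / ‖y - z‖ ^ 2} with e | ⟨c, hc⟩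
  · rw [e, Real.sSup_empty]; simpa using hL
  · have h1 := le_csSup (bddAbove_quotients hf hL z r) hc
    have h2 : sSup {c | ∃ y, 0 < ‖y - z‖ ∧ ‖y - z‖ < r ∧
        c = inner ℝ (y - z) (f y - f z) / ‖y - z‖ ^ 2} ≤ L := by
      refine csSup_le ⟨c, hc⟩ ?_
      rintro c ⟨y, _, _, rfl⟩
      exact (abs_le.1 (abs_quotient_le hf hL y z)).2
    obtain ⟨y, _, _, rfl⟩ := hc
    exact abs_le.2 ⟨(abs_le.1 (abs_quotient_le hf hL y z)).1.trans h1, h2⟩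

theorem ellr_eq_iSup (z : E d) (r : ℝ) :
    ellr f z r = ⨆ h : {h : E d // 0 < ‖h‖ ∧ ‖h‖ < r},
      inner ℝ (h : E d) (f (z + h) - f z) / ‖(h : E d)‖ ^ 2 := by
  unfold ellr
  rw [iSup]
  congr 1
  ext c
  constructor
  · rintro ⟨y, h1, h2, rfl⟩
    exact ⟨⟨y - z, h1, h2⟩, by simp⟩
  · rintro ⟨⟨h, h1, h2⟩, rfl⟩
    exact ⟨z + h, by simpa using h1, by simpa using h2, by simp⟩

/-- Written with displacements from `z`, the supremum runs over an index set independent of `z`; a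
supremum of continuous functions is lower semicontinuous. -/
theorem measurable_ellr (hf : ∀ a b, ‖f a - f b‖ ≤ L * ‖a - b‖) (hL : 0 ≤ L) (r : ℝ) :
    Measurable fun z => ellr f z r := by
  have hc : Continuous f := (LipschitzWith.of_dist_le_mul (K := ⟨L, hL⟩) fun a b => by
    rw [dist_eq_norm, dist_eq_norm]
    exact hf a b).continuous
  simp only [ellr_eq_iSup]
  refine LowerSemicontinuous.measurable (lowerSemicontinuous_ciSup (fun z => ⟨L, ?_⟩) fun h => ?_)
  · rintro _ ⟨h, rfl⟩
    have := (abs_le.1 (abs_quotient_le hf hL (z + h) z)).2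
    simpa using this
  · refine Continuous.lowerSemicontinuous ?_
    fun_prop

theorem tendsto_ellr (hf : ∀ a b, ‖f a - f b‖ ≤ L * ‖a - b‖) (hL : 0 ≤ L) (z : E d) :
    Tendsto (ellr f z) (𝓝[>] 0) (𝓝 (ell f z)) := by
  have hmono : MonotoneOn (ellr f z) (Ioi 0) := by
    intro r hr r' _ hrr
    -- In dimension 0 there are no quotients and the supremum takes the default value 0. Otherwise a
    -- point at distance `r / 2` makes the set nonempty, as the comparison of suprema requires.
    rcases subsingleton_or_nontrivial (E d) with hs | hs
    · have e : ∀ r, ellr f z r = 0 := fun r => by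
        rw [ellr_eq_iSup]
        have : IsEmpty {h : E d // 0 < ‖h‖ ∧ ‖h‖ < r} :=
          ⟨fun h => by have := h.2.1; rw [Subsingleton.elim (h : E d) 0] at this; simp at this⟩
        exact Real.iSup_of_isEmpty _
      rw [e, e]
    · obtain ⟨h, hh⟩ := exists_norm_eq (E d) (half_pos (mem_Ioi.1 hr)).le
      refine csSup_le_csSup (bddAbove_quotients hf hL z r') ⟨_, z + h, ?_, ?_, rfl⟩ ?_
      · have := mem_Ioi.1 hr
        simpa [hh] using this
      · have := mem_Ioi.1 hr
        simp [hh, this]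
      · rintro c ⟨y, h1, h2, h3⟩
        exact ⟨y, h1, h2.trans_le hrr, h3⟩
  have hb : BddBelow (ellr f z '' Ioi 0) := by
    refine ⟨-L, ?_⟩
    rintro _ ⟨r, _, rfl⟩
    exact (abs_le.1 (abs_ellr_le hf hL z r)).1
  exact tendsto_nhds_limUnder ⟨_, hmono.tendsto_nhdsGT hb⟩

theorem tendsto_integral_ellr {Ω : Type*} [MeasurableSpace Ω] {P : Measure Ω}
    [IsProbabilityMeasure P] (hf : ∀ a b, ‖f a - f b‖ ≤ L * ‖a - b‖) (hL : 0 ≤ L) {z : Ω → E d}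
    (hz : Measurable z) : Tendsto (fun r => ∫ w, ellr f (z w) r ∂P) (𝓝[>] 0)
      (𝓝 (∫ w, ell f (z w) ∂P)) := by
  refine tendsto_integral_filter_of_dominated_convergence (fun _ => L) ?_ ?_
    (integrable_const L) ?_
  · exact Eventually.of_forall fun r => ((measurable_ellr hf hL r).comp hz).aestronglyMeasurable
  · exact Eventually.of_forall fun r => Eventually.of_forall fun _ => abs_ellr_le hf hL _ _
  · exact Eventually.of_forall fun w => tendsto_ellr hf hL (z w)

theorem integrable_ellr {Ω : Type*} [MeasurableSpace Ω] {P : Measure Ω}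
    [IsProbabilityMeasure P] (hf : ∀ a b, ‖f a - f b‖ ≤ L * ‖a - b‖) (hL : 0 ≤ L) {z : Ω → E d}
    (hz : Measurable z) (r : ℝ) : Integrable (fun w => ellr f (z w) r) P :=
  Integrable.of_bound ((measurable_ellr hf hL r).comp hz).aestronglyMeasurable L
    (Eventually.of_forall fun _ => abs_ellr_le hf hL _ _)

end Ellr

/-! ### Shifts of the scheme -/

section Shift

variable {d m : ℕ} {a : ℝ} {f : E d → E d} {g : E d → (E m →L[ℝ] E d)} {Δ : ℝ}

theorem shift_shift (s t : ℝ) (w : PathSpace m a) : shift s (shift t w) = shift (t + s) w := by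
  apply Subtype.ext
  funext u
  simp [shift, mul_assoc, add_assoc]

theorem shift_zero (w : PathSpace m a) : shift 0 w = w := by
  apply Subtype.ext
  funext u
  simp [shift, w.2.1]

theorem iterate_shift (Δ : ℝ) (k : ℕ) (w : PathSpace m a) :
    (shift Δ)^[k] w = shift (k * Δ) w := by
  induction k with
  | zero => simp [shift_zero]
  | succ k ih =>
    rw [Function.iterate_succ_apply', ih, shift_shift]
    congr 1
    push_cast
    ring

theorem inc_shift_val (t r s : ℝ) (w : PathSpace m a) :
    inc (shift t w).1 r s = inc w.1 (t + r) (t + s) := inc_shift w.1 t r s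

theorem gridX_shift (Δ : ℝ) (w : PathSpace m a) (i j k : ℕ) :
    gridX Δ (shift (i * Δ) w) j k = gridX Δ w (i + j) (i + k) := by
  unfold gridX
  rw [inc_shift_val]
  push_cast
  ring_nf

theorem gridXX_shift (Δ : ℝ) (w : PathSpace m a) (i j k : ℕ) :
    gridXX Δ (shift (i * Δ) w) j k = gridXX Δ w (i + j) (i + k) := by
  unfold gridXX
  rw [inc_shift_val]
  push_cast
  ring_nf

/-- The recursion of the scheme along the whole grid. -/
def SolvesScheme (f : E d → E d) (g : E d → (E m →L[ℝ] E d)) (Δ : ℝ) (w : PathSpace m a)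
    (y : ℕ → E d) : Prop :=
  ∀ k, y (k + 1) = y k + Δ • f (y k) + g (y k) (gridX Δ w k (k + 1))
    + contract (gridXX Δ w k (k + 1)) (secondCoef g (y k))

theorem solvesScheme_eulerSol (f : E d → E d) (g : E d → (E m →L[ℝ] E d)) (Δ : ℝ)
    (w : PathSpace m a) (y₀ : E d) : SolvesScheme f g Δ w (eulerSol f g Δ w y₀) := by
  intro k
  rw [eulerSol, eulerStep_eq]
  unfold gridX gridXX
  push_cast
  rfl

theorem SolvesScheme.shift {w : PathSpace m a} {y : ℕ → E d} (h : SolvesScheme f g Δ w y)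
    (i : ℕ) : SolvesScheme f g Δ (shift (i * Δ) w) fun k => y (i + k) := by
  intro k
  rw [gridX_shift, gridXX_shift]
  exact h (i + k)

theorem IsStationarySol.ae_solvesScheme {P : Measure (PathSpace m a)} {z : PathSpace m a → E d}
    (h : IsStationarySol P f g Δ z) :
    ∀ᵐ w ∂P, SolvesScheme f g Δ w fun k => z (RoughEuler.shift (k * Δ) w) := by
  filter_upwards [h.2] with w hw
  have e : (fun k : ℕ => z (RoughEuler.shift (k * Δ) w)) = eulerSol f g Δ w (z w) := funext hw
  rw [e]
  exact solvesScheme_eulerSol f g Δ w (z w)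

theorem SolvesScheme.isSchemeSol {G l L : ℝ} {w : PathSpace m a} {y : ℕ → E d}
    (h : SolvesScheme f g Δ w y) (ha : 1 / 3 < a) (ha' : a ≤ 1 / 2) (hg : CoefBound g G l)
    (hf : ∀ a b, ‖f a - f b‖ ≤ L * ‖a - b‖) (hL : 0 ≤ L) (hΔ : 0 < Δ) {N : ℕ} (hN : Δ * N ≤ 1) :
    IsSchemeSol a G l L f g Δ (gridX Δ w) (gridXX Δ w) (gridControl Δ w) y N where
  lo := ha
  hi := ha'
  coef := hg
  rough := roughData_grid (by linarith) Δ w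
  lip := hf
  L_nonneg := hL
  mesh_pos := hΔ
  length := hN
  step k _ := h k

end Shift

end RoughEuler

end

noncomputable section

namespace RoughEuler

set_option maxSynthPendingDepth 3

/-! ### Exponential stability from block estimates -/

section Stability

variable {d m : ℕ} {a : ℝ} {f : E d → E d} {g : E d → (E m →L[ℝ] E d)} {Δ L κ : ℝ} {N : ℕ}
  {z : PathSpace m a → E d} {Ψ : PathSpace m a → ℝ} {P : Measure (PathSpace m a)}

/-- The difference of a solution and the stationary one over at most `N` steps grows at the rate
given by the one-sided Lipschitz constants, up to the cost `Ψ` for the noise. -/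
def HasBlockCost (f : E d → E d) (g : E d → (E m →L[ℝ] E d)) (Δ L κ : ℝ) (N : ℕ)
    (z : PathSpace m a → E d) (Ψ : PathSpace m a → ℝ) : Prop :=
  ∀ (w : PathSpace m a) (y : ℕ → E d) (r : ℝ) (e : ℕ → ℝ) (n : ℕ),
    SolvesScheme f g Δ w (fun k => z (shift (k * Δ) w)) → SolvesScheme f g Δ w y →
    0 ≤ r → (∀ k, |e k| ≤ L) → n ≤ N →
    (∀ k < n, ‖y k - z (shift (k * Δ) w)‖ ≤ r) →
    (∀ k < n, inner ℝ (y k - z (shift (k * Δ) w)) (f (y k) - f (z (shift (k * Δ) w)))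
      ≤ e k * ‖y k - z (shift (k * Δ) w)‖ ^ 2) →
    ‖y n - z (shift (n * Δ) w)‖ ≤ ‖y 0 - z w‖ * Real.exp (∑ k ∈ Finset.range n,
      (Δ * e k + L ^ 2 * Δ ^ 2 / 2
        + κ * r * (‖gridX Δ w k (k + 1)‖ + ‖gridXX Δ w k (k + 1)‖)) + Ψ w)

/-- The growth rate of a difference of size at most `r` in one step. -/
def stepRate (f : E d → E d) (Δ L κ : ℝ) (z : PathSpace m a → E d) (r : ℝ) (w : PathSpace m a) :
    ℝ :=
  Δ * ellr f (z w) r + L ^ 2 * Δ ^ 2 / 2 + κ * r * (‖gridX Δ w 0 1‖ + ‖gridXX Δ w 0 1‖)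

theorem shift_grid (Δ : ℝ) (i k : ℕ) (w : PathSpace m a) :
    shift (k * Δ) (shift (i * Δ) w) = shift ((i + k : ℕ) * Δ) w := by
  rw [shift_shift]
  congr 1
  push_cast
  ring

/-- Differences of size at most `r` lie in the open ball of radius `r'` that defines `ellr`, hence
the strict inequality. -/
theorem HasBlockCost.block (h : HasBlockCost f g Δ L κ N z Ψ)
    (hf : ∀ a b, ‖f a - f b‖ ≤ L * ‖a - b‖) (hL : 0 ≤ L) {w : PathSpace m a}
    (hw : SolvesScheme f g Δ w (fun k => z (shift (k * Δ) w))) {y : ℕ → E d}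
    (hy : SolvesScheme f g Δ w y) {r r' : ℝ} (hr : 0 ≤ r) (hrr : r < r') (hκ : 0 ≤ κ) {i j : ℕ}
    (hij : i ≤ j) (hj : j ≤ i + N) (hclose : ∀ k < j, ‖y k - z (shift (k * Δ) w)‖ ≤ r) :
    ‖y j - z (shift (j * Δ) w)‖ ≤ ‖y i - z (shift (i * Δ) w)‖
      * Real.exp (∑ k ∈ Finset.Ico i j, stepRate f Δ L κ z r' (shift (k * Δ) w)
        + Ψ (shift (i * Δ) w)) := by
  obtain ⟨n, rfl⟩ := Nat.exists_eq_add_of_le hij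
  have key := h (shift (i * Δ) w) (fun k => y (i + k)) r
    (fun k => ellr f (z (shift ((i + k : ℕ) * Δ) w)) r') n
    (by simpa only [shift_grid] using hw.shift i) (hy.shift i) hr
    (fun k => abs_ellr_le hf hL _ _) (by omega)
    (fun k hk => by rw [shift_grid]; exact hclose (i + k) (by omega))
    (fun k hk => by
      rw [shift_grid]
      exact inner_le_ellr hf hL ((hclose (i + k) (by omega)).trans_lt hrr))
  rw [shift_grid] at key
  refine key.trans ?_
  rw [add_zero]
  refine mul_le_mul_of_nonneg_left (Real.exp_le_exp.2 (add_le_add ?_ le_rfl)) (norm_nonneg _)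
  rw [Finset.sum_Ico_eq_sum_range, Nat.add_sub_cancel_left]
  refine Finset.sum_le_sum fun k _ => ?_
  unfold stepRate
  rw [gridX_shift, gridXX_shift, gridX_shift, gridXX_shift]
  simp only [add_zero, ← add_assoc]
  gcongr

theorem measurable_stepRate (hf : ∀ a b, ‖f a - f b‖ ≤ L * ‖a - b‖) (hL : 0 ≤ L)
    (hz : Measurable z) (r : ℝ) : Measurable (stepRate f Δ L κ z r) := by
  have h1 : Measurable fun w => ellr f (z w) r := (measurable_ellr hf hL r).comp hz
  have h2 : Measurable fun w : PathSpace m a => ‖gridX Δ w 0 1‖ := (measurable_inc_lvl1 _ _).norm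
  have h3 : Measurable fun w : PathSpace m a => ‖gridXX Δ w 0 1‖ := (measurable_inc_lvl2 _ _).norm
  exact ((h1.const_mul Δ).add_const _).add ((h2.add h3).const_mul _)

theorem isExpStable_of_decay (hΔ : 0 < Δ) {B : PathSpace m a → ℝ}
    (hB : Measurable B) {r ε : ℝ} (hr : 0 < r) (hε : 0 < ε)
    (h : ∀ᵐ w ∂P, ∀ y₀ : E d, ‖y₀ - z w‖ * Real.exp (B w) ≤ r → ∀ n : ℕ,
      ‖eulerSol f g Δ w y₀ n - z (shift (n * Δ) w)‖ ≤ ‖y₀ - z w‖ * Real.exp (B w - ε * n)) :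
    IsExpStable P f g Δ z := by
  have hmeas : ∀ c : ℝ, Measurable fun w => c * Real.exp (-B w) := fun c =>
    (Real.measurable_exp.comp hB.neg).const_mul c
  have hsmall : ∀ (c : ℝ) (w : PathSpace m a) (y₀ : E d), ‖y₀ - z w‖ < c * Real.exp (-B w) →
      ‖y₀ - z w‖ * Real.exp (B w) ≤ c := by
    intro c w y₀ h
    calc ‖y₀ - z w‖ * Real.exp (B w) ≤ c * Real.exp (-B w) * Real.exp (B w) := by gcongr
      _ = c := by rw [mul_assoc, ← Real.exp_add, neg_add_cancel, Real.exp_zero, mul_one]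
  have hdec : ∀ (c : ℝ) (w : PathSpace m a) (v : ℝ), v * Real.exp (B w) ≤ c → ∀ n : ℕ,
      v * Real.exp (B w - ε * n) ≤ c * Real.exp (-(ε * n)) := by
    intro c w v h n
    rw [sub_eq_add_neg, Real.exp_add, ← mul_assoc]
    gcongr
  -- Half of `ε'` keeps the supremum over time strictly below `ε'`. A decay of `ε` per step is a
  -- rate `ε / Δ` in time.
  refine ⟨fun ε' hε' => ⟨fun w => min r (ε' / 2) * Real.exp (-B w), hmeas _,
    fun w => by positivity, ?_⟩, fun w => r * Real.exp (-B w), fun _ => r, hmeas r,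
    measurable_const, fun w => by positivity, fun _ => hr, ε / Δ, by positivity, ?_⟩
  · filter_upwards [h] with w hw y₀ hy
    have h1 := hsmall _ w y₀ hy
    have h2 := hw y₀ (h1.trans (min_le_left _ _))
    refine lt_of_le_of_lt (iSup_le fun k => ?_)
      ((ENNReal.ofReal_lt_ofReal_iff hε').2 (half_lt_self hε'))
    rw [← ofReal_norm]
    refine ENNReal.ofReal_le_ofReal ((h2 k).trans ((hdec _ w _ h1 k).trans ?_))
    have h3 : Real.exp (-(ε * k)) ≤ 1 := Real.exp_le_one_iff.2 (by
      have : 0 ≤ ε * k := by positivity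
      linarith)
    calc min r (ε' / 2) * Real.exp (-(ε * k)) ≤ min r (ε' / 2) * 1 := by gcongr
      _ ≤ ε' / 2 := by rw [mul_one]; exact min_le_right _ _
  · filter_upwards [h] with w hw y₀ hy k
    have h1 := hsmall _ w y₀ hy
    refine (hw y₀ h1 k).trans ((hdec _ w _ h1 k).trans (le_of_eq ?_))
    rw [show -(ε / Δ) * (k * Δ) = -(ε * k) by field_simp]

/-- As `r` tends to 0, the mean of the step rate plus `Ψ / N` tends to `-Δ η` plus the mean of `Ψ /
N`, which is negative by assumption. A fixed small `r` therefore suffices for the ergodic bound and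
the bootstrap. -/
theorem isExpStable_of_blockCost [IsProbabilityMeasure P] (hT : Ergodic (shift Δ) P)
    (hz : IsStationarySol P f g Δ z) (hf : DriftRegular f) (hΔ : 0 < Δ)
    (hx : Integrable (fun w => ‖gridX Δ w 0 1‖ + ‖gridXX Δ w 0 1‖) P) (hN : 1 ≤ N) (hκ : 0 ≤ κ)
    (hblock : HasBlockCost f g Δ (Lf f) κ N z Ψ) (hΨm : Measurable Ψ) (hΨ0 : ∀ w, 0 ≤ Ψ w)
    (hΨ : Integrable Ψ P) (hneg : ∫ w, Ψ w ∂P < N * (Δ * eta P f Δ z)) :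
    IsExpStable P f g Δ z := by
  have hlip := hf.lip
  have hL := Lf_nonneg f
  have hN0 : (0 : ℝ) < N := by exact_mod_cast hN
  set c := ∫ w, (‖gridX Δ w 0 1‖ + ‖gridXX Δ w 0 1‖) ∂P with hc
  -- Half of the gap: the limiting mean is `-2 ε`, so for small `r` the mean is still below `-ε`.
  set ε := (Δ * eta P f Δ z - (∫ w, Ψ w ∂P) / N) / 2 with hε
  have hε0 : 0 < ε := by
    have : (∫ w, Ψ w ∂P) / N < Δ * eta P f Δ z := by
      rw [div_lt_iff₀ hN0]; linarith
    rw [hε]; linarith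
  have hint : ∀ r, Integrable (stepRate f Δ (Lf f) κ z r) P := fun r =>
    (((integrable_ellr hlip hL hz.1 r).const_mul Δ).add (integrable_const _)).add
      (hx.const_mul (κ * r))
  have hmean : ∀ r, ∫ w, (stepRate f Δ (Lf f) κ z r w + Ψ w / N) ∂P
      = Δ * ∫ w, ellr f (z w) r ∂P + Lf f ^ 2 * Δ ^ 2 / 2 + κ * r * c + (∫ w, Ψ w ∂P) / N := by
    intro r
    rw [integral_add (hint r) (hΨ.div_const _), integral_div]
    congr 1
    unfold stepRate
    have hI : Integrable (fun w => Δ * ellr f (z w) r + Lf f ^ 2 * Δ ^ 2 / 2) P :=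
      ((integrable_ellr hlip hL hz.1 r).const_mul Δ).add (integrable_const _)
    rw [integral_add hI (hx.const_mul (κ * r)), integral_add ((integrable_ellr hlip hL hz.1 r).const_mul Δ)
      (integrable_const _), integral_const_mul, integral_const_mul, integral_const,
      probReal_univ, one_smul]
  have hlim : Tendsto (fun r => ∫ w, (stepRate f Δ (Lf f) κ z r w + Ψ w / N) ∂P) (𝓝[>] 0)
      (𝓝 (Δ * ∫ w, ell f (z w) ∂P + Lf f ^ 2 * Δ ^ 2 / 2 + κ * 0 * c + (∫ w, Ψ w ∂P) / N)) := by
    simp only [hmean]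
    refine (((((tendsto_integral_ellr hlip hL hz.1).const_mul Δ).add_const _).add
      (Tendsto.mul_const c (Tendsto.const_mul κ ?_))).add_const _)
    exact tendsto_id.mono_left nhdsWithin_le_nhds
  have hval : Δ * ∫ w, ell f (z w) ∂P + Lf f ^ 2 * Δ ^ 2 / 2 + κ * 0 * c + (∫ w, Ψ w ∂P) / N
      < -ε := by
    have : Δ * ∫ w, ell f (z w) ∂P + Lf f ^ 2 * Δ ^ 2 / 2 = -(Δ * eta P f Δ z) := by
      unfold eta; ring
    rw [this, mul_zero, zero_mul, add_zero]
    have : 2 * ε = Δ * eta P f Δ z - (∫ w, Ψ w ∂P) / N := by rw [hε]; ring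
    linarith
  obtain ⟨r, hr1, hr0⟩ := ((hlim.eventually_lt_const hval).and self_mem_nhdsWithin).exists
  have hr0 : 0 < r := hr0
  obtain ⟨C, hC, hbound⟩ := exists_birkhoff_le (φ := fun w => stepRate f Δ (Lf f) κ z r w + Ψ w / N)
    hT ((measurable_stepRate hlip hL hz.1 r).add (hΨm.div_const _))
    ((hint r).add (hΨ.div_const _)) hr1
  refine isExpStable_of_decay hΔ (B := fun w => Ψ w + C w) (hΨm.add hC) (half_pos hr0) hε0 ?_
  filter_upwards [hbound, hz.ae_solvesScheme] with w hw hsol y₀ hy₀ n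
  have hz0 : z (shift ((0 : ℕ) * Δ) w) = z w := by
    rw [Nat.cast_zero, zero_mul, shift_zero]
  have hΨz : Ψ (shift ((0 : ℕ) * Δ) w) = Ψ w := by
    rw [Nat.cast_zero, zero_mul, shift_zero]
  have hv0 : ‖eulerSol f g Δ w y₀ 0 - z (shift ((0 : ℕ) * Δ) w)‖ = ‖y₀ - z w‖ := by
    rw [hz0, eulerSol]
  have := block_chain_bootstrap hN
    (v := fun k => ‖eulerSol f g Δ w y₀ k - z (shift (k * Δ) w)‖)
    (lam := fun k => stepRate f Δ (Lf f) κ z r (shift (k * Δ) w))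
    (Ψ := fun k => Ψ (shift (k * Δ) w)) (r := r / 2) (C := C w) (ε := ε)
    (fun _ => norm_nonneg _) (fun _ => hΨ0 _) hε0.le
    (fun i j hij hj hk => hblock.block hlip hL hsol (solvesScheme_eulerSol f g Δ w y₀)
      (half_pos hr0).le (half_lt_self hr0) hκ hij hj hk)
    (fun n => by simpa only [iterate_shift] using hw n)
    (by rw [hv0, hΨz]; exact hy₀) n
  rw [hv0, hΨz] at this
  exact this

end Stability

end RoughEuler

end

noncomputable section

namespace RoughEuler

set_option maxSynthPendingDepth 3

/-! ### Bounds in terms of the moment of the rough path -/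

theorem integral_lt_of_lintegral_lt {Ω : Type*} [MeasurableSpace Ω] {P : Measure Ω} {Ψ : Ω → ℝ}
    (hm : Measurable Ψ) (h0 : ∀ w, 0 ≤ Ψ w) {b : ℝ}
    (h : ∫⁻ w, ENNReal.ofReal (Ψ w) ∂P < ENNReal.ofReal b) :
    Integrable Ψ P ∧ ∫ w, Ψ w ∂P < b := by
  refine ⟨⟨hm.aestronglyMeasurable, ?_⟩, ?_⟩
  · rw [hasFiniteIntegral_iff_ofReal (Eventually.of_forall h0)]
    exact h.trans ENNReal.ofReal_lt_top
  · rw [integral_eq_lintegral_of_nonneg_ae (Eventually.of_forall h0) hm.aestronglyMeasurable]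
    exact ENNReal.toReal_lt_of_lt_ofReal h

section Moments

variable {d m : ℕ} {a : ℝ} {P : Measure (PathSpace m a)}

theorem lintegral_one_add_variation_le [IsProbabilityMeasure P] (ha : 0 < a) :
    ∫⁻ w, (1 + (xVarPow w (Icc 0 1) + xxVarPow w (Icc 0 1))) ∂P ≤ 2 * (1 + roughMoment P) := by
  calc ∫⁻ w, (1 + (xVarPow w (Icc 0 1) + xxVarPow w (Icc 0 1))) ∂P
      ≤ ∫⁻ w, (2 + roughVar w (Icc 0 1) ^ (1 / a * (1 / a + 2))) ∂P := by
        refine lintegral_mono fun w => ?_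
        have := add_le_add (le_refl (1 : ℝ≥0∞)) (variation_le_one_add_roughVar ha w)
        rwa [← add_assoc 1 1, one_add_one_eq_two] at this
    _ = 2 + roughMoment P := by
        rw [lintegral_add_left measurable_const, lintegral_const, measure_univ, mul_one]
        rfl
    _ ≤ 2 * (1 + roughMoment P) := by
        rw [mul_add, mul_one, two_mul (roughMoment P)]
        gcongr
        exact le_self_add

theorem lintegral_one_add_gridControl_le [IsProbabilityMeasure P] (ha : 0 < a) {Δ : ℝ}
    (hΔ : 0 ≤ Δ) {N : ℕ} (hN : N * Δ ≤ 1) :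
    ∫⁻ w, ENNReal.ofReal (1 + gridControl Δ w 0 N) ∂P ≤ 2 * (1 + roughMoment P) := by
  refine le_trans (lintegral_mono fun w => ?_) (lintegral_one_add_variation_le ha)
  rw [ENNReal.ofReal_add zero_le_one (gridControl_nonneg Δ w _ _),
    ENNReal.ofReal_one]
  exact add_le_add le_rfl (ofReal_gridControl_le ha hΔ w hN)

/-- Both exponents `1 / a` and `1 / a / 2` are at least 1. This integrability must not come from
`roughMoment`, which the criterion allows to be infinite when `L_g = 0`. -/
theorem MomentBound.integrable_grid [IsProbabilityMeasure P] {ν : ℝ} (h : MomentBound P ν)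
    (ha : 0 < a) (ha' : a ≤ 1 / 2) {Δ : ℝ} (hΔ : 0 ≤ Δ) (hΔ1 : Δ ≤ 1) :
    Integrable (fun w => ‖gridX Δ w 0 1‖ + ‖gridXX Δ w 0 1‖) P := by
  obtain ⟨C, hC⟩ := h 1 one_pos
  have hp : 2 ≤ 1 / a := by rw [le_div_iff₀ ha]; linarith
  have key := hC 0 (left_mem_Icc.2 zero_le_one) Δ ⟨hΔ, hΔ1⟩ hΔ
  have hle : ∀ (v b : ℝ), 0 ≤ v → 1 ≤ b → v ≤ 1 + v ^ b := by
    intro v b hv hb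
    rcases le_total v 1 with e | e
    · have := Real.rpow_nonneg hv b
      linarith
    · have := Real.self_le_rpow_of_one_le e hb
      linarith
  have hcost : Integrable (fun w : PathSpace m a => gridCost Δ w 0 1) P := by
    refine ⟨(measurable_gridCost Δ 0 1).aestronglyMeasurable, ?_⟩
    rw [hasFiniteIntegral_iff_ofReal (Eventually.of_forall fun w => gridCost_nonneg Δ w 0 1)]
    refine lt_of_le_of_lt (le_of_eq ?_) (key.trans_lt ENNReal.ofReal_lt_top)
    refine lintegral_congr fun w => ?_
    rw [gridCost, ENNReal.ofReal_add (by positivity) (by positivity),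
      ← enorm_rpow_eq _ (by positivity), ← enorm_rpow_eq _ (by positivity)]
    unfold gridX gridXX
    rw [Nat.cast_zero, zero_mul, Nat.cast_one, one_mul]
  refine Integrable.mono' ((integrable_const (2 : ℝ)).add hcost)
    ((measurable_inc_lvl1 _ _).norm.add (measurable_inc_lvl2 _ _).norm).aestronglyMeasurable
    (Eventually.of_forall fun w => ?_)
  have h1 := hle _ (1 / a) (norm_nonneg (gridX Δ w 0 1)) (by linarith)
  have h2 := hle _ (1 / a / 2) (norm_nonneg (gridXX Δ w 0 1)) (by linarith)
  rw [Real.norm_of_nonneg (add_nonneg (norm_nonneg _) (norm_nonneg _)), Pi.add_apply, gridCost]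
  linarith

theorem floor_mesh {Δ : ℝ} (hΔ : 0 < Δ) (hΔ1 : Δ ≤ 1) :
    1 ≤ ⌊1 / Δ⌋₊ ∧ Δ * (⌊1 / Δ⌋₊ : ℝ) ≤ 1 ∧ 1 / 2 ≤ Δ * (⌊1 / Δ⌋₊ : ℝ) := by
  have h1 : (1 : ℝ) ≤ 1 / Δ := by rw [le_div_iff₀ hΔ]; linarith
  have h2 : 1 ≤ ⌊1 / Δ⌋₊ := Nat.le_floor (by exact_mod_cast h1)
  have h3 := Nat.floor_le (show 0 ≤ 1 / Δ by positivity)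
  have h4 := Nat.lt_floor_add_one (1 / Δ)
  rw [le_div_iff₀ hΔ] at h3
  rw [div_lt_iff₀ hΔ] at h4
  have h5 : (1 : ℝ) ≤ ⌊1 / Δ⌋₊ := by exact_mod_cast h2
  refine ⟨h2, by linarith, ?_⟩
  nlinarith

/-- For a dissipative drift and a small mesh, the drift along a stationary solution is bounded
over a unit of time by an integrable random variable. -/
theorem exists_drift_bound (d m : ℕ) {α G L F D₁ D₂ : ℝ} (hα : 1 / 3 < α) (hα' : α ≤ 1 / 2)
    (hG : 1 ≤ G) (hL : 0 ≤ L) (hF : 0 ≤ F) (hD1 : 0 < D₁) (hD2 : 0 < D₂) :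
    ∃ A : ℝ, 0 ≤ A ∧ ∀ (f : E d → E d) (g : E d → (E m →L[ℝ] E d)) (Δ : ℝ)
      (P : Measure (PathSpace m α)) [IsProbabilityMeasure P] (z : PathSpace m α → E d),
      DriftRegular f → Lf f = L → ‖f 0‖ = F → Dissipative f D₁ D₂ → C3b g → normC3b g ≤ G →
      0 < Δ → Δ ≤ 1 → Δ * L ^ 2 ≤ D₂ / 2 → Δ * D₂ ≤ 1 → StationaryIncrements P →
      IsStationarySol P f g Δ z →
      ∃ M : PathSpace m α → ℝ, Measurable M ∧ (∀ w, 0 ≤ M w) ∧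
        (∀ w, SolvesScheme f g Δ w (fun k => z (shift (k * Δ) w)) →
          ∀ k ≤ ⌊1 / Δ⌋₊, ‖f (z (shift (k * Δ) w))‖ ≤ M w) ∧
        ∫⁻ w, ENNReal.ofReal (M w) ∂P ≤ ENNReal.ofReal A * (1 + roughMoment P) := by
  have hα0 : 0 < α := by linarith
  obtain ⟨C, ρ, hC, hρ0, hρ1, hblock⟩ := dissipative_block (V := E d) (m := m) hα hG hL hF hD1 hD2
  have hσ : 0 < 1 - ρ := by linarith
  refine ⟨F + 2 * L * (1 / (1 - ρ) * (2 * C)) + L * (2 * C), by positivity, ?_⟩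
  intro f g Δ P _ z hf hLf hF0 hdiss hg hgG hΔ hΔ1 hm1 hm2 hP hz
  obtain ⟨hN, hN1, hN2⟩ := floor_mesh hΔ hΔ1
  generalize ⌊1 / Δ⌋₊ = N at *
  have hlip := hf.lip
  rw [hLf] at hlip
  have hNΔ : (N : ℝ) * Δ ≤ 1 := by linarith
  have hgc := lintegral_one_add_gridControl_le (P := P) hα0 hΔ.le hNΔ
  have hc0 : ∀ w : PathSpace m α, 0 ≤ gridControl Δ w 0 N := fun w =>
    gridControl_nonneg Δ w _ _
  have hcm := measurable_gridControl (m := m) (a := α) Δ 0 N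
  have hz0 : ∀ w, z (shift ((0 : ℕ) * Δ) w) = z w := fun w => by
    rw [Nat.cast_zero, zero_mul, shift_zero]
  have hpath : ∀ w, SolvesScheme f g Δ w (fun k => z (shift (k * Δ) w)) →
      (∀ k, k ≤ N → ‖z (shift (k * Δ) w)‖ ≤ 2 * ‖z w‖ + C * (1 + gridControl Δ w 0 N)) ∧
        ‖z (shift (N * Δ) w)‖ ≤ ρ * ‖z w‖ + C * (1 + gridControl Δ w 0 N) := by
    intro w hw
    have := hblock f g (Lg g) Δ _ _ _ _ N
      (hw.isSchemeSol hα hα' (hg.coefBound hG hgG) hlip hL hΔ hN1) hF0.le hdiss hm1 hm2 hN2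
    simpa only [hz0] using this
  have hzint : ∫⁻ w, ‖z w‖ₑ ∂P
      ≤ ENNReal.ofReal (1 / (1 - ρ) * (2 * C)) * (1 + roughMoment P) := by
    -- Along the shift by a whole block the norm of the stationary solution contracts up to `C (1 +
    -- ϖ)`; invariance of the law is enough here.
    have h1 := lintegral_le_of_contraction (hP (N * Δ)) (u := fun w => ‖z w‖ₑ)
      (ξ := fun w => ENNReal.ofReal C * ENNReal.ofReal (1 + gridControl Δ w 0 N))
      hz.1.enorm (fun w => enorm_lt_top) (ρ := ENNReal.ofReal ρ) (σ := ENNReal.ofReal (1 - ρ))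
      (by rw [← ENNReal.ofReal_add hρ0 hσ.le]; simp) (by
        filter_upwards [hz.ae_solvesScheme] with w hw
        rw [← ofReal_norm, ← ofReal_norm, ← ENNReal.ofReal_mul hρ0, ← ENNReal.ofReal_mul hC,
          ← ENNReal.ofReal_add (by positivity) (mul_nonneg hC (by linarith [hc0 w]))]
        exact ENNReal.ofReal_le_ofReal (hpath w hw).2)
    rw [lintegral_const_mul _ (hcm.const_add 1).ennreal_ofReal] at h1
    calc ∫⁻ w, ‖z w‖ₑ ∂P
        = ENNReal.ofReal (1 / (1 - ρ)) * (ENNReal.ofReal (1 - ρ) * ∫⁻ w, ‖z w‖ₑ ∂P) := by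
          rw [← mul_assoc, ← ENNReal.ofReal_mul (by positivity), one_div_mul_cancel hσ.ne',
            ENNReal.ofReal_one, one_mul]
      _ ≤ ENNReal.ofReal (1 / (1 - ρ)) * (ENNReal.ofReal C * (2 * (1 + roughMoment P))) := by
          refine mul_le_mul_right (h1.trans ?_) _
          gcongr
      _ = _ := by
          rw [ENNReal.ofReal_mul (by positivity), ENNReal.ofReal_mul zero_le_two,
            ENNReal.ofReal_ofNat]
          ring
  refine ⟨fun w => F + (2 * L * ‖z w‖ + L * C * (1 + gridControl Δ w 0 N)),
    ((hz.1.norm.const_mul _).add ((hcm.const_add 1).const_mul _)).const_add F,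
    fun w => ?_, fun w hw k hk => ?_, ?_⟩
  · have := hc0 w
    positivity
  · have h1 := (hpath w hw).1 k hk
    have h2 := hlip (z (shift (k * Δ) w)) 0
    rw [sub_zero] at h2
    have h3 : ‖f (z (shift (k * Δ) w))‖ ≤ ‖f 0‖ + ‖f (z (shift (k * Δ) w)) - f 0‖ := by
      have := norm_add_le (f 0) (f (z (shift (k * Δ) w)) - f 0)
      rwa [add_sub_cancel] at this
    have h4 := mul_le_mul_of_nonneg_left h1 hL
    rw [hF0] at h3
    linarith
  · have e : ∀ w, ENNReal.ofReal (F + (2 * L * ‖z w‖ + L * C * (1 + gridControl Δ w 0 N)))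
        = ENNReal.ofReal F + (ENNReal.ofReal (2 * L) * ‖z w‖ₑ
          + ENNReal.ofReal (L * C) * ENNReal.ofReal (1 + gridControl Δ w 0 N)) := by
      intro w
      have := hc0 w
      rw [ENNReal.ofReal_add hF (by positivity), ENNReal.ofReal_add (by positivity) (by positivity),
        ENNReal.ofReal_mul (p := 2 * L) (by positivity), ofReal_norm,
        ENNReal.ofReal_mul (p := L * C) (by positivity)]
    simp only [e]
    rw [lintegral_add_left measurable_const, lintegral_add_left (hz.1.enorm.const_mul _),
      lintegral_const_mul _ hz.1.enorm, lintegral_const_mul _ (hcm.const_add 1).ennreal_ofReal,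
      lintegral_const, measure_univ, mul_one]
    calc ENNReal.ofReal F + (ENNReal.ofReal (2 * L) * ∫⁻ w, ‖z w‖ₑ ∂P + ENNReal.ofReal (L * C)
          * ∫⁻ w, ENNReal.ofReal (1 + gridControl Δ w 0 N) ∂P)
        ≤ ENNReal.ofReal F * (1 + roughMoment P) + (ENNReal.ofReal (2 * L)
          * (ENNReal.ofReal (1 / (1 - ρ) * (2 * C)) * (1 + roughMoment P))
          + ENNReal.ofReal (L * C) * (2 * (1 + roughMoment P))) := by
          gcongr
          exact le_mul_of_one_le_right zero_le le_self_add
      _ = _ := by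
          rw [show L * (2 * C) = L * C * 2 by ring,
            ENNReal.ofReal_add (p := F + _) (by positivity) (by positivity),
            ENNReal.ofReal_add hF (by positivity),
            ENNReal.ofReal_mul (p := 2 * L) (by positivity),
            ENNReal.ofReal_mul (p := L * C) (by positivity), ENNReal.ofReal_ofNat]
          ring

end Moments

end RoughEuler

end

noncomputable section

namespace RoughEuler

set_option maxSynthPendingDepth 3

/-! ### Block costs of the scheme -/

section Cost

variable {d m : ℕ} {α G l L Δ : ℝ} {f : E d → E d} {g : E d → (E m →L[ℝ] E d)} {N : ℕ}
  {z : PathSpace m α → E d}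

theorem nonlinC_nonneg (m : ℕ) {G : ℝ} (hG : 1 ≤ G) : 0 ≤ nonlinC m G := by
  unfold nonlinC
  positivity

theorem hasBlockCost_of_drift_bound (hα : 1 / 3 < α) (hα' : α ≤ 1 / 2) (hg : CoefBound g G l)
    (hf : ∀ a b, ‖f a - f b‖ ≤ L * ‖a - b‖) (hL : 0 ≤ L) (hΔ : 0 < Δ) (hN : Δ * N ≤ 1)
    {M : PathSpace m α → ℝ} (hM : ∀ w, SolvesScheme f g Δ w (fun k => z (shift (k * Δ) w)) →
      ∀ k ≤ N, ‖f (z (shift (k * Δ) w))‖ ≤ M w) :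
    HasBlockCost f g Δ L (4 * Real.exp L * nonlinC m G) N z
      (fun w => growthC m G L * (2 + 2 / shortC α m G) * l * (1 + gridControl Δ w 0 N + M w)) := by
  intro w y r e n hw hy hr he hn hclose hin
  have hnN : Δ * (n : ℝ) ≤ 1 := by
    have : (n : ℝ) ≤ N := by exact_mod_cast hn
    nlinarith
  have hpair : SchemePair α G l L f g Δ (gridX Δ w) (gridXX Δ w) (gridControl Δ w) y
      (fun k => z (shift (k * Δ) w)) n (M w) r e :=
    { sol := hw.isSchemeSol hα hα' hg hf hL hΔ hnN
      step := fun k _ => hy k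
      drift := fun k hk => hM w hw k (hk.trans hn)
      r_nonneg := hr
      close := hclose
      ell_abs := he
      ell_le := hin }
  have h := hpair.growth
  rw [Nat.cast_zero, zero_mul, shift_zero] at h
  refine h.trans (mul_le_mul_of_nonneg_left (Real.exp_le_exp.2 (add_le_add (le_of_eq ?_) ?_))
    (norm_nonneg _))
  · refine Finset.sum_congr rfl fun k _ => ?_
    ring
  · have h1 := (isControl_chainSup _ (gridCost_nonneg Δ w)).mono (le_refl 0) (Nat.zero_le n) hn
    have h2 := growthC_pos m hg.one_le hL
    have h3 := shortC_pos hα m hg.one_le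
    have h4 := hg.nonneg
    refine mul_le_mul_of_nonneg_left ?_ (by positivity)
    have h5 : gridControl Δ w 0 n ≤ gridControl Δ w 0 N := h1
    linarith

/-- For a coarse mesh the scheme need not inherit dissipativity and no integrable drift bound is
available. Blocks of one step avoid it, since `single_step` does not involve `M`. -/
theorem hasBlockCost_one (hα : 1 / 3 < α) (hα' : α ≤ 1 / 2) (hg : CoefBound g G l)
    (hf : ∀ a b, ‖f a - f b‖ ≤ L * ‖a - b‖) (hL : 0 ≤ L) (hΔ : 0 < Δ) (hΔ1 : Δ ≤ 1) :
    HasBlockCost f g Δ L (4 * Real.exp L * nonlinC m G) 1 z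
      (fun w => growthC m G L * l * (1 + gridControl Δ w 0 1)) := by
  intro w y r e n hw hy hr he hn hclose hin
  have h2 := growthC_pos m hg.one_le hL
  have h4 := hg.nonneg
  have h5 := gridControl_nonneg Δ w 0 1
  have hz0 : z (shift ((0 : ℕ) * Δ) w) = z w := by
    rw [Nat.cast_zero, zero_mul, shift_zero]
  rcases Nat.le_one_iff_eq_zero_or_eq_one.1 hn with rfl | rfl
  · rw [hz0, Finset.range_zero, Finset.sum_empty, zero_add]
    exact le_mul_of_one_le_right (norm_nonneg _) (Real.one_le_exp (by positivity))
  · have hpair : SchemePair α G l L f g Δ (gridX Δ w) (gridXX Δ w) (gridControl Δ w) y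
        (fun k => z (shift (k * Δ) w)) 1
        (‖f (z (shift ((0 : ℕ) * Δ) w))‖ + ‖f (z (shift ((1 : ℕ) * Δ) w))‖) r e :=
      { sol := hw.isSchemeSol hα hα' hg hf hL hΔ (by rw [Nat.cast_one, mul_one]; exact hΔ1)
        step := fun k _ => hy k
        drift := fun k hk => by
          rcases Nat.le_one_iff_eq_zero_or_eq_one.1 hk with rfl | rfl
          · exact le_add_of_nonneg_right (norm_nonneg _)
          · exact le_add_of_nonneg_left (norm_nonneg _)
        r_nonneg := hr
        close := hclose
        ell_abs := he
        ell_le := hin }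
    have h := hpair.single_step one_pos
    rw [hz0, zero_add] at h
    refine h.trans (mul_le_mul_of_nonneg_left (Real.exp_le_exp.2 (le_of_eq ?_)) (norm_nonneg _))
    rw [Finset.sum_range_one, zero_add]
    ring

end Cost

/-! ### The constants of the criterion -/

/-- The mesh below which the scheme inherits the dissipativity of the drift. -/
def meshBound (L D₂ : ℝ) : ℝ := if 0 < D₂ then min (D₂ / (2 * (L ^ 2 + 1))) (1 / D₂) else 1

theorem meshBound_pos (L D₂ : ℝ) : 0 < meshBound L D₂ := by
  unfold meshBound
  split_ifs
  · positivity
  · exact one_pos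

theorem le_of_lt_meshBound {L D₂ Δ : ℝ} (hD : 0 < D₂) (hΔ : 0 < Δ) (h : Δ < meshBound L D₂) :
    Δ * L ^ 2 ≤ D₂ / 2 ∧ Δ * D₂ ≤ 1 := by
  rw [meshBound, if_pos hD, lt_min_iff, lt_div_iff₀ (by positivity), lt_div_iff₀ hD] at h
  exact ⟨by nlinarith [h.1], h.2.le⟩

/-- The constant `C` bounds the expected greedy counts and is admissible in the stability
criterion, for all coefficients with the given bounds. -/
def IsCriterionConst (d m : ℕ) (α Cp L F D₁ D₂ G lam γ C : ℝ) : Prop :=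
  ∀ (f : E d → E d) (g : E d → (E m →L[ℝ] E d)) (Δ ν : ℝ) (P : Measure (PathSpace m α))
    [IsProbabilityMeasure P] (z : PathSpace m α → E d),
    DriftRegular f → Lf f = L → ‖f 0‖ = F → Dissipative f D₁ D₂ → C3b g → normC3b g ≤ G →
    MomentBound P ν → StationaryIncrements P → 0 < Δ → Δ ≤ 1 → Ergodic (shift Δ) P →
    IsStationarySol P f g Δ z →
    (Δ < meshBound L D₂ → (∫⁻ w, Nstar γ w ∂P) + 2 * ∫⁻ w, NstarS Cp lam f g Δ z w ∂P
      ≤ ENNReal.ofReal C * (1 + roughMoment P)) ∧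
    (ENNReal.ofReal (5 * C * Lg g) * (1 + roughMoment P) < ENNReal.ofReal (eta P f Δ z) →
      IsExpStable P f g Δ z)

theorem Nstar_le_mul {m : ℕ} {a γ : ℝ} (ha : 0 < a) (hγ : 0 < γ) (w : PathSpace m a) :
    Nstar γ w ≤ ENNReal.ofReal (2 + 2 * (1 / γ) ^ (1 / a))
      * (1 + (xVarPow w (Icc 0 1) + xxVarPow w (Icc 0 1))) := by
  refine (Nstar_le ha hγ w).trans ?_
  rw [ENNReal.ofReal_add zero_le_two (by positivity), ENNReal.ofReal_mul zero_le_two,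
    ENNReal.ofReal_ofNat]
  generalize xVarPow w (Icc 0 1) + xxVarPow w (Icc 0 1) = v
  generalize ENNReal.ofReal ((1 / γ) ^ (1 / a)) = c
  calc 2 + 2 * (c * v) ≤ 2 + 2 * (c * v) + (2 * v + 2 * c) := le_self_add
    _ = _ := by ring

theorem NstarS_le_mul {d m : ℕ} {a Cp lam Δ B G : ℝ} {f : E d → E d}
    {g : E d → (E m →L[ℝ] E d)} {z : PathSpace m a → E d} {w : PathSpace m a} (ha : 0 < a)
    (hCp : 0 ≤ Cp) (hlam : 0 < lam) (hΔ : 0 < Δ) (hG : Lg g ≤ G) (hG0 : 0 ≤ G)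
    (hB : ∀ u ∈ grid Δ 0 1, ‖f (z (shift u w))‖ ≤ B) (hB0 : 0 ≤ B) :
    NstarS Cp lam f g Δ z w ≤ ENNReal.ofReal (2 + 2 * (4 / lam * Lf f
        + ((4 / lam) ^ (1 / a) + (4 / lam) ^ (1 / (2 * a))) * ((4 * Cp + 1) * G) ^ (1 / a)))
      * (1 + (xVarPow w (Icc 0 1) + xxVarPow w (Icc 0 1))) + 16 * ENNReal.ofReal B := by
  have hLf := Lf_nonneg f
  have hc : ENNReal.ofReal ((4 * Cp + 1) * Lg g) ^ (1 / a)
      ≤ ENNReal.ofReal (((4 * Cp + 1) * G) ^ (1 / a)) := by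
    rw [← ENNReal.ofReal_rpow_of_nonneg (by positivity) (by positivity)]
    gcongr
  refine (NstarS_le ha hlam hΔ hB hB0).trans ?_
  rw [ENNReal.ofReal_add zero_le_two (by positivity), ENNReal.ofReal_mul zero_le_two,
    ENNReal.ofReal_add (p := 4 / lam * Lf f) (by positivity) (by positivity),
    ENNReal.ofReal_mul (p := (4 / lam) ^ (1 / a) + (4 / lam) ^ (1 / (2 * a))) (by positivity),
    ENNReal.ofReal_add (p := (4 / lam) ^ (1 / a)) (by positivity) (by positivity),
    ENNReal.ofReal_mul (p := 8) (by norm_num), ENNReal.ofReal_ofNat, ENNReal.ofReal_ofNat]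
  generalize xVarPow w (Icc 0 1) = x
  generalize xxVarPow w (Icc 0 1) = y
  generalize ENNReal.ofReal ((4 * Cp + 1) * Lg g) ^ (1 / a) = c at *
  generalize ENNReal.ofReal (((4 * Cp + 1) * G) ^ (1 / a)) = c' at *
  generalize ENNReal.ofReal (4 / lam * Lf f) = k₁
  generalize ENNReal.ofReal ((4 / lam) ^ (1 / a)) = k₂
  generalize ENNReal.ofReal ((4 / lam) ^ (1 / (2 * a))) = k₃
  generalize ENNReal.ofReal B = b
  calc 2 + 2 * (k₁ + k₂ * (c * x) + k₃ * (c * y) + 8 * b)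
      ≤ 2 + 2 * (k₁ + k₂ * (c' * x) + k₃ * (c' * y) + 8 * b) := by gcongr
    _ ≤ 2 + 2 * (k₁ + k₂ * (c' * x) + k₃ * (c' * y) + 8 * b)
        + (2 * (x + y) + 2 * k₁ * (x + y) + 2 * (k₂ + k₃) * c' + 2 * k₂ * c' * y
          + 2 * k₃ * c' * x) := le_self_add
    _ = _ := by ring

/-- Below the mesh threshold, blocks of `N = ⌊1 / Δ⌋` steps have `N Δ η ≥ η / 2`; above it, single
steps have `Δ η ≥ meshBound * η`. In both cases the mean block cost, proportional to `L_g`, is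
smaller once `C` is large. -/
theorem exists_criterionConst (d m : ℕ) {α Cp L F D₁ D₂ G lam γ : ℝ} (hα : 1 / 3 < α)
    (hα' : α ≤ 1 / 2) (hCp : 0 ≤ Cp) (hG : 1 ≤ G) (hL : 0 ≤ L) (hF : 0 ≤ F) (hD1 : 0 < D₁)
    (hD2 : 0 < D₂) (hlam : 0 < lam) (hγ : 0 < γ) :
    ∃ C : ℝ, 0 < C ∧ IsCriterionConst d m α Cp L F D₁ D₂ G lam γ C := by
  have hα0 : 0 < α := by linarith
  have hgr := growthC_pos m hG hL
  have hsh := shortC_pos hα m hG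
  have hmb := meshBound_pos L D₂
  have hnl := nonlinC_nonneg m hG
  obtain ⟨A, hA, hdrift⟩ := exists_drift_bound d m hα hα' hG hL hF hD1 hD2
  obtain ⟨A₁, hA₁⟩ : ∃ A₁, A₁ = 2 + 2 * (1 / γ) ^ (1 / α) := ⟨_, rfl⟩
  obtain ⟨A₂, hA₂⟩ : ∃ A₂, A₂ = 2 + 2 * (4 / lam * L
        + ((4 / lam) ^ (1 / α) + (4 / lam) ^ (1 / (2 * α))) * ((4 * Cp + 1) * G) ^ (1 / α)) :=
    ⟨_, rfl⟩
  obtain ⟨A₃, hA₃⟩ : ∃ A₃, A₃ = growthC m G L * (2 + 2 / shortC α m G) := ⟨_, rfl⟩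
  have hA₁0 : 0 < A₁ := by rw [hA₁]; positivity
  have hA₂0 : 0 < A₂ := by rw [hA₂]; positivity
  have hA₃0 : 0 < A₃ := by rw [hA₃]; positivity
  -- The three summands serve the greedy counts, stability for a fine mesh and stability for a
  -- coarse mesh.
  obtain ⟨C, hC⟩ : ∃ C, C = (2 * A₁ + 4 * A₂ + 32 * A) + A₃ * (2 + A)
    + growthC m G L / meshBound L D₂ := ⟨_, rfl⟩
  have hC1 : 2 * A₁ + 4 * A₂ + 32 * A ≤ C := by
    have : 0 ≤ A₃ * (2 + A) + growthC m G L / meshBound L D₂ := by positivity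
    linarith
  have hC2 : A₃ * (2 + A) ≤ C := by
    have : 0 ≤ (2 * A₁ + 4 * A₂ + 32 * A) + growthC m G L / meshBound L D₂ := by positivity
    linarith
  have hC3 : growthC m G L ≤ meshBound L D₂ * C := by
    have h1 : growthC m G L / meshBound L D₂ ≤ C := by
      have : 0 ≤ (2 * A₁ + 4 * A₂ + 32 * A) + A₃ * (2 + A) := by positivity
      linarith
    rw [div_le_iff₀ hmb] at h1
    linarith
  have hC0 : 0 < C := by rw [hC]; positivity
  refine ⟨C, hC0, ?_⟩
  intro f g Δ ν P _ z hf hLf hF0 hdiss hg hgG hmom hP hΔ hΔ1 hT hz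
  have hcoef := hg.coefBound hG hgG
  have hl0 := hcoef.nonneg
  have hlip := hf.lip
  rw [hLf] at hlip
  have hI := lintegral_one_add_variation_le (P := P) hα0
  constructor
  · intro hmesh
    obtain ⟨hm1, hm2⟩ := le_of_lt_meshBound hD2 hΔ hmesh
    obtain ⟨M, hMm, hM0, hMb, hMI⟩ := hdrift f g Δ P z hf hLf hF0 hdiss hg hgG hΔ hΔ1 hm1 hm2 hP hz
    have h1 : ∫⁻ w, Nstar γ w ∂P ≤ ENNReal.ofReal A₁ * (2 * (1 + roughMoment P)) := by
      refine (lintegral_mono fun w => Nstar_le_mul hα0 hγ w).trans ?_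
      rw [lintegral_const_mul' _ _ ENNReal.ofReal_ne_top, ← hA₁]
      gcongr
    have h2 : ∫⁻ w, NstarS Cp lam f g Δ z w ∂P ≤ ENNReal.ofReal A₂ * (2 * (1 + roughMoment P))
        + 16 * (ENNReal.ofReal A * (1 + roughMoment P)) := by
      have hpt : ∀ᵐ w ∂P, NstarS Cp lam f g Δ z w ≤ ENNReal.ofReal A₂
          * (1 + (xVarPow w (Icc 0 1) + xxVarPow w (Icc 0 1))) + 16 * ENNReal.ofReal (M w) := by
        filter_upwards [hz.ae_solvesScheme] with w hw
        rw [hA₂, ← hLf]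
        refine NstarS_le_mul hα0 hCp hlam hΔ hcoef.le (by linarith) ?_ (hM0 w)
        rintro u ⟨⟨k, rfl⟩, -, hk⟩
        refine hMb w hw k (Nat.le_floor ?_)
        rwa [le_div_iff₀ hΔ]
      refine (lintegral_mono_ae hpt).trans ?_
      rw [lintegral_add_right _ (hMm.ennreal_ofReal.const_mul _),
        lintegral_const_mul' _ _ ENNReal.ofReal_ne_top,
        lintegral_const_mul _ hMm.ennreal_ofReal]
      gcongr
    calc _ ≤ ENNReal.ofReal A₁ * (2 * (1 + roughMoment P))
          + 2 * (ENNReal.ofReal A₂ * (2 * (1 + roughMoment P))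
            + 16 * (ENNReal.ofReal A * (1 + roughMoment P))) := by gcongr
      _ = ENNReal.ofReal (2 * A₁ + 4 * A₂ + 32 * A) * (1 + roughMoment P) := by
          rw [ENNReal.ofReal_add (by positivity) (by positivity),
            ENNReal.ofReal_add (by positivity) (by positivity),
            ENNReal.ofReal_mul (by norm_num), ENNReal.ofReal_mul (by norm_num),
            ENNReal.ofReal_mul (by norm_num), ENNReal.ofReal_ofNat, ENNReal.ofReal_ofNat,
            ENNReal.ofReal_ofNat]
          ring
      _ ≤ _ := by gcongr
  · intro hη
    have hη0 : 0 < eta P f Δ z := by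
      by_contra hcon
      rw [ENNReal.ofReal_of_nonpos (not_lt.1 hcon)] at hη
      exact not_lt_zero hη
    have hx := hmom.integrable_grid hα0 hα' hΔ.le hΔ1
    have hκ : 0 ≤ 4 * Real.exp L * nonlinC m G := by positivity
    -- The factor 2 is what both cases need: for `Δ N ≥ 1 / 2` when the mesh is fine, and for `1 +
    -- ϖ` having mean at most `2 (1 + roughMoment)` when it is coarse.
    have hη2 : ENNReal.ofReal (2 * (C * Lg g)) * (1 + roughMoment P)
        < ENNReal.ofReal (eta P f Δ z) := by
      refine lt_of_le_of_lt ?_ hη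
      refine mul_le_mul_left (ENNReal.ofReal_le_ofReal ?_) _
      nlinarith [mul_nonneg hC0.le hl0]
    by_cases hfine : Δ < meshBound L D₂
    · obtain ⟨hm1, hm2⟩ := le_of_lt_meshBound hD2 hΔ hfine
      obtain ⟨M, hMm, hM0, hMb, hMI⟩ :=
        hdrift f g Δ P z hf hLf hF0 hdiss hg hgG hΔ hΔ1 hm1 hm2 hP hz
      obtain ⟨hN, hN1, hN2⟩ := floor_mesh hΔ hΔ1
      have hblock := hasBlockCost_of_drift_bound (z := z) hα hα' hcoef hlip hL hΔ hN1 hMb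
      generalize ⌊1 / Δ⌋₊ = N at *
      have hNΔ : (N : ℝ) * Δ ≤ 1 := by linarith
      have hgm := measurable_gridControl (m := m) (a := α) Δ 0 N
      have hΨm : Measurable fun w : PathSpace m α =>
          A₃ * Lg g * (1 + gridControl Δ w 0 N + M w) :=
        ((hgm.const_add 1).add hMm).const_mul _
      have hΨ0 : ∀ w, 0 ≤ A₃ * Lg g * (1 + gridControl Δ w 0 N + M w) := fun w => by
        have := gridControl_nonneg Δ w 0 N
        have := hM0 w
        positivity
      have hbound : ∫⁻ w, ENNReal.ofReal (A₃ * Lg g * (1 + gridControl Δ w 0 N + M w)) ∂P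
          < ENNReal.ofReal (N * (Δ * eta P f Δ z)) := by
        have e : ∀ w, ENNReal.ofReal (A₃ * Lg g * (1 + gridControl Δ w 0 N + M w))
            = ENNReal.ofReal (A₃ * Lg g) * (ENNReal.ofReal (1 + gridControl Δ w 0 N)
              + ENNReal.ofReal (M w)) := fun w => by
          have := gridControl_nonneg Δ w 0 N
          rw [ENNReal.ofReal_mul (p := A₃ * Lg g) (by positivity),
            ENNReal.ofReal_add (p := 1 + _) (by positivity) (hM0 w)]
        simp only [e]
        rw [lintegral_const_mul' _ _ ENNReal.ofReal_ne_top,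
          lintegral_add_right _ hMm.ennreal_ofReal]
        calc ENNReal.ofReal (A₃ * Lg g) * (∫⁻ w, ENNReal.ofReal (1 + gridControl Δ w 0 N) ∂P
              + ∫⁻ w, ENNReal.ofReal (M w) ∂P)
            ≤ ENNReal.ofReal (A₃ * Lg g) * (2 * (1 + roughMoment P)
              + ENNReal.ofReal A * (1 + roughMoment P)) := by
              gcongr
              exact lintegral_one_add_gridControl_le hα0 hΔ.le hNΔ
          _ = ENNReal.ofReal (A₃ * Lg g * (2 + A)) * (1 + roughMoment P) := by
              rw [ENNReal.ofReal_mul (p := A₃ * Lg g) (by positivity),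
                ENNReal.ofReal_add (by norm_num) hA, ENNReal.ofReal_ofNat]
              ring
          _ ≤ ENNReal.ofReal (C * Lg g) * (1 + roughMoment P) := by
              refine mul_le_mul_left (ENNReal.ofReal_le_ofReal ?_) _
              nlinarith [mul_le_mul_of_nonneg_right hC2 hl0]
          _ = ENNReal.ofReal (1 / 2)
              * (ENNReal.ofReal (2 * (C * Lg g)) * (1 + roughMoment P)) := by
              rw [← mul_assoc, ← ENNReal.ofReal_mul (by norm_num)]
              ring_nf
          _ < ENNReal.ofReal (1 / 2) * ENNReal.ofReal (eta P f Δ z) :=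
              ENNReal.mul_lt_mul_right (by simp) ENNReal.ofReal_ne_top hη2
          _ = ENNReal.ofReal (1 / 2 * eta P f Δ z) := (ENNReal.ofReal_mul (by norm_num)).symm
          _ ≤ _ := by
              refine ENNReal.ofReal_le_ofReal ?_
              nlinarith
      obtain ⟨hΨi, hΨlt⟩ := integral_lt_of_lintegral_lt hΨm hΨ0 hbound
      rw [← hA₃] at hblock
      exact isExpStable_of_blockCost hT hz hf hΔ hx hN hκ (by rw [hLf]; exact hblock) hΨm hΨ0 hΨi
        hΨlt
    · have hblock := hasBlockCost_one (z := z) hα hα' hcoef hlip hL hΔ hΔ1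
      have hgm := measurable_gridControl (m := m) (a := α) Δ 0 1
      have hΨm : Measurable fun w : PathSpace m α =>
          growthC m G L * Lg g * (1 + gridControl Δ w 0 1) :=
        (hgm.const_add 1).const_mul _
      have hΨ0 : ∀ w : PathSpace m α, 0 ≤ growthC m G L * Lg g * (1 + gridControl Δ w 0 1) :=
        fun w => by
          have := gridControl_nonneg Δ w 0 1
          positivity
      have hbound : ∫⁻ w, ENNReal.ofReal (growthC m G L * Lg g * (1 + gridControl Δ w 0 1)) ∂P
          < ENNReal.ofReal ((1 : ℕ) * (Δ * eta P f Δ z)) := by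
        have e : ∀ w : PathSpace m α, ENNReal.ofReal (growthC m G L * Lg g
            * (1 + gridControl Δ w 0 1)) = ENNReal.ofReal (growthC m G L * Lg g)
              * ENNReal.ofReal (1 + gridControl Δ w 0 1) := fun w =>
          ENNReal.ofReal_mul (by positivity)
        simp only [e]
        rw [lintegral_const_mul' _ _ ENNReal.ofReal_ne_top]
        calc ENNReal.ofReal (growthC m G L * Lg g)
              * ∫⁻ w, ENNReal.ofReal (1 + gridControl Δ w 0 1) ∂P
            ≤ ENNReal.ofReal (meshBound L D₂ * C * Lg g) * (2 * (1 + roughMoment P)) := by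
              gcongr
              exact lintegral_one_add_gridControl_le hα0 hΔ.le (by simpa using hΔ1)
          _ = ENNReal.ofReal (meshBound L D₂)
              * (ENNReal.ofReal (2 * (C * Lg g)) * (1 + roughMoment P)) := by
              rw [mul_assoc (meshBound L D₂), ENNReal.ofReal_mul hmb.le,
                ENNReal.ofReal_mul zero_le_two, ENNReal.ofReal_ofNat]
              ring
          _ < ENNReal.ofReal (meshBound L D₂) * ENNReal.ofReal (eta P f Δ z) :=
              ENNReal.mul_lt_mul_right (by simpa using hmb) ENNReal.ofReal_ne_top hη2
          _ = ENNReal.ofReal (meshBound L D₂ * eta P f Δ z) := (ENNReal.ofReal_mul hmb.le).symm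
          _ ≤ _ := by
              refine ENNReal.ofReal_le_ofReal ?_
              rw [Nat.cast_one, one_mul]
              exact mul_le_mul_of_nonneg_right (not_lt.1 hfine) hη0.le
      obtain ⟨hΨi, hΨlt⟩ := integral_lt_of_lintegral_lt hΨm hΨ0 hbound
      exact isExpStable_of_blockCost hT hz hf hΔ hx le_rfl hκ (by rw [hLf]; exact hblock) hΨm hΨ0
        hΨi hΨlt

theorem five_le_constK {Cp lam L Δ : ℝ} (hCp : 0 ≤ Cp) (hlam : 0 ≤ lam) :
    5 ≤ constK Cp lam L Δ := by
  refine le_trans ?_ (le_max_left _ _)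
  have h1 : 1 ≤ Real.exp (12 * lam + 2 * lam ^ 2) := Real.one_le_exp (by positivity)
  have h2 : 1 ≤ (1 + 2 * Cp) ^ 2 := one_le_pow₀ (by linarith)
  have h3 : 1 ≤ (1 + lam) * (1 + 2 * Cp) ^ 2 * Real.exp (12 * lam + 2 * lam ^ 2) :=
    one_le_mul_of_one_le_of_one_le (one_le_mul_of_one_le_of_one_le (by linarith) h2) h1
  linarith

end RoughEuler

end

/-! ### The criterion with a constant monotone in the norm of the diffusion coefficient. -/

theorem mainTheorem7 (d m : ℕ) (α Cp : ℝ) (hα : 1 / 3 < α) (hα' : α < 1 / 2) (hCp : 1 < Cp) :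
    ∃ (Δstar : ℝ → ℝ → ℝ) (Γ : ℝ → ℝ → ℝ → ℝ → ℝ → ℝ → ℝ → ℝ),
      (∀ L D₂, 0 < Δstar L D₂) ∧
      (∀ L F D₁ D₂ G lam γ, 0 < Γ L F D₁ D₂ G lam γ) ∧
      (∀ L F D₁ D₂ lam γ, Monotone fun G => Γ L F D₁ D₂ G lam γ) ∧
      ∀ (f : RoughEuler.E d → RoughEuler.E d)
        (g : RoughEuler.E d → (RoughEuler.E m →L[ℝ] RoughEuler.E d))
        (D₁ D₂ lam γ Δ ν : ℝ)
        (P : Measure (RoughEuler.PathSpace m α)) [IsProbabilityMeasure P]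
        (z : RoughEuler.PathSpace m α → RoughEuler.E d),
        RoughEuler.DriftRegular f →
        0 < D₁ → 0 < D₂ → RoughEuler.Dissipative f D₁ D₂ →
        RoughEuler.C3b g →
        α < ν → ν ≤ 1 / 2 → RoughEuler.MomentBound P ν →
        RoughEuler.StationaryIncrements P →
        0 < Δ → Δ ≤ 1 → Ergodic (RoughEuler.shift Δ) P →
        RoughEuler.IsStationarySol P f g Δ z →
        0 < lam → lam < 1 / 2 → 0 < γ → γ < 1 →
        (Δ < Δstar (RoughEuler.Lf f) D₂ →
          (∫⁻ w, RoughEuler.Nstar γ w ∂P) + 2 * ∫⁻ w, RoughEuler.NstarS Cp lam f g Δ z w ∂P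
            ≤ ENNReal.ofReal
                (Γ (RoughEuler.Lf f) ‖f 0‖ D₁ D₂ (RoughEuler.normC3b g) lam γ)
              * (1 + RoughEuler.roughMoment P)) ∧
        (0 < RoughEuler.eta P f Δ z →
          ENNReal.ofReal
              (RoughEuler.constK Cp lam (RoughEuler.Lf f) Δ
                * Γ (RoughEuler.Lf f) ‖f 0‖ D₁ D₂ (RoughEuler.normC3b g) lam γ
                * RoughEuler.Lg g)
            * (1 + RoughEuler.roughMoment P)
              < ENNReal.ofReal (RoughEuler.eta P f Δ z) →
          RoughEuler.IsExpStable P f g Δ z) := by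
  have hex : ∀ (n : ℕ) (L F D₁ D₂ lam γ : ℝ), ∃ C : ℝ, 0 < C ∧
      (0 ≤ L → 0 ≤ F → 0 < D₁ → 0 < D₂ → 0 < lam → 0 < γ →
        RoughEuler.IsCriterionConst d m α Cp L F D₁ D₂ (n + 1) lam γ C) := by
    intro n L F D₁ D₂ lam γ
    by_cases h : 0 ≤ L ∧ 0 ≤ F ∧ 0 < D₁ ∧ 0 < D₂ ∧ 0 < lam ∧ 0 < γ
    · obtain ⟨h1, h2, h3, h4, h5, h6⟩ := h
      obtain ⟨C, hC, hcrit⟩ := RoughEuler.exists_criterionConst d m hα hα'.le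
        (show 0 ≤ Cp by linarith) (show (1 : ℝ) ≤ n + 1 by linarith [Nat.cast_nonneg (α := ℝ) n])
        h1 h2 h3 h4 h5 h6
      exact ⟨C, hC, fun _ _ _ _ _ _ => hcrit⟩
    -- Outside the admissible parameters the value 1 keeps the constant positive everywhere.
    · exact ⟨1, one_pos, fun h1 h2 h3 h4 h5 h6 => absurd ⟨h1, h2, h3, h4, h5, h6⟩ h⟩
  choose C hC hcrit using hex
  -- Constants chosen for the norm bounds `k + 1` need not be monotone in `k`; summing these
  -- positive numbers up to `⌈G⌉₊` gives a nondecreasing function of `G` that dominates the one for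
  -- `k = ⌈G⌉₊`. The shift by 1 ensures that the norm bound is at least 1.
  refine ⟨RoughEuler.meshBound, fun L F D₁ D₂ G lam γ =>
    ∑ k ∈ Finset.range (⌈G⌉₊ + 1), C k L F D₁ D₂ lam γ, RoughEuler.meshBound_pos, ?_, ?_, ?_⟩
  · intro L F D₁ D₂ G lam γ
    exact Finset.sum_pos (fun k _ => hC _ _ _ _ _ _ _) ⟨0, Finset.mem_range.2 (Nat.succ_pos _)⟩
  · intro L F D₁ D₂ lam γ G G' hG
    refine Finset.sum_le_sum_of_subset_of_nonneg ?_ fun k _ _ => (hC _ _ _ _ _ _ _).le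
    exact Finset.range_mono (Nat.succ_le_succ (Nat.ceil_mono hG))
  · intro f g D₁ D₂ lam γ Δ ν P _ z hf hD1 hD2 hdiss hg _ _ hmom hP hΔ hΔ1 hT hz hlam _ hγ _
    have key := hcrit ⌈RoughEuler.normC3b g⌉₊ (RoughEuler.Lf f) ‖f 0‖ D₁ D₂ lam γ
      (RoughEuler.Lf_nonneg f) (norm_nonneg _) hD1 hD2 hlam hγ f g Δ ν P z hf rfl rfl hdiss hg
      ((Nat.le_ceil _).trans (by linarith)) hmom hP hΔ hΔ1 hT hz
    have hle : C ⌈RoughEuler.normC3b g⌉₊ (RoughEuler.Lf f) ‖f 0‖ D₁ D₂ lam γ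
        ≤ ∑ k ∈ Finset.range (⌈RoughEuler.normC3b g⌉₊ + 1),
          C k (RoughEuler.Lf f) ‖f 0‖ D₁ D₂ lam γ :=
      Finset.single_le_sum (f := fun k => C k (RoughEuler.Lf f) ‖f 0‖ D₁ D₂ lam γ)
        (fun k _ => (hC _ _ _ _ _ _ _).le) (Finset.mem_range.2 (Nat.lt_succ_self _))
    have h0 := hC ⌈RoughEuler.normC3b g⌉₊ (RoughEuler.Lf f) ‖f 0‖ D₁ D₂ lam γ
    refine ⟨fun h => (key.1 h).trans (by gcongr), fun _ h => key.2 (lt_of_le_of_lt ?_ h)⟩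
    have hK := RoughEuler.five_le_constK (L := RoughEuler.Lf f) (Δ := Δ)
      (show 0 ≤ Cp by linarith) hlam.le
    have hLg := RoughEuler.Lg_nonneg g
    gcongr
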